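/- Let $s_a=(a\ a{+}1)$ for $a\ge 1$. A finite word $w=w_1\cdots w_m$ of positive integers is a reduced word if $m$ is minimal among the lengths of all words representing the permutation $s_{w_1}\cdots s_{w_m}$ (a finitely supported permutation of the positive integers). The Edelman–Greene recording tableau $Q(w)$ is defined as follows. Insert the letters of $w$ from right to left, starting with the empty tableau. To insert $n$ into a row: if no entry of the row exceeds $n$, adjoin $n$ at its end and stop; otherwise let $y$ be the leftmost entry with $y>n$. If $y=n+1$ and the entry immediately to its left is $n$, leave the row unchanged and insert $n+1$ into the next row; otherwise replace $y$ by $n$ and insert $y$ into the next row. Each step adds one box, and $Q(w)$ is the standard Young tableau that records in each box the number of the step in which it was added. For a word $u$ let $u^{(i)}$ be $u$ with its $i$-th letter removed, and let $u^{(i-)}$ be $u$ with $u_i$ replaced by $u_i-1$ if $u_i>1$, and $u$ with every letter except $u_i$ increased by one if $u_i=1$. Let $w$ be a reduced word and $i$ an index such that $w^{(i)}$ is reduced. The Little bump of $w$ at $i$ forms $w^{(i-)}$; if this word is reduced it is the result $w{\uparrow_i}$, and otherwise there is a unique $j\ne i$ such that the $j$-th and $i$-th letters of $w^{(i-)}$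 swap the same pair of values (where the $k$-th letter of a word $u$ swaps the values $\pi(u_k)$ and $\pi(u_k+1)$ with $\pi=s_{u_1}\cdots s_{u_{k-1}}$), and the process continues in the same way by decrementing the $j$-th letter of $w^{(i-)}$, until a reduced word is reached. Two reduced words communicate if one can be changed into the other by a finite (possibly empty) sequence of Little bumps and inverses of Little bumps. **Theorem (Lam's Conjecture).** Let $v$ and $w$ be two reduced words. Then $v$ and $w$ communicate if and only if $Q(v)=Q(w)$. -/

import Mathlib

namespace LittleBumps

/-- The permutation `s_{w₁} s_{w₂} ⋯ s_{w_m}` represented by a word, where `s_i = (i i+1)`.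
Permutations of the positive integers moving finitely many points are realised inside
`Equiv.Perm ℕ`; for words with positive letters they fix `0`. -/
def wordPerm (w : List ℕ) : Equiv.Perm ℕ :=
  (w.map fun a => Equiv.swap a (a + 1)).prod

/-- All letters of the word are positive, i.e. they index the simple transpositions
`s_1, s_2, …`. -/
def IsWord (w : List ℕ) : Prop := ∀ a ∈ w, 1 ≤ a

/-- A word is reduced if it has minimal length among all words for the same permutation. -/
def IsReducedWord (w : List ℕ) : Prop :=
  IsWord w ∧ ∀ u : List ℕ, IsWord u → wordPerm u = wordPerm w → w.length ≤ u.length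

/-! ### Edelman–Greene insertion -/

/-- Insert `n` into a row. The row is cut into the entries `≤ n` and the rest, whose first
entry `y` is the leftmost entry larger than `n`. If there is no such `y`, then `n` is
adjoined at the end. If `y = n + 1` and the entry before it is `n`, the row is unchanged
and `n + 1` is passed on; otherwise `n` replaces `y`, which is passed on. -/
def rowInsert (n : ℕ) (row : List ℕ) : List ℕ × Option ℕ :=
  match row.dropWhile (fun r => decide (r ≤ n)) with
  | [] => (row ++ [n], none)
  | y :: rest =>
    if y = n + 1 ∧ (row.takeWhile (fun r => decide (r ≤ n))).getLast? = some n then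
      (row, some (n + 1))
    else
      (row.takeWhile (fun r => decide (r ≤ n)) ++ n :: rest, some y)

/-- Edelman–Greene insertion of `n` into a tableau, given as its list of rows. The second
component is the (zero-based) number of the row at whose end the new box was added. -/
def tableauInsert : ℕ → List (List ℕ) → List (List ℕ) × ℕ
  | n, [] => ([[n]], 0)
  | n, row :: T =>
    match rowInsert n row with
    | (row', none) => (row' :: T, 0)
    | (row', some k) => (row' :: (tableauInsert k T).1, (tableauInsert k T).2 + 1)

/-- Add a box with the entry `t` at the end of row `r` (zero-based) of a tableau; if there
is no row `r`, a new row is created at the bottom. -/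
def addBox (t : ℕ) : ℕ → List (List ℕ) → List (List ℕ)
  | _, [] => [[t]]
  | 0, row :: Q => (row ++ [t]) :: Q
  | r + 1, row :: Q => row :: addBox t r Q

/-- `EG(w) = (P(w), Q(w))`. The letters of `w` are inserted from right to left, and `Q(w)`
records in each box the step in which it was added. -/
def EG : List ℕ → List (List ℕ) × List (List ℕ)
  | [] => ([], [])
  | a :: w =>
    ((tableauInsert a (EG w).1).1,
      addBox (w.length + 1) (tableauInsert a (EG w).1).2 (EG w).2)

/-- The insertion tableau `P(w)`, as a list of rows. -/
def P (w : List ℕ) : List (List ℕ) := (EG w).1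

/-- The recording tableau `Q(w)`, as a list of rows. -/
def Q (w : List ℕ) : List (List ℕ) := (EG w).2

/-! ### Little bumps (positions in a word are zero-based) -/

/-- The word `w^{(i-)}`: the letter at position `i` is decreased by one, or, if this letter
is `1`, it is kept and every other letter is increased by one. -/
def decrementAt (w : List ℕ) (i : ℕ) : List ℕ :=
  if w[i]? = some 1 then w.mapIdx fun k a => if k = i then a else a + 1
  else w.mapIdx fun k a => if k = i then a - 1 else a

/-- The unordered pair of values exchanged by the letter at position `i < w.length`: if
`π` is the permutation of the first `i` letters and `a` is the letter at position `i`, then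
right multiplication by `s_a` exchanges the values `π(a)` and `π(a+1)`. -/
def swappedValues (w : List ℕ) (i : ℕ) : Sym2 ℕ :=
  s(wordPerm (w.take i) (w.getD i 0), wordPerm (w.take i) (w.getD i 0 + 1))

/-- `BumpFrom w i v`: the process of decrementing, begun with position `i` of `w`, ends in
the reduced word `v`. After a position `i` has been decremented, the process stops if the
resulting word is reduced; otherwise it goes on with the other position `j` whose letter
swaps the same values as the letter at position `i`. -/
inductive BumpFrom : List ℕ → ℕ → List ℕ → Prop
  | last (w : List ℕ) (i : ℕ) (h : IsReducedWord (decrementAt w i)) :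
      BumpFrom w i (decrementAt w i)
  | next (w : List ℕ) (i j : ℕ) (v : List ℕ) (h : ¬ IsReducedWord (decrementAt w i))
      (hj : j < w.length) (hij : j ≠ i)
      (hswap : swappedValues (decrementAt w i) j = swappedValues (decrementAt w i) i)
      (hv : BumpFrom (decrementAt w i) j v) :
      BumpFrom w i v

/-- `v = w↑ᵢ` for some position `i` at which a Little bump may begin: both `w` and the word
`w^{(i)}` obtained from `w` by removing the letter at position `i` are reduced. -/
def LittleBump (w v : List ℕ) : Prop :=
  IsReducedWord w ∧ ∃ i : ℕ, i < w.length ∧ IsReducedWord (w.eraseIdx i) ∧ BumpFrom w i v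

/-- Two words communicate if a finite sequence of Little bumps and inverses of Little bumps
changes one into the other. -/
def Communicate (v w : List ℕ) : Prop := Relation.EqvGen LittleBump v w

end LittleBumps

/-!
A Little bump preserves `Q`, and every `Q` is represented, up to a shift of the letters, by
exactly one word of a Grassmannian permutation with a given descent, to which Little bumps lead.

**Words.** A word of positive integers is treated as a word of integers (`shift`), for which bumps
need no renormalisation (`Bump`). The letter at position `k` exchanges two values, `tr w k`, and a
word is reduced exactly if no pair of values is exchanged twice (`isReducedWord_iff`). A bump runs
through words which become reduced on removal of the marked letter (`NearRed`); it terminates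
(`NearRed.exists_bump`), preserves descents (`Bump.lt_iff`), and multiplies the permutation of the
word without the marked letter by a transposition that involves the value on the lower side of
this letter (`Bump.exists_pre_eq`).

**Rigidity.** The tableau `Q(w)` is recorded by the Yamanouchi word `rowsOf w` of the rows in
which the boxes are added (`Q_eq_iff`). The descents of `rowsOf w` are the ascents of `w`
(`EGRel.lt_iff`), and a Coxeter–Knuth move of `w` does not change `P(w)` and changes `rowsOf w` by
a Knuth move at the same place (`EGRel.knuthAt`). These properties determine `rowsOf`: a relation
between Yamanouchi words that preserves descents and follows all such moves is contained in
equality (`KnuthBisim.eq`). For the tail of the two words this is induction; and if the tails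
agree while the first letters are `p < q`, then moves of the tail bring `q - 1` to its front,
where `q` makes a descent and `p` does not.

**Bumps preserve `Q`.** Little bumps commute with Coxeter–Knuth moves, the marked letters being
those which exchange the same values (`Bump.exists_bump_of_ck`). As they also preserve descents,
rigidity applies (`LittleBump.rowsOf_eq`).

**Equal `Q` implies communication.** By the transitions of Lascoux and Schützenberger, bumps lead
from any reduced word to a word of a permutation with a single possible descent `d`
(`Red.exists_grassmannian`). In a word of such a permutation each letter moves up the value at a
position `d - r`, and the numbers `r` form a Yamanouchi word which determines the word (`GrRel`,
`GrRel.eq_of_rows`). It has the descents and the Knuth moves of `rowsOf w`, so rigidity shows that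
it is `rowsOf w` (`IsReducedWord.grRel_rowsOf`). Hence two reduced words with the same `Q` are
bumped to the same word of integers. The number of renormalisations on the two ways may differ;
but the word with the larger letters can be bumped down to the other one, again by transitions and
uniqueness (`communicate_of_grRel`).
-/

namespace LittleBumps

open Equiv

/-! ### Words of integers and the values exchanged by their letters -/

theorem swap_eq_swap_iff {a b x y : ℤ} (hab : a ≠ b) :
    swap a b = swap x y ↔ (x = a ∧ y = b) ∨ (x = b ∧ y = a) := by
  constructor
  · intro h
    have h1 : swap x y a = b := by rw [← h, swap_apply_left]
    rw [swap_apply_def] at h1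
    split_ifs at h1 with h2 h3
    · exact Or.inl ⟨h2.symm, h1⟩
    · exact Or.inr ⟨h1, h3.symm⟩
    · exact absurd h1 hab
  · rintro (⟨rfl, rfl⟩ | ⟨rfl, rfl⟩)
    · rfl
    · exact swap_comm _ _

/-- The permutation of the first `k` letters of `w`. A word of integers is a function `ℕ → ℤ`, of
which only the values below the length, given separately, matter. -/
def pre (w : ℕ → ℤ) : ℕ → Perm ℤ
  | 0 => 1
  | k + 1 => pre w k * swap (w k) (w k + 1)

/-- The letter at position `k` of `w` seen as a transposition of values. -/
def tr (w : ℕ → ℤ) (k : ℕ) : Perm ℤ := swap (pre w k (w k)) (pre w k (w k + 1))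

/-- The position of the value `x` after the first `k` letters of `w`. -/
def pos (w : ℕ → ℤ) (k : ℕ) (x : ℤ) : ℤ := (pre w k)⁻¹ x

@[simp] theorem pre_zero (w : ℕ → ℤ) : pre w 0 = 1 := rfl

theorem pre_succ (w : ℕ → ℤ) (k : ℕ) : pre w (k + 1) = pre w k * swap (w k) (w k + 1) := rfl

theorem tr_eq_conj (w : ℕ → ℤ) (k : ℕ) :
    tr w k = pre w k * swap (w k) (w k + 1) * (pre w k)⁻¹ := swap_apply_apply _ _ _

theorem pre_succ' (w : ℕ → ℤ) (k : ℕ) : pre w (k + 1) = tr w k * pre w k := by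
  rw [tr_eq_conj, pre_succ]; group

@[simp] theorem tr_mul_self (w : ℕ → ℤ) (k : ℕ) : tr w k * tr w k = 1 := swap_mul_self _ _

@[simp] theorem tr_inv (w : ℕ → ℤ) (k : ℕ) : (tr w k)⁻¹ = tr w k := swap_inv _ _

@[simp] theorem tr_mul_self_assoc (w : ℕ → ℤ) (k : ℕ) (p : Perm ℤ) :
    tr w k * (tr w k * p) = p := by rw [← mul_assoc, tr_mul_self, one_mul]

@[simp] theorem pos_zero (w : ℕ → ℤ) (x : ℤ) : pos w 0 x = x := rfl

theorem pos_succ (w : ℕ → ℤ) (k : ℕ) (x : ℤ) :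
    pos w (k + 1) x = swap (w k) (w k + 1) (pos w k x) := by
  simp only [pos, pre_succ, mul_inv_rev, swap_inv, Perm.mul_apply]

theorem pos_pre (w : ℕ → ℤ) (k : ℕ) (x : ℤ) : pos w k (pre w k x) = x := by
  simp [pos]

theorem pre_pos (w : ℕ → ℤ) (k : ℕ) (x : ℤ) : pre w k (pos w k x) = x := by
  simp [pos]

theorem pos_eq_iff (w : ℕ → ℤ) (k : ℕ) (x a : ℤ) : pos w k x = a ↔ x = pre w k a := by
  rw [pos, Perm.inv_eq_iff_eq]

theorem pos_inj (w : ℕ → ℤ) (k : ℕ) {x y : ℤ} : pos w k x = pos w k y ↔ x = y :=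
  (pre w k)⁻¹.injective.eq_iff

theorem tr_eq_swap_iff {w : ℕ → ℤ} {k : ℕ} {x y : ℤ} :
    tr w k = swap x y ↔
      (pos w k x = w k ∧ pos w k y = w k + 1) ∨ (pos w k x = w k + 1 ∧ pos w k y = w k) := by
  rw [tr, swap_eq_swap_iff (by simp), pos_eq_iff, pos_eq_iff, pos_eq_iff, pos_eq_iff]

theorem pos_succ_cases (w : ℕ → ℤ) (k : ℕ) (x : ℤ) :
    (pos w k x = w k ∧ pos w (k + 1) x = w k + 1) ∨
    (pos w k x = w k + 1 ∧ pos w (k + 1) x = w k) ∨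
    (pos w k x ≠ w k ∧ pos w k x ≠ w k + 1 ∧ pos w (k + 1) x = pos w k x) := by
  rw [pos_succ, swap_apply_def]
  split_ifs <;> omega

/-- Two values change their relative order only when they are exchanged. -/
theorem pos_succ_lt_iff_of_ne {w : ℕ → ℤ} {k : ℕ} {x y : ℤ} (h : tr w k ≠ swap x y) :
    pos w (k + 1) x < pos w (k + 1) y ↔ pos w k x < pos w k y := by
  by_cases hxy : x = y
  · simp [hxy]
  rw [Ne, tr_eq_swap_iff] at h
  have h1 := pos_succ_cases w k x
  have h2 := pos_succ_cases w k y
  have h3 := (pos_inj w k (x := x) (y := y)).not.mpr hxy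
  omega

theorem pos_succ_lt_iff_of_eq {w : ℕ → ℤ} {k : ℕ} {x y : ℤ} (h : tr w k = swap x y) :
    pos w (k + 1) x < pos w (k + 1) y ↔ pos w k y < pos w k x := by
  rw [tr_eq_swap_iff] at h
  have h1 := pos_succ_cases w k x
  have h2 := pos_succ_cases w k y
  omega

theorem pos_lt_iff_of_forall_ne {w : ℕ → ℤ} {k l : ℕ} {x y : ℤ} (hkl : k ≤ l)
    (h : ∀ j, k ≤ j → j < l → tr w j ≠ swap x y) :
    pos w l x < pos w l y ↔ pos w k x < pos w k y := by
  induction l, hkl using Nat.le_induction with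
  | base => rfl
  | succ l hl ih =>
    rw [pos_succ_lt_iff_of_ne (h l hl (Nat.lt_succ_self l)),
      ih fun j hj hjl => h j hj (hjl.trans (Nat.lt_succ_self l))]

/-- A word of length `m` is reduced if no pair of values is exchanged twice. -/
def Red (m : ℕ) (w : ℕ → ℤ) : Prop := ∀ i < m, ∀ j < m, tr w i = tr w j → i = j

/-- An inversion comes from a letter which exchanges the two values. -/
theorem exists_tr_eq {w : ℕ → ℤ} {m : ℕ} {x y : ℤ} (hxy : x < y)
    (h : pos w m y < pos w m x) : ∃ i < m, tr w i = swap x y := by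
  by_contra! hc
  have := pos_lt_iff_of_forall_ne (w := w) (x := x) (y := y) (Nat.zero_le m)
    fun j _ hj => hc j hj
  simp only [pos_zero] at this
  omega

theorem Red.pos_lt_before {w : ℕ → ℤ} {m i k : ℕ} {x y : ℤ} (hw : Red m w) (hi : i < m)
    (h : tr w i = swap x y) (hxy : x < y) (hk : k ≤ i) : pos w k x < pos w k y := by
  rw [pos_lt_iff_of_forall_ne (Nat.zero_le k)]
  · simpa
  · intro j _ hj hj'
    have := hw j (by omega) i hi (hj'.trans h.symm)
    omega

theorem Red.pos_lt_after {w : ℕ → ℤ} {m i k : ℕ} {x y : ℤ} (hw : Red m w)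
    (h : tr w i = swap x y) (hxy : x < y) (hk : i < k) (hkm : k ≤ m) :
    pos w k y < pos w k x := by
  have h1 := hw.pos_lt_before (k := i) (by omega) h hxy le_rfl
  rw [pos_lt_iff_of_forall_ne (k := i + 1) hk]
  · rw [swap_comm] at h
    rwa [pos_succ_lt_iff_of_eq h]
  · intro j hj hjk hj'
    rw [swap_comm] at hj'
    have := hw j (by omega) i (by omega) (hj'.trans h.symm)
    omega

theorem tr_eq_swap_lt (w : ℕ → ℤ) (k : ℕ) : ∃ x y, x < y ∧ tr w k = swap x y := by
  rcases lt_or_gt_of_ne (a := pre w k (w k)) (b := pre w k (w k + 1)) (by simp) with h | h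
  · exact ⟨_, _, h, rfl⟩
  · exact ⟨_, _, h, swap_comm _ _⟩

/-- In a reduced word the letters correspond to the inversions of the permutation. -/
theorem Red.exists_tr_iff {w : ℕ → ℤ} {m : ℕ} {x y : ℤ} (hw : Red m w) (hxy : x < y) :
    (∃ i < m, tr w i = swap x y) ↔ pos w m y < pos w m x :=
  ⟨fun ⟨_, hi, h⟩ => hw.pos_lt_after h hxy hi le_rfl, exists_tr_eq hxy⟩

open Classical in
/-- Every inversion is needed in every word for the same permutation. -/
theorem Red.image_tr_subset {w v : ℕ → ℤ} {m n : ℕ} (hw : Red m w) (h : pre w m = pre v n) :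
    (Finset.range m).image (tr w) ⊆ (Finset.range n).image (tr v) := by
  intro t ht
  simp only [Finset.mem_image, Finset.mem_range] at ht ⊢
  obtain ⟨i, hi, rfl⟩ := ht
  obtain ⟨x, y, hxy, ht⟩ := tr_eq_swap_lt w i
  have := (hw.exists_tr_iff hxy).1 ⟨i, hi, ht⟩
  simp only [pos, h] at this
  rw [ht]
  exact exists_tr_eq hxy this

open Classical in
theorem Red.card_image_tr {w : ℕ → ℤ} {m : ℕ} (hw : Red m w) :
    ((Finset.range m).image (tr w)).card = m := by
  rw [Finset.card_image_of_injOn, Finset.card_range]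
  intro i hi j hj hij
  exact hw i (by simpa using hi) j (by simpa using hj) hij

/-- A reduced word is a shortest word for its permutation. -/
theorem Red.length_le {w v : ℕ → ℤ} {m n : ℕ} (hw : Red m w) (h : pre w m = pre v n) :
    m ≤ n := by
  classical
  have hcard := (Finset.card_le_card (hw.image_tr_subset h)).trans Finset.card_image_le
  rwa [hw.card_image_tr, Finset.card_range] at hcard

/-- Being reduced depends only on the length and the permutation. -/
theorem Red.of_pre_eq {w v : ℕ → ℤ} {m : ℕ} (hw : Red m w) (h : pre w m = pre v m) :
    Red m v := by
  classical
  have hcard := Finset.card_le_card (hw.image_tr_subset h)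
  rw [hw.card_image_tr] at hcard
  have h2 := Finset.card_image_iff.1
    (le_antisymm Finset.card_image_le (by rwa [Finset.card_range]))
  intro i hi j hj hij
  exact h2 (by simpa using hi) (by simpa using hj) hij

/-- The word `w` with the letter at position `i` removed. -/
def del (w : ℕ → ℤ) (i : ℕ) : ℕ → ℤ := fun j => if j < i then w j else w (j + 1)

/-- The word `w` with the letter at position `i` decreased by one. -/
def dec (w : ℕ → ℤ) (i : ℕ) : ℕ → ℤ := Function.update w i (w i - 1)

theorem pre_congr {w v : ℕ → ℤ} {k : ℕ} (h : ∀ j < k, w j = v j) : pre w k = pre v k := by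
  induction k with
  | zero => rfl
  | succ k ih => rw [pre_succ, pre_succ, ih fun j hj => h j (by omega), h k (by omega)]

theorem tr_congr {w v : ℕ → ℤ} {k : ℕ} (h : ∀ j ≤ k, w j = v j) : tr w k = tr v k := by
  rw [tr, tr, pre_congr fun j hj => h j (by omega), h k le_rfl]

theorem pre_del_le {w : ℕ → ℤ} {i j : ℕ} (h : j ≤ i) : pre (del w i) j = pre w j :=
  pre_congr fun l hl => if_pos (by omega)

theorem pre_del_ge {w : ℕ → ℤ} {i j : ℕ} (h : i ≤ j) :
    pre (del w i) j = tr w i * pre w (j + 1) := by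
  induction j, h using Nat.le_induction with
  | base => rw [pre_del_le le_rfl, pre_succ', tr_mul_self_assoc]
  | succ j hj ih => rw [pre_succ, ih, pre_succ w (j + 1), mul_assoc, del, if_neg (by omega)]

theorem tr_del_lt {w : ℕ → ℤ} {i j : ℕ} (h : j < i) : tr (del w i) j = tr w j :=
  tr_congr fun l hl => if_pos (by omega)

theorem tr_del_ge {w : ℕ → ℤ} {i j : ℕ} (h : i ≤ j) :
    tr (del w i) j = tr w i * tr w (j + 1) * tr w i := by
  rw [tr_eq_conj, pre_del_ge h, del, if_neg (by omega), tr_eq_conj w (j + 1)]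
  simp [mul_assoc]

/-- The word `w` of length `m` is nearly reduced at `i`: it becomes reduced when the letter at
position `i` is removed. -/
def NearRed (m : ℕ) (w : ℕ → ℤ) (i : ℕ) : Prop := i < m ∧ Red (m - 1) (del w i)

/-- `NearRed` in terms of the transpositions of `w` itself: those to the right of the removed
letter are conjugated by its transposition. -/
theorem NearRed.of_eq {m : ℕ} {w : ℕ → ℤ} {i j l : ℕ} (h : NearRed m w i) (hj : j < m)
    (hl : l < m) (hji : j ≠ i) (hli : l ≠ i)
    (he : (if j < i then tr w j else tr w i * tr w j * tr w i) =
      (if l < i then tr w l else tr w i * tr w l * tr w i)) : j = l := by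
  obtain ⟨hi, h⟩ := h
  have key : ∀ j, j ≠ i → (if j < i then tr w j else tr w i * tr w j * tr w i) =
      tr (del w i) (if j < i then j else j - 1) := by
    intro j hj
    by_cases hlt : j < i
    · rw [if_pos hlt, if_pos hlt, tr_del_lt hlt]
    · rw [if_neg hlt, if_neg hlt, tr_del_ge (by omega), Nat.sub_add_cancel (by omega)]
  rw [key j hji, key l hli] at he
  have := h _ (by split_ifs <;> omega) _ (by split_ifs <;> omega) he
  split_ifs at this <;> omega

theorem NearRed.partner_unique {m : ℕ} {w : ℕ → ℤ} {i j l : ℕ} (h : NearRed m w i) (hj : j < m)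
    (hl : l < m) (hji : j ≠ i) (hli : l ≠ i) (hj' : tr w j = tr w i) (hl' : tr w l = tr w i) :
    j = l :=
  h.of_eq hj hl hji hli (by simp [hj', hl'])

theorem NearRed.pre_del {m : ℕ} {w : ℕ → ℤ} {i : ℕ} (h : i < m) :
    pre (del w i) (m - 1) = tr w i * pre w m := by
  rw [pre_del_ge (by omega), Nat.sub_add_cancel (by omega)]

/-- After a decrement, the process may go on with any letter exchanging the same values. -/
theorem NearRed.partner {m : ℕ} {w : ℕ → ℤ} {i j : ℕ} (h : NearRed m w i) (hj : j < m)
    (hj' : tr w j = tr w i) : NearRed m w j :=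
  ⟨hj, h.2.of_pre_eq (by rw [NearRed.pre_del h.1, NearRed.pre_del hj, hj'])⟩

theorem del_dec (w : ℕ → ℤ) (i : ℕ) : del (dec w i) i = del w i := by
  funext j
  simp only [del, dec]
  split_ifs <;> rw [Function.update_of_ne (by omega)]

theorem NearRed.after_dec {m : ℕ} {w : ℕ → ℤ} {i : ℕ} (h : NearRed m w i) : NearRed m (dec w i) i :=
  ⟨h.1, by rw [del_dec]; exact h.2⟩

theorem swap_conj_swap (a b x y : ℤ) :
    swap a b * swap x y * swap a b = swap (swap a b x) (swap a b y) := by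
  rw [swap_apply_apply, swap_inv]

/-! ### Nearly reduced words and Little bumps -/

theorem Red.pos_lt_iff_before {w : ℕ → ℤ} {m i k : ℕ} {x y : ℤ} (hw : Red m w) (hi : i < m)
    (h : tr w i = swap x y) (hk : k ≤ i) : pos w k x < pos w k y ↔ x < y := by
  rcases lt_trichotomy x y with hxy | rfl | hxy
  · simp [hxy, hw.pos_lt_before hi h hxy hk]
  · simp
  · rw [swap_comm] at h
    have := hw.pos_lt_before hi h hxy hk
    omega

theorem Red.pos_lt_iff_after {w : ℕ → ℤ} {m i k : ℕ} {x y : ℤ} (hw : Red m w)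
    (h : tr w i = swap x y) (hk : i < k) (hkm : k ≤ m) : pos w k x < pos w k y ↔ y < x := by
  rcases lt_trichotomy x y with hxy | rfl | hxy
  · have := hw.pos_lt_after h hxy hk hkm
    omega
  · simp
  · rw [swap_comm] at h
    simp [hxy, hw.pos_lt_after h hxy hk hkm]

theorem Red.exists_tr_of_ne {w : ℕ → ℤ} {m : ℕ} {x y : ℤ}
    (h : ¬ (pos w m x < pos w m y ↔ x < y)) : ∃ i < m, tr w i = swap x y := by
  have h1 := (pos_inj w m (x := x) (y := y))
  rcases lt_trichotomy x y with hxy | rfl | hxy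
  · exact exists_tr_eq hxy (by omega)
  · simp at h
  · rw [swap_comm]
    exact exists_tr_eq hxy (by omega)

/-- Two transpositions whose conjugate differs from the second one share exactly one element. -/
theorem exists_swaps_of_conj_ne {t p : Perm ℤ} (ht : ∃ a b, a < b ∧ t = swap a b)
    (hp : ∃ x y, x < y ∧ p = swap x y) (hne : t * p * t ≠ p) :
    ∃ C D E, C ≠ D ∧ C ≠ E ∧ D ≠ E ∧ t = swap C D ∧ p = swap C E ∧ t * p * t = swap D E := by
  obtain ⟨a, b, hab, rfl⟩ := ht
  obtain ⟨x, y, hxy, rfl⟩ := hp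
  rw [swap_conj_swap] at hne ⊢
  by_cases hxa : x = a
  · subst hxa
    by_cases hyb : y = b
    · subst hyb; simp [swap_comm] at hne
    · refine ⟨x, b, y, hab.ne, hxy.ne, Ne.symm hyb, rfl, rfl, ?_⟩
      rw [swap_apply_left, swap_apply_of_ne_of_ne hxy.ne' hyb]
  by_cases hxb : x = b
  · subst hxb
    refine ⟨x, a, y, hab.ne', hxy.ne, by omega, swap_comm _ _, rfl, ?_⟩
    rw [swap_apply_right, swap_apply_of_ne_of_ne (by omega) hxy.ne']
  by_cases hya : y = a
  · subst hya
    refine ⟨y, b, x, hab.ne, hxy.ne', by omega, rfl, swap_comm _ _, ?_⟩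
    rw [swap_apply_left, swap_apply_of_ne_of_ne hxa hxb, swap_comm]
  by_cases hyb : y = b
  · subst hyb
    refine ⟨y, a, x, hab.ne', hxy.ne', by omega, swap_comm _ _, swap_comm _ _, ?_⟩
    rw [swap_apply_right, swap_apply_of_ne_of_ne hxa hxb, swap_comm]
  · rw [swap_apply_of_ne_of_ne hxa hxb, swap_apply_of_ne_of_ne hya hyb] at hne
    exact absurd rfl hne

theorem tr_conj_eq_iff {w : ℕ → ℤ} {i : ℕ} {p q : Perm ℤ} :
    tr w i * p * tr w i = q ↔ p = tr w i * q * tr w i := by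
  constructor <;> rintro rfl <;> simp [mul_assoc]

/-- If a nearly reduced word is not reduced, the marked letter exchanges the same values as
another letter. -/
theorem NearRed.exists_partner {m : ℕ} {w : ℕ → ℤ} {i : ℕ} (h : NearRed m w i)
    (hw : ¬ Red m w) : ∃ j < m, j ≠ i ∧ tr w j = tr w i := by
  by_contra! hc
  apply hw
  -- A pair exchanged twice has the marked letter strictly between its two letters.
  have key : ∀ j l, j < l → l < m → tr w j = tr w l → False := by
    intro j l hjl hl hjl'
    have hji : j ≠ i := fun e => hc l hl (by omega) (by rw [← hjl', e])
    have hli : l ≠ i := fun e => hc j (by omega) hji (by rw [hjl', e])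
    have hsplit : j < i ∧ i < l := by
      by_contra hn
      have := h.of_eq (j := j) (l := l) (by omega) hl hji hli (by
        by_cases h1 : j < i
        · rw [if_pos h1, if_pos (by omega), hjl']
        · rw [if_neg h1, if_neg (by omega), hjl'])
      omega
    obtain ⟨hlt, hgt⟩ := hsplit
    obtain ⟨hi, hu⟩ := h
    have huj : tr (del w i) j = tr w j := tr_del_lt hlt
    have hul : tr (del w i) (l - 1) = tr w i * tr w j * tr w i := by
      rw [tr_del_ge (by omega), Nat.sub_add_cancel (by omega), hjl']
    obtain ⟨C, D, E, hCD, hCE, hDE, ht, hp, hq⟩ := exists_swaps_of_conj_ne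
      (tr_eq_swap_lt w i) (tr_eq_swap_lt w j) (fun he => by
        have := hu (l - 1) (by omega) j (by omega) (by rw [huj, hul, he])
        omega)
    rw [hp] at huj
    rw [hq] at hul
    have o1 := hu.pos_lt_iff_after huj (k := i) hlt (by omega)
    have o2 := hu.pos_lt_iff_before (by omega) hul (k := i) (by omega)
    have o3 := hu.pos_lt_iff_after huj (k := m - 1) (by omega) le_rfl
    have o4 := hu.pos_lt_iff_after hul (k := m - 1) (by omega) le_rfl
    have hadj := tr_eq_swap_iff.1 ht
    have e1 : pos (del w i) i = pos w i := by funext x; rw [pos, pos, pre_del_le le_rfl]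
    rw [e1] at o1 o2
    have i1 := pos_inj w i (x := C) (y := E)
    have i2 := pos_inj w i (x := D) (y := E)
    have i3 := pos_inj (del w i) (m - 1) (x := C) (y := E)
    have i4 := pos_inj (del w i) (m - 1) (x := D) (y := E)
    obtain ⟨k, hk, hk'⟩ := Red.exists_tr_of_ne (w := del w i) (m := m - 1) (x := C) (y := D)
      (by omega)
    rw [← ht] at hk'
    by_cases hki : k < i
    · rw [tr_del_lt hki] at hk'
      exact hc k (by omega) (by omega) hk'
    · rw [tr_del_ge (by omega), tr_conj_eq_iff] at hk'
      exact hc (k + 1) (by omega) (by omega) (by simpa using hk')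
  intro j hj l hl hjl
  rcases lt_trichotomy j l with hlt | rfl | hlt
  · exact (key j l hlt hl hjl).elim
  · rfl
  · exact (key l j hlt hj hjl.symm).elim

/-- A letter of a reduced word can be removed if it exchanges two values between which, in value
and in final position, there is no third one. -/
theorem Red.nearRed_of_cover {m : ℕ} {w : ℕ → ℤ} {i : ℕ} {x y : ℤ} (hw : Red m w) (hi : i < m)
    (hxy : x < y) (ht : tr w i = swap x y)
    (hcov : ∀ z, x < z → z < y → pos w m y < pos w m z → pos w m z < pos w m x → False) :
    NearRed m w i := by
  refine ⟨hi, ?_⟩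
  have key : ∀ j l, j < i → i ≤ l → l < m - 1 → tr (del w i) j = tr (del w i) l → False := by
    intro j l hj hl hlm he
    rw [tr_del_lt hj, tr_del_ge hl, eq_comm, tr_conj_eq_iff] at he
    obtain ⟨C, D, E, hCD, hCE, hDE, ht', hp, hq⟩ := exists_swaps_of_conj_ne
      (tr_eq_swap_lt w i) (tr_eq_swap_lt w j) (fun h => by
        have := hw (l + 1) (by omega) j (by omega) (by rw [he, h])
        omega)
    rw [← he] at hq
    have o1 := hw.pos_lt_iff_after hp (k := i) hj (by omega)
    have o2 := hw.pos_lt_iff_before (by omega) hq (k := i) (by omega)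
    have o3 := hw.pos_lt_iff_after hp (k := m) (by omega) le_rfl
    have o4 := hw.pos_lt_iff_after hq (k := m) (by omega) le_rfl
    have o5 := hw.pos_lt_iff_after ht' (k := m) (by omega) le_rfl
    have hadj := tr_eq_swap_iff.1 ht'
    have i1 := pos_inj w i (x := C) (y := E)
    have i2 := pos_inj w i (x := D) (y := E)
    have i3 := pos_inj w m (x := C) (y := E)
    have i4 := pos_inj w m (x := D) (y := E)
    have hc := hcov E
    rw [ht, swap_eq_swap_iff (by omega)] at ht'
    rcases ht' with ⟨rfl, rfl⟩ | ⟨rfl, rfl⟩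
    · apply hc <;> omega
    · apply hc <;> omega
  intro j hj l hl he
  by_cases h1 : j < i <;> by_cases h2 : l < i
  · rw [tr_del_lt h1, tr_del_lt h2] at he
    exact hw _ (by omega) _ (by omega) he
  · exact (key j l h1 (by omega) hl he).elim
  · exact (key l j h2 (by omega) hj he.symm).elim
  · rw [tr_del_ge (by omega), tr_del_ge (by omega)] at he
    have := hw (j + 1) (by omega) (l + 1) (by omega) (by simpa using he)
    omega

/-- `Bump m w i v`: decrementing the word `w` of length `m`, beginning at position `i`, ends in
the reduced word `v`. -/
inductive Bump (m : ℕ) : (ℕ → ℤ) → ℕ → (ℕ → ℤ) → Prop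
  | last (w : ℕ → ℤ) (i : ℕ) (h : Red m (dec w i)) : Bump m w i (dec w i)
  | next (w : ℕ → ℤ) (i j : ℕ) (v : ℕ → ℤ) (h : ¬ Red m (dec w i)) (hj : j < m) (hij : j ≠ i)
      (ht : tr (dec w i) j = tr (dec w i) i) (hv : Bump m (dec w i) j v) : Bump m w i v

theorem Bump.red {m : ℕ} {w v : ℕ → ℤ} {i : ℕ} (h : Bump m w i v) : Red m v := by
  induction h with
  | last w i h => exact h
  | next w i j v h hj hij ht hv ih => exact ih

/-- Letters never increase. -/
theorem Bump.le {m : ℕ} {w v : ℕ → ℤ} {i : ℕ} (h : Bump m w i v) :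
    (∀ k, v k ≤ w k) ∧ v i < w i := by
  have hd : ∀ (w : ℕ → ℤ) i, (∀ k, dec w i k ≤ w k) ∧ dec w i i < w i := by
    intro w i
    refine ⟨fun k => ?_, by simp [dec]⟩
    by_cases hk : k = i
    · subst hk; simp [dec]
    · simp [dec, hk]
  induction h with
  | last w i h => exact hd w i
  | next w i j v h hj hij ht hv ih =>
    exact ⟨fun k => (ih.1 k).trans ((hd w i).1 k), (ih.1 i).trans_lt (hd w i).2⟩

/-! ### Bumps terminate -/

/-- If the letter `x` does not occur, then no value crosses the gap between the positions `x` and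
`x + 1`. -/
theorem pre_apply_le_iff {w : ℕ → ℤ} {k : ℕ} {x : ℤ} (h : ∀ j < k, w j ≠ x) (y : ℤ) :
    pos w k y ≤ x ↔ y ≤ x := by
  induction k with
  | zero => simp
  | succ k ih =>
    rw [← ih fun j hj => h j (by omega)]
    have h1 := h k (by omega)
    have h2 := pos_succ_cases w k y
    omega

/-- The letters of a reduced word lie in the support of its permutation. -/
theorem Red.lt_letter {m : ℕ} {w : ℕ → ℤ} {L : ℤ} (hw : Red m w)
    (hL : ∀ x ≤ L, pos w m x = x) : ∀ j < m, L < w j := by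
  classical
  by_contra! hc
  obtain ⟨j, hj, hjL⟩ := hc
  have hex : ∃ k, k < m ∧ w k = w j := ⟨j, hj, rfl⟩
  set k := Nat.find hex with hk
  obtain ⟨hkm, hkj⟩ := Nat.find_spec hex
  rw [← hk] at hkm hkj
  have hmin : ∀ l < k, w l ≠ w j := fun l hl h => Nat.find_min hex hl ⟨by omega, h⟩
  -- The first letter equal to `w j` exchanges a value `X ≤ w j` with a value `Y > w j`.
  have hX := pre_apply_le_iff hmin (pre w k (w k))
  have hY := pre_apply_le_iff hmin (pre w k (w k + 1))
  rw [pos_pre] at hX hY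
  have hlt := hw.pos_lt_after (i := k) (k := m) (x := pre w k (w k)) (y := pre w k (w k + 1))
    rfl (by omega) hkm le_rfl
  have h1 := hL (pre w k (w k)) (by omega)
  have h2 := hL (pos w m (pre w k (w k + 1))) (by omega)
  rw [pos_inj] at h2
  omega

theorem pos_of_lt_letters {k : ℕ} {w : ℕ → ℤ} {L : ℤ} (h : ∀ j < k, L < w j) {x : ℤ}
    (hx : x ≤ L) : pos w k x = x := by
  induction k with
  | zero => rfl
  | succ k ih =>
    have h1 := pos_succ_cases w k x
    have h2 := h k (by omega)
    have h3 := ih fun j hj => h j (by omega)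
    omega

/-- As long as a bump goes on, the decremented word stays in the support of the permutation of the
word without the marked letter, which does not change during the bump. -/
theorem NearRed.lt_letter {m : ℕ} {w : ℕ → ℤ} {i : ℕ} {L : ℤ} (h : NearRed m w i)
    (hw : ¬ Red m w) (hL : ∀ x ≤ L, pos (del w i) (m - 1) x = x) : ∀ j < m, L < w j := by
  have hu := h.2.lt_letter hL
  obtain ⟨j, hj, hji, htj⟩ := h.exists_partner hw
  have hmark : L < w i := by
    by_contra hle
    have hpos : ∀ x ≤ L, pos w i x = x := fun x hx =>
      pos_of_lt_letters (fun l hl => by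
        have := hu l (by have := h.1; omega)
        rwa [del, if_pos hl] at this) hx
    have hC : pre w i (w i) = w i := ((pos_eq_iff _ _ _ _).1 (hpos _ (by omega))).symm
    -- The marked letter exchanges the value `w i ≤ L` with a larger one.
    have hV : w i < pre w i (w i + 1) := by
      by_contra hV
      have := hpos _ (show pre w i (w i + 1) ≤ L by omega)
      rw [pos_pre] at this
      omega
    have hk : ∃ k < m - 1, tr (del w i) k = swap (w i) (pre w i (w i + 1)) := by
      have htr : tr w i = swap (w i) (pre w i (w i + 1)) := by rw [tr, hC]
      rw [← htr]
      by_cases hji' : j < i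
      · exact ⟨j, by have := h.1; omega, by rw [tr_del_lt hji', htj]⟩
      · refine ⟨j - 1, by omega, ?_⟩
        rw [tr_del_ge (by omega), Nat.sub_add_cancel (by omega), htj]
        simp
    have hlt := (h.2.exists_tr_iff hV).1 hk
    have h1 := hL (w i) (by omega)
    have h2 := hL (pos (del w i) (m - 1) (pre w i (w i + 1))) (by omega)
    rw [pos_inj] at h2
    omega
  intro l hl
  rcases lt_trichotomy l i with hli | rfl | hli
  · have := hu l (by have := h.1; omega)
    rwa [del, if_pos hli] at this
  · exact hmark
  · have := hu (l - 1) (by omega)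
    rwa [del, if_neg (by omega), Nat.sub_add_cancel (by omega)] at this

theorem exists_forall_pos_eq (w : ℕ → ℤ) (k : ℕ) :
    ∃ N : ℤ, 0 ≤ N ∧ ∀ x, (x < -N ∨ N < x) → pos w k x = x := by
  induction k with
  | zero => exact ⟨0, le_rfl, fun x _ => rfl⟩
  | succ k ih =>
    obtain ⟨N, hN0, hN⟩ := ih
    refine ⟨max N (max (w k + 1) (-w k)), by omega, fun x hx => ?_⟩
    have h1 := hN x (by omega)
    have h2 := pos_succ_cases w k x
    omega

/-- Bumps terminate: the letters are bounded below as long as the word is not reduced, and their sum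
decreases. -/
theorem NearRed.exists_bump {m : ℕ} {w : ℕ → ℤ} {i : ℕ} (h : NearRed m w i) :
    ∃ v, Bump m w i v := by
  obtain ⟨N, hN0, hN⟩ := exists_forall_pos_eq (del w i) (m - 1)
  have key : ∀ (n : ℕ) (w : ℕ → ℤ) (i : ℕ), NearRed m w i →
      (∀ x ≤ -N - 1, pos (del w i) (m - 1) x = x) →
      ∑ j ∈ Finset.range m, (w j - (-N - 1)) ≤ n → ∃ v, Bump m w i v := by
    intro n
    induction n with
    | zero =>
      intro w i h hL hs
      by_cases hr : Red m (dec w i)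
      · exact ⟨_, .last w i hr⟩
      have hlt := h.after_dec.lt_letter hr (by rwa [del_dec])
      have : ∀ j ∈ Finset.range m, 0 < w j - (-N - 1) := by
        intro j hj
        have h1 := hlt j (by simpa using hj)
        by_cases hji : j = i
        · subst hji; simp [dec] at h1; omega
        · simp [dec, hji] at h1; omega
      have := Finset.sum_pos this ⟨i, by simpa using h.1⟩
      push_cast at hs
      linarith
    | succ n ih =>
      intro w i h hL hs
      by_cases hr : Red m (dec w i)
      · exact ⟨_, .last w i hr⟩
      obtain ⟨j, hj, hji, htj⟩ := h.after_dec.exists_partner hr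
      obtain ⟨v, hv⟩ := ih (dec w i) j (h.after_dec.partner hj htj) (by
        intro x hx
        rw [pos, NearRed.pre_del hj, htj, ← NearRed.pre_del h.1, del_dec]
        exact hL x hx) (by
        have : ∑ j ∈ Finset.range m, (dec w i j - (-N - 1)) <
            ∑ j ∈ Finset.range m, (w j - (-N - 1)) := by
          apply Finset.sum_lt_sum
          · intro k _
            by_cases hk : k = i
            · subst hk; simp [dec]; omega
            · simp [dec, hk]
          · exact ⟨i, by simpa using h.1, by simp [dec]; omega⟩
        push_cast at hs
        omega)
      exact ⟨v, .next w i j v hr hj hji htj hv⟩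
  exact key (∑ j ∈ Finset.range m, (w j - (-N - 1))).toNat w i h (fun x hx => hN x (by omega))
    (Int.self_le_toNat _)

/-! ### The permutation of the result of a bump -/

theorem dec_self (w : ℕ → ℤ) (i : ℕ) : dec w i i = w i - 1 := by simp [dec]

theorem dec_of_ne {w : ℕ → ℤ} {i j : ℕ} (h : j ≠ i) : dec w i j = w j := by simp [dec, h]

theorem pre_dec {w : ℕ → ℤ} {i k : ℕ} (h : k ≤ i) : pre (dec w i) k = pre w k :=
  pre_congr fun _ hj => dec_of_ne (by omega)

theorem tr_dec_self (w : ℕ → ℤ) (i : ℕ) :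
    tr (dec w i) i = swap (pre w i (w i - 1)) (pre w i (w i)) := by
  rw [tr, pre_dec le_rfl, dec_self, sub_add_cancel]

theorem pre_eq_tr_mul_del {m : ℕ} {w : ℕ → ℤ} {i : ℕ} (h : i < m) :
    pre w m = tr w i * pre (del w i) (m - 1) := by
  rw [NearRed.pre_del h, tr_mul_self_assoc]

/-- The value which sits on the lower side of the marked letter stays the same during a Little
bump. -/
theorem NearRed.lower_value_partner {m : ℕ} {w : ℕ → ℤ} {i j : ℕ} (h : NearRed m w i)
    (hj : j < m) (hji : j ≠ i) (ht : tr (dec w i) j = tr (dec w i) i) :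
    pre (dec w i) j (dec w i j) = pre w i (w i) := by
  have hu := h.after_dec
  have hne : ∀ l < m, l ≠ i → l ≠ j → tr (dec w i) l ≠ tr (dec w i) i :=
    fun l hl hli hlj he => hlj (hu.partner_unique hl hj hli hji he ht)
  have hti := tr_dec_self w i
  set C := pre w i (w i - 1)
  set V := pre w i (w i)
  have hC : pos (dec w i) i C = w i - 1 := by rw [pos_eq_iff, pre_dec le_rfl]
  have hV : pos (dec w i) i V = w i := by rw [pos_eq_iff, pre_dec le_rfl]
  rw [ht.symm] at hti
  have hlt : pos (dec w i) j V < pos (dec w i) j C := by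
    rcases lt_or_gt_of_ne hji with hlt | hlt
    · rw [← pos_succ_lt_iff_of_eq hti, ← pos_lt_iff_of_forall_ne (k := j + 1) (l := i) hlt]
      · omega
      · intro l hl hli
        rw [← hti, ht]
        exact hne l (by have := h.1; omega) (by omega) (by omega)
    · rw [pos_lt_iff_of_forall_ne (k := i + 1) (l := j) hlt]
      · rw [pos_succ_lt_iff_of_eq]
        · omega
        · rw [← ht, hti, swap_comm]
      · intro l hl hli
        rw [swap_comm, ← hti, ht]
        exact hne l (by omega) (by omega) (by omega)
  have := tr_eq_swap_iff.1 hti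
  rw [eq_comm, ← pos_eq_iff]
  omega

/-- The permutation of the result of a Little bump: if `σ` is the permutation of the word without
the marked letter and `V` is the value on the lower side of this letter, then `V` is exchanged
with a smaller value `C` in such a way that the length grows by one. -/
theorem Bump.exists_pre_eq {m : ℕ} {w v : ℕ → ℤ} {i : ℕ} (h : Bump m w i v)
    (hn : NearRed m w i) :
    ∃ C, C < pre w i (w i) ∧
      (∀ x, pos v m x = pos (del w i) (m - 1) (swap C (pre w i (w i)) x)) ∧
      pos (del w i) (m - 1) C < pos (del w i) (m - 1) (pre w i (w i)) ∧
      ∀ E, C < E → E < pre w i (w i) → pos (del w i) (m - 1) C < pos (del w i) (m - 1) E →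
        pos (del w i) (m - 1) E < pos (del w i) (m - 1) (pre w i (w i)) → False := by
  induction h with
  | last w i h =>
    have hti := tr_dec_self w i
    have hC : pos (dec w i) i (pre w i (w i - 1)) = w i - 1 := by rw [pos_eq_iff, pre_dec le_rfl]
    have hV : pos (dec w i) i (pre w i (w i)) = w i := by rw [pos_eq_iff, pre_dec le_rfl]
    have hpos : ∀ x, pos (dec w i) m x =
        pos (del w i) (m - 1) (swap (pre w i (w i - 1)) (pre w i (w i)) x) := by
      intro x
      rw [pos, pre_eq_tr_mul_del hn.1, hti, del_dec]
      simp [pos]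
    set C := pre w i (w i - 1)
    set V := pre w i (w i)
    have hlt : C < V := by
      rw [← h.pos_lt_iff_before hn.1 hti le_rfl]
      omega
    refine ⟨C, hlt, hpos, ?_, ?_⟩
    · by_contra hle
      have h1 := pos_inj (del w i) (m - 1) (x := C) (y := V)
      have h2 := h.pos_lt_after hti hlt hn.1 le_rfl
      rw [hpos, hpos, swap_apply_left, swap_apply_right] at h2
      omega
    · intro E hCE hEV h1 h2
      have hE : pos (dec w i) m E = pos (del w i) (m - 1) E := by
        rw [hpos, swap_apply_of_ne_of_ne hCE.ne' hEV.ne]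
      have hC' : pos (dec w i) m C = pos (del w i) (m - 1) V := by
        rw [hpos, swap_apply_left]
      obtain ⟨l, hl, htl⟩ := exists_tr_eq (w := dec w i) (m := m) hCE (by omega)
      have hli : l ≠ i := by
        rintro rfl
        rw [htl, swap_eq_swap_iff (by omega)] at hti
        omega
      have hu := hn.after_dec.2
      have hdd := del_dec w i
      rcases lt_or_gt_of_ne hli with hlt' | hlt'
      · have := hu.pos_lt_after (i := l) (k := m - 1) (by rw [tr_del_lt hlt', htl]) hCE
          (by have := hn.1; omega) le_rfl
        rw [hdd] at this
        omega
      · have := hu.pos_lt_after (i := l - 1) (k := m - 1) (x := E) (y := V) (by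
          rw [tr_del_ge (by omega), Nat.sub_add_cancel (by omega), htl, hti]
          rw [swap_conj_swap, swap_apply_left, swap_apply_of_ne_of_ne hCE.ne' hEV.ne, swap_comm])
          hEV (by omega) le_rfl
        rw [hdd] at this
        omega
  | next w i j v h hj hij ht hv ih =>
    have hn' := hn.after_dec.partner hj ht
    have h1 := ih hn'
    rw [hn.lower_value_partner hj hij ht] at h1
    have h2 : pos (del (dec w i) j) (m - 1) = pos (del w i) (m - 1) := by
      funext x
      rw [pos, pos, NearRed.pre_del hj, ht, ← NearRed.pre_del hn.1, del_dec]
    rwa [h2] at h1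

/-! ### Bumps preserve descents -/

theorem tr_succ_eq_of_eq {w : ℕ → ℤ} {k : ℕ} (h : w k = w (k + 1)) : tr w k = tr w (k + 1) := by
  rw [tr_eq_conj, tr_eq_conj, pre_succ, ← h]
  simp [mul_assoc]

/-- When two neighbours become equal, they exchange the same values, and the bump goes on with the
other one of them: an ascent is restored at once. -/
theorem Bump.lt_of_lt_aux {m : ℕ} {w v : ℕ → ℤ} {i k : ℕ} (h : Bump m w i v)
    (hn : NearRed m w i) (hk : k + 1 < m)
    (hlt : w k < w (k + 1) ∨ (w k = w (k + 1) ∧ i = k)) : v k < v (k + 1) := by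
  have hdec : ∀ (w : ℕ → ℤ) i, (w k < w (k + 1) ∨ (w k = w (k + 1) ∧ i = k)) →
      dec w i k < dec w i (k + 1) ∨ (dec w i k = dec w i (k + 1) ∧ i = k + 1) := by
    intro w i h
    by_cases h1 : i = k
    · subst h1
      rw [dec_self, dec_of_ne (by omega)]
      omega
    by_cases h2 : i = k + 1
    · subst h2
      rw [dec_self, dec_of_ne (by omega)]
      omega
    · rw [dec_of_ne (by omega), dec_of_ne (by omega)]
      omega
  induction h with
  | last w i h =>
    rcases hdec w i hlt with h1 | ⟨h1, _⟩
    · exact h1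
    · have := h k (by omega) (k + 1) hk (tr_succ_eq_of_eq h1)
      omega
  | next w i j v h hj hij ht hv ih =>
    refine ih (hn.after_dec.partner hj ht) ?_
    rcases hdec w i hlt with h1 | ⟨h1, rfl⟩
    · exact Or.inl h1
    · exact Or.inr ⟨h1, hn.after_dec.partner_unique hj (by omega) hij (by omega) ht
        (tr_succ_eq_of_eq h1)⟩

theorem Bump.gt_of_gt_aux {m : ℕ} {w v : ℕ → ℤ} {i k : ℕ} (h : Bump m w i v)
    (hn : NearRed m w i) (hk : k + 1 < m)
    (hlt : w (k + 1) < w k ∨ (w k = w (k + 1) ∧ i = k + 1)) : v (k + 1) < v k := by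
  have hdec : ∀ (w : ℕ → ℤ) i, (w (k + 1) < w k ∨ (w k = w (k + 1) ∧ i = k + 1)) →
      dec w i (k + 1) < dec w i k ∨ (dec w i k = dec w i (k + 1) ∧ i = k) := by
    intro w i h
    by_cases h1 : i = k
    · subst h1
      rw [dec_self, dec_of_ne (by omega)]
      omega
    by_cases h2 : i = k + 1
    · subst h2
      rw [dec_self, dec_of_ne (by omega)]
      omega
    · rw [dec_of_ne (by omega), dec_of_ne (by omega)]
      omega
  induction h with
  | last w i h =>
    rcases hdec w i hlt with h1 | ⟨h1, _⟩
    · exact h1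
    · have := h k (by omega) (k + 1) hk (tr_succ_eq_of_eq h1)
      omega
  | next w i j v h hj hij ht hv ih =>
    refine ih (hn.after_dec.partner hj ht) ?_
    rcases hdec w i hlt with h1 | ⟨h1, rfl⟩
    · exact Or.inl h1
    · exact Or.inr ⟨h1, hn.after_dec.partner_unique hj (by omega) hij (by omega) ht
        (tr_succ_eq_of_eq h1).symm⟩

theorem Red.ne_succ {m : ℕ} {w : ℕ → ℤ} {k : ℕ} (hw : Red m w) (hk : k + 1 < m) :
    w k ≠ w (k + 1) := fun h => by
  have := hw k (by omega) (k + 1) hk (tr_succ_eq_of_eq h)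
  omega

/-- A Little bump preserves the descents of a word. -/
theorem Bump.lt_iff {m : ℕ} {w v : ℕ → ℤ} {i k : ℕ} (h : Bump m w i v) (hw : Red m w)
    (hn : NearRed m w i) (hk : k + 1 < m) : w k < w (k + 1) ↔ v k < v (k + 1) := by
  have h1 := hw.ne_succ hk
  have h2 := h.lt_of_lt_aux hn hk
  have h3 := h.gt_of_gt_aux hn hk
  omega

/-! ### Coxeter–Knuth moves -/

/-- The Coxeter–Knuth moves on three consecutive letters: the braid relation, and the exchange of
two neighbours `a < c` next to a letter `b` with `a < b < c`. -/
inductive CKTriple : ℤ → ℤ → ℤ → ℤ → ℤ → ℤ → Prop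
  | acb {a b c : ℤ} (hab : a < b) (hbc : b < c) : CKTriple a c b c a b
  | cab {a b c : ℤ} (hab : a < b) (hbc : b < c) : CKTriple c a b a c b
  | bac {a b c : ℤ} (hab : a < b) (hbc : b < c) : CKTriple b a c b c a
  | bca {a b c : ℤ} (hab : a < b) (hbc : b < c) : CKTriple b c a b a c
  | up (n : ℤ) : CKTriple n (n + 1) n (n + 1) n (n + 1)
  | down (n : ℤ) : CKTriple (n + 1) n (n + 1) n (n + 1) n

theorem CKTriple.symm {x y z x' y' z' : ℤ} (h : CKTriple x y z x' y' z') :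
    CKTriple x' y' z' x y z := by
  cases h with
  | acb h1 h2 => exact .cab h1 h2
  | cab h1 h2 => exact .acb h1 h2
  | bac h1 h2 => exact .bca h1 h2
  | bca h1 h2 => exact .bac h1 h2
  | up => exact .down _
  | down => exact .up _

/-- `CK k w w'`: the words `w` and `w'` differ by a Coxeter–Knuth move at the positions
`k, k + 1, k + 2`. -/
def CK (k : ℕ) (w w' : ℕ → ℤ) : Prop :=
  (∀ j, j ≠ k → j ≠ k + 1 → j ≠ k + 2 → w j = w' j) ∧
    CKTriple (w k) (w (k + 1)) (w (k + 2)) (w' k) (w' (k + 1)) (w' (k + 2))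

theorem CK.symm {k : ℕ} {w w' : ℕ → ℤ} (h : CK k w w') : CK k w' w :=
  ⟨fun j h1 h2 h3 => (h.1 j h1 h2 h3).symm, h.2.symm⟩

/-- For two words which differ by a Coxeter–Knuth move at `k`, the permutation of the positions
which matches the letters exchanging the same values. -/
def ckPerm (k : ℕ) (w w' : ℕ → ℤ) : Perm ℕ :=
  if w k = w' k then swap (k + 1) (k + 2)
  else if w (k + 2) = w' (k + 2) then swap k (k + 1) else swap k (k + 2)

theorem ckPerm_symm (k : ℕ) (w w' : ℕ → ℤ) : ckPerm k w' w = ckPerm k w w' := by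
  unfold ckPerm
  simp only [eq_comm]

theorem ckPerm_ckPerm (k : ℕ) (w w' : ℕ → ℤ) (i : ℕ) :
    ckPerm k w w' (ckPerm k w w' i) = i := by
  unfold ckPerm
  split_ifs <;> simp

theorem ckPerm_of_ne {k : ℕ} {w w' : ℕ → ℤ} {i : ℕ} (h0 : i ≠ k) (h1 : i ≠ k + 1)
    (h2 : i ≠ k + 2) : ckPerm k w w' i = i := by
  unfold ckPerm
  split_ifs
  · exact swap_apply_of_ne_of_ne h1 h2
  · exact swap_apply_of_ne_of_ne h0 h1
  · exact swap_apply_of_ne_of_ne h0 h2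

theorem ckPerm_lt {k m : ℕ} {w w' : ℕ → ℤ} {i : ℕ} (hk : k + 2 < m) (hi : i < m) :
    ckPerm k w w' i < m := by
  unfold ckPerm
  split_ifs <;> rw [swap_apply_def] <;> split_ifs <;> omega

theorem swap_comm_of_far {a c : ℤ} (h : a + 1 < c ∨ c + 1 < a) :
    swap a (a + 1) * swap c (c + 1) = swap c (c + 1) * swap a (a + 1) :=
  (Perm.disjoint_swap_swap (by simp; omega)).commute

theorem swap_conj_of_far {a c : ℤ} (h : a + 1 < c ∨ c + 1 < a) (p : Perm ℤ) :
    swap a (a + 1) * (swap c (c + 1) * (swap a (a + 1) * p)) = swap c (c + 1) * p := by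
  rw [← mul_assoc (swap c _), ← swap_comm_of_far h, mul_assoc, ← mul_assoc, swap_mul_self, one_mul]

theorem swap_conj_of_far_self {a c : ℤ} (h : a + 1 < c ∨ c + 1 < a) :
    swap a (a + 1) * (swap c (c + 1) * swap a (a + 1)) = swap c (c + 1) := by
  simpa using swap_conj_of_far h 1

theorem swap_braid (n : ℤ) :
    swap n (n + 1) * swap (n + 1) (n + 1 + 1) * swap n (n + 1) =
      swap (n + 1) (n + 1 + 1) * swap n (n + 1) * swap (n + 1) (n + 1 + 1) := by
  rw [swap_conj_swap, swap_conj_swap, swap_apply_right, swap_apply_left,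
    swap_apply_of_ne_of_ne (by omega) (by omega), swap_apply_of_ne_of_ne (by omega) (by omega)]

theorem CKTriple.prod_eq {x y z x' y' z' : ℤ} (h : CKTriple x y z x' y' z') :
    swap x (x + 1) * (swap y (y + 1) * swap z (z + 1)) =
      swap x' (x' + 1) * (swap y' (y' + 1) * swap z' (z' + 1)) := by
  cases h with
  | acb h1 h2 => rw [← mul_assoc, swap_comm_of_far (a := x) (c := y) (by omega), mul_assoc]
  | cab h1 h2 => rw [← mul_assoc, swap_comm_of_far (a := x) (c := y) (by omega), mul_assoc]
  | bac h1 h2 => rw [swap_comm_of_far (a := y) (c := z) (by omega)]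
  | bca h1 h2 => rw [swap_comm_of_far (a := y) (c := z) (by omega)]
  | up => rw [← mul_assoc, swap_braid, mul_assoc]
  | down => rw [← mul_assoc, ← swap_braid, mul_assoc]

theorem CK.pre_eq_of_le {k j : ℕ} {w w' : ℕ → ℤ} (h : CK k w w') (hj : j ≤ k) :
    pre w j = pre w' j :=
  pre_congr fun l hl => h.1 l (by omega) (by omega) (by omega)

theorem CK.pre_eq_of_ge {k j : ℕ} {w w' : ℕ → ℤ} (h : CK k w w') (hj : k + 3 ≤ j) :
    pre w j = pre w' j := by
  induction j, hj using Nat.le_induction with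
  | base =>
    simp only [pre_succ, h.pre_eq_of_le le_rfl, mul_assoc]
    rw [h.2.prod_eq]
  | succ j hj ih => rw [pre_succ, pre_succ, ih, h.1 j (by omega) (by omega) (by omega)]

theorem CK.red {k m : ℕ} {w w' : ℕ → ℤ} (h : CK k w w') (hk : k + 2 < m) (hw : Red m w) :
    Red m w' := hw.of_pre_eq (h.pre_eq_of_ge hk)

theorem tr_succ_eq (w : ℕ → ℤ) (k : ℕ) :
    tr w (k + 1) = pre w k * (swap (w k) (w k + 1) * (swap (w (k + 1)) (w (k + 1) + 1) *
      swap (w k) (w k + 1))) * (pre w k)⁻¹ := by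
  rw [tr_eq_conj, pre_succ]
  simp [mul_assoc]

theorem tr_succ_succ_eq (w : ℕ → ℤ) (k : ℕ) :
    tr w (k + 2) = pre w k * (swap (w k) (w k + 1) * (swap (w (k + 1)) (w (k + 1) + 1) *
      (swap (w (k + 2)) (w (k + 2) + 1) * (swap (w (k + 1)) (w (k + 1) + 1) *
      swap (w k) (w k + 1))))) * (pre w k)⁻¹ := by
  rw [tr_eq_conj, pre_succ, pre_succ]
  simp [mul_assoc]

theorem conj_conj_of_comm {a b c : Perm ℤ} (h : a * c = c * a) :
    c * (a * (b * (a * c))) = a * (c * (b * (c * a))) := by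
  rw [h, ← mul_assoc c a, ← h, mul_assoc]

theorem braid_conj (n : ℤ) :
    swap n (n + 1) * (swap (n + 1) (n + 1 + 1) * (swap n (n + 1) *
      (swap (n + 1) (n + 1 + 1) * swap n (n + 1)))) = swap (n + 1) (n + 1 + 1) ∧
    swap (n + 1) (n + 1 + 1) * (swap n (n + 1) * (swap (n + 1) (n + 1 + 1) *
      (swap n (n + 1) * swap (n + 1) (n + 1 + 1)))) = swap n (n + 1) := by
  have h := swap_braid n
  have h1 := swap_mul_self n (n + 1)
  have h2 := swap_mul_self (n + 1) (n + 1 + 1)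
  generalize swap n (n + 1) = a at *
  generalize swap (n + 1) (n + 1 + 1) = b at *
  constructor
  · calc _ = (a * b * a) * b * a := by group
      _ = b * a * (b * b) * a := by rw [h]; group
      _ = b * (a * a) := by rw [h2]; group
      _ = b := by rw [h1, mul_one]
  · calc _ = (b * a * b) * a * b := by group
      _ = a * b * (a * a) * b := by rw [← h]; group
      _ = a * (b * b) := by rw [h1]; group
      _ = a := by rw [h2, mul_one]

/-- The middle letter of a braid cannot be the marked one. -/
theorem NearRed.ne_middle {m k : ℕ} {w : ℕ → ℤ} (hk : k + 2 < m) (hz : w k = w (k + 2)) :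
    ¬ NearRed m w (k + 1) := fun h => by
  have := h.2.ne_succ (k := k) (by omega)
  simp [del, hz] at this

/-- The letters matched by `ckPerm` exchange the same values. Removability of the letter is used
only to exclude the middle letter of a braid. -/
theorem CK.tr_ckPerm {m k : ℕ} {w w' : ℕ → ℤ} (h : CK k w w') (hk : k + 2 < m) {i : ℕ}
    (hi : NearRed m w i) : tr w' (ckPerm k w w' i) = tr w i := by
  by_cases hout : i ≠ k ∧ i ≠ k + 1 ∧ i ≠ k + 2
  · rw [ckPerm_of_ne hout.1 hout.2.1 hout.2.2, tr, tr, h.1 i hout.1 hout.2.1 hout.2.2]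
    by_cases hik : i ≤ k
    · rw [h.pre_eq_of_le hik]
    · rw [h.pre_eq_of_ge (by omega)]
  have hmid := NearRed.ne_middle (w := w) hk
  have hc : i = k ∨ i = k + 1 ∨ i = k + 2 := by omega
  have hp := h.pre_eq_of_le le_rfl
  obtain ⟨-, ht⟩ := h
  unfold ckPerm
  generalize hx : w k = x at *
  generalize hy : w (k + 1) = y at *
  generalize hz : w (k + 2) = z at *
  generalize hx' : w' k = x' at *
  generalize hy' : w' (k + 1) = y' at *
  generalize hz' : w' (k + 2) = z' at *
  cases ht with
  | acb h1 h2 =>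
    rw [if_neg (by omega), if_pos rfl]
    rcases hc with rfl | rfl | rfl
    · rw [swap_apply_left, tr_succ_eq, tr_eq_conj, hx, hx', hy', hp,
        swap_conj_of_far_self (by omega)]
    · rw [swap_apply_right, tr_succ_eq, tr_eq_conj, hx, hx', hy, hp,
        swap_conj_of_far_self (by omega)]
    · rw [swap_apply_of_ne_of_ne (by omega) (by omega), tr_succ_succ_eq, tr_succ_succ_eq, hx, hx',
        hy, hy', hz, hz', hp, conj_conj_of_comm (swap_comm_of_far (by omega))]
  | cab h1 h2 =>
    rw [if_neg (by omega), if_pos rfl]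
    rcases hc with rfl | rfl | rfl
    · rw [swap_apply_left, tr_succ_eq, tr_eq_conj, hx, hx', hy', hp,
        swap_conj_of_far_self (by omega)]
    · rw [swap_apply_right, tr_succ_eq, tr_eq_conj, hx, hx', hy, hp,
        swap_conj_of_far_self (by omega)]
    · rw [swap_apply_of_ne_of_ne (by omega) (by omega), tr_succ_succ_eq, tr_succ_succ_eq, hx, hx',
        hy, hy', hz, hz', hp, conj_conj_of_comm (swap_comm_of_far (by omega))]
  | bac h1 h2 =>
    rw [if_pos rfl]
    rcases hc with rfl | rfl | rfl
    · rw [swap_apply_of_ne_of_ne (by omega) (by omega), tr, tr, hx, hx', hp]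
    · rw [swap_apply_left, tr_succ_eq w, tr_succ_succ_eq, hx, hx', hy, hy', hz', hp,
        swap_conj_of_far (by omega)]
    · rw [swap_apply_right, tr_succ_eq, tr_succ_succ_eq, hx, hx', hy, hy', hz, hp,
        swap_conj_of_far (by omega)]
  | bca h1 h2 =>
    rw [if_pos rfl]
    rcases hc with rfl | rfl | rfl
    · rw [swap_apply_of_ne_of_ne (by omega) (by omega), tr, tr, hx, hx', hp]
    · rw [swap_apply_left, tr_succ_eq w, tr_succ_succ_eq, hx, hx', hy, hy', hz', hp,
        swap_conj_of_far (by omega)]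
    · rw [swap_apply_right, tr_succ_eq, tr_succ_succ_eq, hx, hx', hy, hy', hz, hp,
        swap_conj_of_far (by omega)]
  | up =>
    rw [if_neg (by omega), if_neg (by omega)]
    rcases hc with rfl | rfl | rfl
    · rw [swap_apply_left, tr_succ_succ_eq, tr_eq_conj, hx, hx', hy', hz', hp, (braid_conj _).2]
    · exact (hmid rfl hi).elim
    · rw [swap_apply_right, tr_succ_succ_eq, tr_eq_conj, hx, hx', hy, hz, hp, (braid_conj _).1]
  | down =>
    rw [if_neg (by omega), if_neg (by omega)]
    rcases hc with rfl | rfl | rfl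
    · rw [swap_apply_left, tr_succ_succ_eq, tr_eq_conj, hx, hx', hy', hz', hp, (braid_conj _).1]
    · exact (hmid rfl hi).elim
    · rw [swap_apply_right, tr_succ_succ_eq, tr_eq_conj, hx, hx', hy, hz, hp, (braid_conj _).2]

/-! ### Little bumps commute with Coxeter–Knuth moves -/

/-! In the following three lemmas the hypotheses are those of `CK`, with all letters named. -/

theorem ck_acb {k : ℕ} {w w' : ℕ → ℤ} {a b c : ℤ}
    (h : ∀ j, j ≠ k → j ≠ k + 1 → j ≠ k + 2 → w j = w' j)
    (h0 : w k = a) (h1 : w (k + 1) = c) (h2 : w (k + 2) = b)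
    (h0' : w' k = c) (h1' : w' (k + 1) = a) (h2' : w' (k + 2) = b) (hab : a < b) (hbc : b < c) :
    CK k w w' ∧ ckPerm k w w' = swap k (k + 1) := by
  refine ⟨⟨h, by rw [h0, h1, h2, h0', h1', h2']; exact .acb hab hbc⟩, ?_⟩
  rw [ckPerm, if_neg (by omega), if_pos (by omega)]

theorem ck_bac {k : ℕ} {w w' : ℕ → ℤ} {a b c : ℤ}
    (h : ∀ j, j ≠ k → j ≠ k + 1 → j ≠ k + 2 → w j = w' j)
    (h0 : w k = b) (h1 : w (k + 1) = a) (h2 : w (k + 2) = c)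
    (h0' : w' k = b) (h1' : w' (k + 1) = c) (h2' : w' (k + 2) = a) (hab : a < b) (hbc : b < c) :
    CK k w w' ∧ ckPerm k w w' = swap (k + 1) (k + 2) := by
  refine ⟨⟨h, by rw [h0, h1, h2, h0', h1', h2']; exact .bac hab hbc⟩, ?_⟩
  rw [ckPerm, if_pos (by omega)]

theorem ck_up {k : ℕ} {w w' : ℕ → ℤ} {a b : ℤ}
    (h : ∀ j, j ≠ k → j ≠ k + 1 → j ≠ k + 2 → w j = w' j)
    (h0 : w k = a) (h1 : w (k + 1) = b) (h2 : w (k + 2) = a)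
    (h0' : w' k = b) (h1' : w' (k + 1) = a) (h2' : w' (k + 2) = b) (hab : b = a + 1) :
    CK k w w' ∧ ckPerm k w w' = swap k (k + 2) := by
  subst hab
  refine ⟨⟨h, by rw [h0, h1, h2, h0', h1', h2']; exact .up a⟩, ?_⟩
  rw [ckPerm, if_neg (by omega), if_neg (by omega)]

theorem CK.swap_perm {k : ℕ} {w w' : ℕ → ℤ} {p : Perm ℕ} (h : CK k w w' ∧ ckPerm k w w' = p) :
    CK k w' w ∧ ckPerm k w' w = p := ⟨h.1.symm, by rw [ckPerm_symm]; exact h.2⟩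

theorem tr_add_two_eq_of_eq {w : ℕ → ℤ} {k : ℕ} (h : w k = w (k + 2))
    (h1 : w k + 1 < w (k + 1) ∨ w (k + 1) + 1 < w k) : tr w (k + 2) = tr w k := by
  rw [tr_succ_succ_eq, tr_eq_conj, ← h, ← mul_assoc (swap (w (k + 1)) _) (swap (w k) _),
    ← swap_comm_of_far h1]
  simp only [mul_assoc, swap_mul_self_mul]
  rw [swap_conj_of_far h1.symm]

/-- At most one step of a Little bump, from `w` with the marked position `i` to `w₁` with the
marked position `i₁`; the marked letter of `w₁` still has to be decremented. -/
def BumpStep (m : ℕ) (w : ℕ → ℤ) (i : ℕ) (w₁ : ℕ → ℤ) (i₁ : ℕ) : Prop :=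
  (w₁ = w ∧ i₁ = i) ∨
    (w₁ = dec w i ∧ i₁ < m ∧ i₁ ≠ i ∧ tr (dec w i) i₁ = tr (dec w i) i)

theorem BumpStep.refl (m : ℕ) (w : ℕ → ℤ) (i : ℕ) : BumpStep m w i w i := Or.inl ⟨rfl, rfl⟩

theorem BumpStep.of_tr {m : ℕ} {w : ℕ → ℤ} {i i₁ : ℕ} (h : i₁ < m) (hne : i₁ ≠ i)
    (ht : tr (dec w i) i₁ = tr (dec w i) i) : BumpStep m w i (dec w i) i₁ :=
  Or.inr ⟨rfl, h, hne, ht⟩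

theorem BumpStep.nearRed {m : ℕ} {w w₁ : ℕ → ℤ} {i i₁ : ℕ} (h : BumpStep m w i w₁ i₁)
    (hn : NearRed m w i) : NearRed m w₁ i₁ := by
  rcases h with ⟨rfl, rfl⟩ | ⟨rfl, h1, h2, h3⟩
  · exact hn
  · exact hn.after_dec.partner h1 h3

theorem not_red_of_tr_eq {m : ℕ} {w : ℕ → ℤ} {i j : ℕ} (hi : i < m) (hj : j < m) (hij : j ≠ i)
    (h : tr w j = tr w i) : ¬ Red m w := fun hw => hij (hw j hj i hi h)

theorem BumpStep.bump {m : ℕ} {w w₁ v : ℕ → ℤ} {i i₁ : ℕ} (h : BumpStep m w i w₁ i₁)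
    (hi : i < m) (hb : Bump m w₁ i₁ v) : Bump m w i v := by
  rcases h with ⟨rfl, rfl⟩ | ⟨rfl, h1, h2, h3⟩
  · exact hb
  · exact .next w i i₁ v (not_red_of_tr_eq hi h1 h2 h3) h1 h2 h3 hb

/-- `BumpN m n w i v`: the relation `Bump m w i v`, in which the process goes on `n` times after the
first decrement. -/
inductive BumpN (m : ℕ) : ℕ → (ℕ → ℤ) → ℕ → (ℕ → ℤ) → Prop
  | last (w : ℕ → ℤ) (i : ℕ) (h : Red m (dec w i)) : BumpN m 0 w i (dec w i)
  | next (n : ℕ) (w : ℕ → ℤ) (i j : ℕ) (v : ℕ → ℤ) (h : ¬ Red m (dec w i)) (hj : j < m)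
      (hij : j ≠ i) (ht : tr (dec w i) j = tr (dec w i) i) (hv : BumpN m n (dec w i) j v) :
      BumpN m (n + 1) w i v

theorem Bump.exists_bumpN {m : ℕ} {w v : ℕ → ℤ} {i : ℕ} (h : Bump m w i v) :
    ∃ n, BumpN m n w i v := by
  induction h with
  | last w i h => exact ⟨0, .last w i h⟩
  | next w i j v h hj hij ht hv ih =>
    obtain ⟨n, hn⟩ := ih
    exact ⟨n + 1, .next n w i j v h hj hij ht hn⟩

/-- A bump passes through each of its steps, since the next marked position is unique. -/
theorem BumpN.of_step {m n : ℕ} {w w₁ v : ℕ → ℤ} {i i₁ : ℕ} (hb : BumpN m n w i v)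
    (hn : NearRed m w i) (h : BumpStep m w i w₁ i₁) : ∃ n' ≤ n, BumpN m n' w₁ i₁ v := by
  rcases h with ⟨rfl, rfl⟩ | ⟨rfl, h1, h2, h3⟩
  · exact ⟨n, le_rfl, hb⟩
  · have hr := not_red_of_tr_eq hn.1 h1 h2 h3
    cases hb with
    | last w i h => exact (hr h).elim
    | next n w i j v h hj hij ht hv =>
      obtain rfl := hn.after_dec.partner_unique hj h1 hij h2 ht h3
      exact ⟨n, by omega, hv⟩

/-- The situation after the marked letters of two matched words have been decremented, each
possibly after one further step of the bump. -/
def Matched (m k : ℕ) (w w' : ℕ → ℤ) (i i' : ℕ) : Prop :=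
  ∃ w₁ i₁ w₁' i₁', BumpStep m w i w₁ i₁ ∧ BumpStep m w' i' w₁' i₁' ∧
    CK k (dec w₁ i₁) (dec w₁' i₁') ∧ ckPerm k (dec w₁ i₁) (dec w₁' i₁') i₁ = i₁'

theorem Matched.symm {m k : ℕ} {w w' : ℕ → ℤ} {i i' : ℕ} (h : Matched m k w w' i i') :
    Matched m k w' w i' i := by
  obtain ⟨w₁, i₁, w₁', i₁', h1, h2, h3, h4⟩ := h
  refine ⟨w₁', i₁', w₁, i₁, h2, h1, h3.symm, ?_⟩
  have := congrArg (ckPerm k (dec w₁ i₁) (dec w₁' i₁')) h4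
  rwa [ckPerm_ckPerm, eq_comm, ← ckPerm_symm] at this

theorem matched_of_perm {m k : ℕ} {w w' w₁ w₁' : ℕ → ℤ} {i i' i₁ i₁' : ℕ} {p : Perm ℕ}
    (h : BumpStep m w i w₁ i₁) (h' : BumpStep m w' i' w₁' i₁')
    (hck : CK k (dec w₁ i₁) (dec w₁' i₁') ∧ ckPerm k (dec w₁ i₁) (dec w₁' i₁') = p)
    (hp : p i₁ = i₁') : Matched m k w w' i i' :=
  ⟨w₁, i₁, w₁', i₁', h, h', hck.1, by rw [hck.2, hp]⟩

theorem dec_apply (w : ℕ → ℤ) (i j : ℕ) : dec w i j = if j = i then w i - 1 else w j := by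
  simp [dec, Function.update_apply]

/-- The three possible marked letters of the move `a c b → c a b`. A delay occurs when the
decremented letter becomes equal to another one of the three. -/
theorem matched_acb {m k : ℕ} {w w' : ℕ → ℤ} {a b c : ℤ} (hk : k + 2 < m)
    (h : ∀ j, j ≠ k → j ≠ k + 1 → j ≠ k + 2 → w j = w' j)
    (h0 : w k = a) (h1 : w (k + 1) = c) (h2 : w (k + 2) = b)
    (h0' : w' k = c) (h1' : w' (k + 1) = a) (h2' : w' (k + 2) = b) (hab : a < b) (hbc : b < c) :
    Matched m k w w' k (k + 1) ∧ Matched m k w w' (k + 1) k ∧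
      Matched m k w w' (k + 2) (k + 2) := by
  refine ⟨?_, ?_, ?_⟩
  · refine matched_of_perm (.refl _ _ _) (.refl _ _ _)
      (ck_acb (a := a - 1) (b := b) (c := c) ?_ ?_ ?_ ?_ ?_ ?_ ?_ ?_ ?_) (swap_apply_left _ _)
    all_goals (try simp +contextual [dec_apply, *]) <;> try omega
  · by_cases hc : b < c - 1
    · refine matched_of_perm (.refl _ _ _) (.refl _ _ _)
        (ck_acb (a := a) (b := b) (c := c - 1) ?_ ?_ ?_ ?_ ?_ ?_ ?_ ?_ ?_) (swap_apply_right _ _)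
      all_goals simp +contextual [dec_apply, *]
    obtain rfl : c = b + 1 := by omega
    by_cases ha : a < b - 1
    · refine matched_of_perm
        (.of_tr hk (by omega) (tr_succ_eq_of_eq ?_).symm)
        (.of_tr hk (by omega) (tr_add_two_eq_of_eq ?_ ?_))
        (ck_acb (a := a) (b := b - 1) (c := b) ?_ ?_ ?_ ?_ ?_ ?_ ?_ ?_ ?_)
        (swap_apply_of_ne_of_ne (by omega) (by omega))
      all_goals (try simp +contextual [dec_apply, *]) <;> try omega
    · obtain rfl : b = a + 1 := by omega
      refine matched_of_perm
        (.of_tr hk (by omega) (tr_succ_eq_of_eq ?_).symm) (.refl _ _ _)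
        (ck_up (a := a) (b := a + 1) ?_ ?_ ?_ ?_ ?_ ?_ ?_ ?_) (swap_apply_right _ _)
      all_goals simp +contextual [dec_apply, *]
  · by_cases hb : a < b - 1
    · refine matched_of_perm (.refl _ _ _) (.refl _ _ _)
        (ck_acb (a := a) (b := b - 1) (c := c) ?_ ?_ ?_ ?_ ?_ ?_ ?_ ?_ ?_)
        (swap_apply_of_ne_of_ne (by omega) (by omega))
      all_goals (try simp +contextual [dec_apply, *]) <;> try omega
    · obtain rfl : b = a + 1 := by omega
      refine matched_of_perm
        (.of_tr (i₁ := k) (by omega) (by omega) (tr_add_two_eq_of_eq ?_ ?_).symm)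
        (.of_tr (i₁ := k + 1) (by omega) (by omega) (tr_succ_eq_of_eq ?_))
        (ck_acb (a := a - 1) (b := a) (c := c) ?_ ?_ ?_ ?_ ?_ ?_ ?_ ?_ ?_) (swap_apply_left _ _)
      all_goals (try simp +contextual [dec_apply, *]) <;> try omega

/-- The three possible marked letters of the move `b a c → b c a`. -/
theorem matched_bac {m k : ℕ} {w w' : ℕ → ℤ} {a b c : ℤ} (hk : k + 2 < m)
    (h : ∀ j, j ≠ k → j ≠ k + 1 → j ≠ k + 2 → w j = w' j)
    (h0 : w k = b) (h1 : w (k + 1) = a) (h2 : w (k + 2) = c)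
    (h0' : w' k = b) (h1' : w' (k + 1) = c) (h2' : w' (k + 2) = a) (hab : a < b) (hbc : b < c) :
    Matched m k w w' k k ∧ Matched m k w w' (k + 1) (k + 2) ∧
      Matched m k w w' (k + 2) (k + 1) := by
  refine ⟨?_, ?_, ?_⟩
  · by_cases hb : a < b - 1
    · refine matched_of_perm (.refl _ _ _) (.refl _ _ _)
        (ck_bac (a := a) (b := b - 1) (c := c) ?_ ?_ ?_ ?_ ?_ ?_ ?_ ?_ ?_)
        (swap_apply_of_ne_of_ne (by omega) (by omega))
      all_goals (try simp +contextual [dec_apply, *]) <;> try omega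
    · obtain rfl : b = a + 1 := by omega
      refine matched_of_perm
        (.of_tr (i₁ := k + 1) (by omega) (by omega) (tr_succ_eq_of_eq ?_).symm)
        (.of_tr (i₁ := k + 2) (by omega) (by omega) (tr_add_two_eq_of_eq ?_ ?_))
        (ck_bac (a := a - 1) (b := a) (c := c) ?_ ?_ ?_ ?_ ?_ ?_ ?_ ?_ ?_) (swap_apply_left _ _)
      all_goals (try simp +contextual [dec_apply, *]) <;> try omega
  · refine matched_of_perm (.refl _ _ _) (.refl _ _ _)
      (ck_bac (a := a - 1) (b := b) (c := c) ?_ ?_ ?_ ?_ ?_ ?_ ?_ ?_ ?_) (swap_apply_left _ _)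
    all_goals (try simp +contextual [dec_apply, *]) <;> try omega
  · by_cases hc : b < c - 1
    · refine matched_of_perm (.refl _ _ _) (.refl _ _ _)
        (ck_bac (a := a) (b := b) (c := c - 1) ?_ ?_ ?_ ?_ ?_ ?_ ?_ ?_ ?_) (swap_apply_right _ _)
      all_goals simp +contextual [dec_apply, *]
    obtain rfl : c = b + 1 := by omega
    by_cases ha : a < b - 1
    · refine matched_of_perm
        (.of_tr (i₁ := k) (by omega) (by omega) (tr_add_two_eq_of_eq ?_ ?_).symm)
        (.of_tr (i₁ := k) (by omega) (by omega) (tr_succ_eq_of_eq ?_))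
        (ck_bac (a := a) (b := b - 1) (c := b) ?_ ?_ ?_ ?_ ?_ ?_ ?_ ?_ ?_)
        (swap_apply_of_ne_of_ne (by omega) (by omega))
      all_goals (try simp +contextual [dec_apply, *]) <;> try omega
    · obtain rfl : b = a + 1 := by omega
      refine matched_of_perm (.refl _ _ _)
        (.of_tr (i₁ := k) (by omega) (by omega) (tr_succ_eq_of_eq ?_))
        (CK.swap_perm (ck_up (a := a) (b := a + 1) ?_ ?_ ?_ ?_ ?_ ?_ ?_ ?_))
        (swap_apply_right _ _)
      all_goals simp +contextual [dec_apply, *]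

/-- The two possible marked letters of the braid move. -/
theorem matched_up {m k : ℕ} {w w' : ℕ → ℤ} {a b : ℤ} (hk : k + 2 < m)
    (h : ∀ j, j ≠ k → j ≠ k + 1 → j ≠ k + 2 → w j = w' j)
    (h0 : w k = a) (h1 : w (k + 1) = b) (h2 : w (k + 2) = a)
    (h0' : w' k = b) (h1' : w' (k + 1) = a) (h2' : w' (k + 2) = b) (hab : b = a + 1) :
    Matched m k w w' k (k + 2) ∧ Matched m k w w' (k + 2) k := by
  subst hab
  refine ⟨?_, ?_⟩
  · refine matched_of_perm (.refl _ _ _)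
      (.of_tr (i₁ := k + 1) (by omega) (by omega) (tr_succ_eq_of_eq ?_))
      (ck_acb (a := a - 1) (b := a) (c := a + 1) ?_ ?_ ?_ ?_ ?_ ?_ ?_ ?_ ?_) (swap_apply_left _ _)
    all_goals simp +contextual [dec_apply, *]
  · refine matched_of_perm (.refl _ _ _)
      (.of_tr (i₁ := k + 1) (by omega) (by omega) (tr_succ_eq_of_eq ?_).symm)
      (CK.swap_perm (ck_bac (a := a - 1) (b := a) (c := a + 1) ?_ ?_ ?_ ?_ ?_ ?_ ?_ ?_ ?_))
      (swap_apply_right _ _)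
    all_goals simp +contextual [dec_apply, *]

theorem CK.matched_of_eq {m k : ℕ} {w w' : ℕ → ℤ} (h : CK k w w') {i : ℕ}
    (h0 : i ≠ k) (h1 : i ≠ k + 1) (h2 : i ≠ k + 2) : Matched m k w w' i i := by
  refine ⟨w, i, w', i, .refl _ _ _, .refl _ _ _, ⟨?_, ?_⟩, ckPerm_of_ne h0 h1 h2⟩
  · intro j j0 j1 j2
    rw [dec_apply, dec_apply, h.1 i h0 h1 h2, h.1 j j0 j1 j2]
  · have := h.2
    rwa [dec_of_ne h0.symm, dec_of_ne h1.symm, dec_of_ne h2.symm, dec_of_ne h0.symm,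
      dec_of_ne h1.symm, dec_of_ne h2.symm]

/-- Two words which differ by a Coxeter–Knuth move, with matching marked letters, differ by a
Coxeter–Knuth move again, with matching marked letters, after the next step of the bump, up to a
delay by one step. -/
theorem CK.matched {m k : ℕ} {w w' : ℕ → ℤ} (h : CK k w w') (hk : k + 2 < m) {i : ℕ}
    (hn : NearRed m w i) : Matched m k w w' i (ckPerm k w w' i) := by
  by_cases hout : i ≠ k ∧ i ≠ k + 1 ∧ i ≠ k + 2
  · rw [ckPerm_of_ne hout.1 hout.2.1 hout.2.2]
    exact h.matched_of_eq hout.1 hout.2.1 hout.2.2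
  have hmid := NearRed.ne_middle (w := w) hk
  have hc : i = k ∨ i = k + 1 ∨ i = k + 2 := by omega
  obtain ⟨ho, ht⟩ := h
  have ho' : ∀ j, j ≠ k → j ≠ k + 1 → j ≠ k + 2 → w' j = w j :=
    fun j h0 h1 h2 => (ho j h0 h1 h2).symm
  unfold ckPerm
  generalize hx : w k = x at *
  generalize hy : w (k + 1) = y at *
  generalize hz : w (k + 2) = z at *
  generalize hx' : w' k = x' at *
  generalize hy' : w' (k + 1) = y' at *
  generalize hz' : w' (k + 2) = z' at *
  cases ht with
  | acb h1 h2 =>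
    rw [if_neg (by omega), if_pos rfl]
    have H := matched_acb hk ho hx hy hz hx' hy' hz' h1 h2
    rcases hc with rfl | rfl | rfl
    · rw [swap_apply_left]; exact H.1
    · rw [swap_apply_right]; exact H.2.1
    · rw [swap_apply_of_ne_of_ne (by omega) (by omega)]; exact H.2.2
  | cab h1 h2 =>
    rw [if_neg (by omega), if_pos rfl]
    have H := matched_acb hk ho' hx' hy' hz' hx hy hz h1 h2
    rcases hc with rfl | rfl | rfl
    · rw [swap_apply_left]; exact H.2.1.symm
    · rw [swap_apply_right]; exact H.1.symm
    · rw [swap_apply_of_ne_of_ne (by omega) (by omega)]; exact H.2.2.symm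
  | bac h1 h2 =>
    rw [if_pos rfl]
    have H := matched_bac hk ho hx hy hz hx' hy' hz' h1 h2
    rcases hc with rfl | rfl | rfl
    · rw [swap_apply_of_ne_of_ne (by omega) (by omega)]; exact H.1
    · rw [swap_apply_left]; exact H.2.1
    · rw [swap_apply_right]; exact H.2.2
  | bca h1 h2 =>
    rw [if_pos rfl]
    have H := matched_bac hk ho' hx' hy' hz' hx hy hz h1 h2
    rcases hc with rfl | rfl | rfl
    · rw [swap_apply_of_ne_of_ne (by omega) (by omega)]; exact H.1.symm
    · rw [swap_apply_left]; exact H.2.2.symm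
    · rw [swap_apply_right]; exact H.2.1.symm
  | up =>
    rw [if_neg (by omega), if_neg (by omega)]
    have H := matched_up hk ho hx hy hz hx' hy' hz' rfl
    rcases hc with rfl | rfl | rfl
    · rw [swap_apply_left]; exact H.1
    · exact (hmid rfl hn).elim
    · rw [swap_apply_right]; exact H.2
  | down =>
    rw [if_neg (by omega), if_neg (by omega)]
    have H := matched_up hk ho' hx' hy' hz' hx hy hz rfl
    rcases hc with rfl | rfl | rfl
    · rw [swap_apply_left]; exact H.2.symm
    · exact (hmid rfl hn).elim
    · rw [swap_apply_right]; exact H.1.symm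

theorem CK.nearRed {m k : ℕ} {w w' : ℕ → ℤ} (h : CK k w w') (hk : k + 2 < m) {i : ℕ}
    (hn : NearRed m w i) : NearRed m w' (ckPerm k w w' i) := by
  refine ⟨ckPerm_lt hk hn.1, hn.2.of_pre_eq ?_⟩
  rw [NearRed.pre_del hn.1, NearRed.pre_del (ckPerm_lt hk hn.1), h.tr_ckPerm hk hn,
    h.pre_eq_of_ge (by omega)]

/-- Little bumps commute with Coxeter–Knuth moves. Induction on the number of steps; a step of one
word may correspond to two of the other. -/
theorem BumpN.exists_bump_of_ck {m k : ℕ} (hk : k + 2 < m) (n : ℕ) :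
    ∀ {w w' v : ℕ → ℤ} {i : ℕ}, BumpN m n w i v → NearRed m w i → CK k w w' →
      ∃ v', Bump m w' (ckPerm k w w' i) v' ∧ CK k v v' := by
  induction n using Nat.strong_induction_on with
  | _ n ih =>
    intro w w' v i hb hn hck
    have hn' := hck.nearRed hk hn
    obtain ⟨w₁, i₁, w₁', i₁', hs, hs', hck₁, hi₁⟩ := hck.matched hk hn
    have hn₁ := (hs.nearRed hn).after_dec
    have hn₁' := (hs'.nearRed hn').after_dec
    have ht₁ := hck₁.tr_ckPerm hk hn₁
    obtain ⟨n', hle, hb₁⟩ := hb.of_step hn hs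
    cases hb₁ with
    | last _ _ h =>
      exact ⟨dec w₁' i₁', hs'.bump hn'.1 (.last _ _ (hck₁.red hk h)), hck₁⟩
    | next n' _ _ j _ h hj hij ht hv =>
      have hnj := hn₁.partner hj ht
      obtain ⟨v', hv', hck'⟩ := ih n' (by omega) hv hnj hck₁
      refine ⟨v', hs'.bump hn'.1 (.next _ _ _ _ (fun hr => h (hck₁.symm.red hk hr))
        (ckPerm_lt hk hj) ?_ ?_ hv'), hck'⟩
      · exact fun he => hij ((ckPerm k (dec w₁ i₁) (dec w₁' i₁')).injective (he.trans hi₁.symm))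
      · rw [hck₁.tr_ckPerm hk hnj, ht, ← ht₁, hi₁]

theorem Bump.exists_bump_of_ck {m k : ℕ} (hk : k + 2 < m) {w w' v : ℕ → ℤ} {i : ℕ}
    (hb : Bump m w i v) (hn : NearRed m w i) (hck : CK k w w') :
    ∃ i' v', NearRed m w' i' ∧ Bump m w' i' v' ∧ CK k v v' := by
  obtain ⟨n, hbn⟩ := hb.exists_bumpN
  obtain ⟨v', h1, h2⟩ := hbn.exists_bump_of_ck hk n hn hck
  exact ⟨_, v', hck.nearRed hk hn, h1, h2⟩

/-! ### Insertion into a row -/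

/-- `RowIns n R R' o`: insertion of `n` into the row with the set `R` of entries gives the row `R'`
and passes on `o`. If `n ∈ R`, then `n + 1` is in `R`, too, and is passed on, and the row stays the
same. -/
structure RowIns (n : ℕ) (R R' : Finset ℕ) (o : Option ℕ) : Prop where
  lt_of_none : o = none → ∀ r ∈ R, r < n
  mem_out : ∀ y, o = some y → y ∈ R ∧ n < y ∧ ∀ r ∈ R, n < r → y ≤ r
  out_of_mem : n ∈ R → o = some (n + 1)
  mem_iff : ∀ x, x ∈ R' ↔ x = n ∨ (x ∈ R ∧ (n ∈ R ∨ o ≠ some x))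

/-- The entry passed on depends only on the entries up to a known larger entry `u`. -/
theorem RowIns.congr_left {n u : ℕ} {R R' S S' : Finset ℕ} {o o' : Option ℕ}
    (h : RowIns n R R' o) (h' : RowIns n S S' o') (hu : u ∈ R) (hnu : n < u)
    (hRS : ∀ x, n < x → x ≤ u → (x ∈ R ↔ x ∈ S)) : o = o' := by
  obtain ⟨h1, h2, h3, h4⟩ := h
  obtain ⟨h1', h2', h3', h4'⟩ := h'
  clear h3 h3' h4 h4'
  cases o <;> cases o'
  · rfl
  · grind
  · grind
  · grind

theorem RowIns.congr_right {n : ℕ} {R R' S S' : Finset ℕ} {o o' : Option ℕ}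
    (h : RowIns n R R' o) (h' : RowIns n S S' o')
    (hRS : ∀ x, n < x → (x ∈ R ↔ x ∈ S)) : o = o' := by
  obtain ⟨h1, h2, h3, h4⟩ := h
  obtain ⟨h1', h2', h3', h4'⟩ := h'
  clear h3 h3' h4 h4'
  cases o <;> cases o'
  · rfl
  · grind
  · grind
  · grind

/-- The insertions of `b, a, c` and of `b, c, a` into a row with `a < b < c` give the same row, and
the entries passed on, as far as they exist, are in the same relative order. -/
theorem RowIns.bac {a b c : ℕ} {R R1 R2 R3 S1 S2 S3 : Finset ℕ} {oa ob oc oa' ob' oc' : Option ℕ}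
    (hab : a < b) (hbc : b < c)
    (h1 : RowIns b R R1 ob) (h2 : RowIns a R1 R2 oa) (h3 : RowIns c R2 R3 oc)
    (h1' : RowIns b R S1 ob') (h2' : RowIns c S1 S2 oc') (h3' : RowIns a S2 S3 oa') :
    R3 = S3 ∧ ob = ob' ∧ oa = oa' ∧ oc = oc' ∧
      (∃ a', oa = some a' ∧ ∀ b', ob = some b' → a' < b') ∧
      ∀ c', oc = some c' → ∃ b', ob = some b' ∧ b' < c' := by
  obtain rfl : ob = ob' := h1.congr_right h1' fun _ _ => Iff.rfl
  obtain rfl : R1 = S1 := by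
    ext x; rw [h1.mem_iff, h1'.mem_iff]
  have hb : b ∈ R1 := (h1.mem_iff b).2 (Or.inl rfl)
  have hbS : b ∈ S2 := (h2'.mem_iff b).2 (Or.inr ⟨hb, by
    right; intro h; have := h2'.mem_out _ h; omega⟩)
  obtain rfl : oa = oa' := h2.congr_left h3' hb hab fun x hx hxb => by
    rw [h2'.mem_iff]
    have := h2'.mem_out x
    grind
  have ha : ∃ a', oa = some a' ∧ a' ≤ b := by
    have := h2.lt_of_none
    have := h2.mem_out
    cases oa <;> grind
  obtain ⟨a', rfl, hab'⟩ := ha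
  obtain rfl : oc = oc' := h3.congr_right h2' fun x hx => by
    rw [h2.mem_iff]
    grind
  have hca : ∀ x, oc = some x → c < x := fun x hx => (h2'.mem_out x hx).2.1
  have hmc : c ∈ R2 ↔ c ∈ R1 := by rw [h2.mem_iff]; grind
  have hma : a ∈ S2 ↔ a ∈ R1 := by
    rw [h2'.mem_iff]; have := hca a; grind
  refine ⟨?_, rfl, rfl, rfl, ⟨a', rfl, ?_⟩, ?_⟩
  · ext x
    rw [h3.mem_iff, h2.mem_iff, h3'.mem_iff, h2'.mem_iff, hmc, hma]
    have := hca x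
    have := hca a
    grind
  · intro b' hb'
    have := h1.mem_out b' hb'
    omega
  · intro c' hc'
    have e1 := h2'.mem_out c' hc'
    have e2 := (h1.mem_iff c').1 e1.1
    have e3 := h1.lt_of_none
    have e4 := h1.mem_out
    have e5 := h1.out_of_mem
    cases ob with
    | none => grind
    | some b' => grind

/-- The entry passed on is determined by the entries above the inserted one. -/
theorem RowIns.out_eq_some {n y : ℕ} {R R' : Finset ℕ} {o : Option ℕ} (h : RowIns n R R' o)
    (hy : y ∈ R) (hny : n < y) (hmin : ∀ r ∈ R, n < r → y ≤ r) : o = some y := by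
  obtain ⟨h1, h2, h3, h4⟩ := h
  clear h3 h4
  cases o <;> grind

theorem RowIns.eq_out {n m : ℕ} {R R' S S' : Finset ℕ} {o o' : Option ℕ}
    (h : RowIns n R R' o) (h' : RowIns m S S' o')
    (hRS : ∀ x, (x ∈ R ∧ n < x) ↔ (x ∈ S ∧ m < x)) : o = o' := by
  cases o' with
  | some y =>
    have := h'.mem_out y rfl
    exact h.out_eq_some ((hRS y).2 ⟨this.1, this.2.1⟩).1 ((hRS y).2 ⟨this.1, this.2.1⟩).2
      fun r hr hnr => this.2.2 r ((hRS r).1 ⟨hr, hnr⟩).1 ((hRS r).1 ⟨hr, hnr⟩).2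
  | none =>
    cases o with
    | none => rfl
    | some y =>
      have h1 := h.mem_out y rfl
      have h2 := (hRS y).1 ⟨h1.1, h1.2.1⟩
      have := h'.lt_of_none rfl y h2.1
      omega

/-- The insertions of `a, c, b` and of `c, a, b` into a row with `a < b < c` give the same row, and
the entries passed on differ by one of the three Coxeter–Knuth moves, as far as they exist. -/
theorem RowIns.acb {a b c : ℕ} {R R1 R2 R3 S1 S2 S3 : Finset ℕ} {o1 o2 o3 o1' o2' o3' : Option ℕ}
    (hab : a < b) (hbc : b < c)
    (h1 : RowIns a R R1 o1) (h2 : RowIns c R1 R2 o2) (h3 : RowIns b R2 R3 o3)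
    (h1' : RowIns c R S1 o1') (h2' : RowIns a S1 S2 o2') (h3' : RowIns b S2 S3 o3') :
    R3 = S3 ∧
    ((∃ x y, x < y ∧ o1 = some x ∧ o3 = some y ∧ o2' = some x ∧ o3' = some y ∧ o2 = o1' ∧
        ∀ z, o2 = some z → y < z) ∨
     (∃ x, o3 = some x ∧ o2' = some x ∧ o1 = o1' ∧ o2 = o3' ∧ (∀ y, o1 = some y → x < y) ∧
        ∀ z, o2 = some z → ∃ y, o1 = some y ∧ y < z) ∨
     (o1 = some c ∧ o2 = some (c+1) ∧ o3 = some c ∧ o1' = some (c + 1) ∧ o2' = some c ∧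
       o3' = some (c + 1))) := by
  by_cases hA : ∃ x, o1 = some x ∧ x ≤ c
  · obtain ⟨x, rfl, hxc⟩ := hA
    have hx := h1.mem_out x rfl
    have hax := h1.out_of_mem
    rcases hxc.lt_or_eq with hxc | rfl
    · -- The entries `a` and `c` are inserted independently.
      obtain rfl : o2 = o1' := h2.congr_right h1' fun x hx => by rw [h1.mem_iff]; grind
      have hz : ∀ z, o2 = some z → c < z := fun z hz => (h2.mem_out z hz).2.1
      obtain rfl : some x = o2' := h1.congr_left h2' hx.1 hx.2.1 fun y hy hyx => by
        rw [h1'.mem_iff]; grind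
      obtain rfl : R2 = S2 := by
        ext y
        have e1 : c ∈ R1 ↔ c ∈ R := by rw [h1.mem_iff]; grind
        have e2 : a ∈ S1 ↔ a ∈ R := by rw [h1'.mem_iff]; have := hz a; grind
        rw [h2.mem_iff, h1.mem_iff, h2'.mem_iff, h1'.mem_iff, e1, e2]
        have := hz y
        have := hz a
        grind
      obtain rfl : o3 = o3' := h3.congr_right h3' fun _ _ => Iff.rfl
      have hcR : c ∈ R2 := (h2.mem_iff c).2 (Or.inl rfl)
      obtain ⟨y, rfl, hyc⟩ : ∃ y, o3 = some y ∧ y ≤ c := by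
        have e1 := h3.lt_of_none
        have e2 := h3.mem_out
        cases o3 <;> grind
      refine ⟨by ext y; rw [h3.mem_iff, h3'.mem_iff],
        Or.inl ⟨x, y, ?_, rfl, rfl, rfl, rfl, rfl, ?_⟩⟩
      · have e1 := h3.mem_out y rfl
        have e2 := h2.mem_iff y
        have e3 := h1.mem_iff y
        grind
      · intro z hz'
        have := hz z hz'
        omega
    · have haR : a ∉ R := fun h => by have := hax h; grind
      obtain rfl := h1'.out_of_mem hx.1
      have hx1 := h1'.mem_out _ rfl
      obtain rfl : some x = o2' := (h2'.out_eq_some (by rw [h1'.mem_iff]; grind) (by omega)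
        fun r hr har => by rw [h1'.mem_iff] at hr; grind).symm
      obtain rfl : o2 = some (x + 1) := h2.out_eq_some (by rw [h1.mem_iff]; grind) (by omega)
        fun r hr har => by omega
      obtain rfl : o3 = some x := h3.out_eq_some (by rw [h2.mem_iff]; grind) (by omega)
        fun r hr har => by rw [h2.mem_iff, h1.mem_iff] at hr; grind
      have haS : a ∉ S1 := by rw [h1'.mem_iff]; grind
      obtain rfl : o3' = some (x + 1) := h3'.out_eq_some
        (by rw [h2'.mem_iff, h1'.mem_iff]; grind) (by omega)
        fun r hr har => by rw [h2'.mem_iff, h1'.mem_iff] at hr; grind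
      refine ⟨?_, Or.inr (Or.inr ⟨rfl, rfl, rfl, rfl, rfl, rfl⟩)⟩
      ext y
      have e1 := h3.mem_iff y
      have e2 := h2.mem_iff y
      have e3 := h1.mem_iff y
      have e1' := h3'.mem_iff y
      have e2' := h2'.mem_iff y
      have e3' := h1'.mem_iff y
      have e4 := h2.mem_iff b
      have e5 := h1.mem_iff b
      have e6 := h1.mem_iff x
      have e4' := h2'.mem_iff b
      have e5' := h1'.mem_iff b
      have e6' := h1'.mem_iff a
      grind
  · -- There is no entry between `a` and `c`.
    have hR : ∀ r ∈ R, a < r → c < r := by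
      intro r hr har
      have e1 := h1.lt_of_none
      have e2 := h1.mem_out
      cases o1 with
      | none => have := e1 rfl r hr; omega
      | some x => have := (e2 x rfl).2.2 r hr har; by_contra; exact hA ⟨x, rfl, by omega⟩
    have haR : a ∉ R := fun h => hA ⟨a + 1, h1.out_of_mem h, by omega⟩
    have hcR : c ∉ R := fun h => by have := hR c h (by omega); omega
    obtain rfl : o1 = o1' := h1.eq_out h1' fun x =>
      ⟨fun h => ⟨h.1, hR x h.1 h.2⟩, fun h => ⟨h.1, by omega⟩⟩
    have ho1 : ∀ x, o1 = some x → c < x := fun x hx => (h1'.mem_out x hx).2.1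
    obtain rfl : o3 = some c := h3.out_eq_some (by rw [h2.mem_iff]; grind) hbc fun r hr har => by
      rw [h2.mem_iff, h1.mem_iff] at hr; grind
    obtain rfl : o2' = some c := h2'.out_eq_some (by rw [h1'.mem_iff]; grind) (by omega)
      fun r hr har => by rw [h1'.mem_iff] at hr; grind
    have haS : a ∉ S1 := by rw [h1'.mem_iff]; grind
    obtain rfl : R1 = S2 := by
      ext x
      have := ho1 x
      have e1 := h1.mem_iff x
      have e2 := h2'.mem_iff x
      have e3 := h1'.mem_iff x
      grind
    obtain rfl : o2 = o3' := h2.eq_out h3' fun x => by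
      rw [h1.mem_iff]; grind
    have hcR1 : c ∉ R1 := by rw [h1.mem_iff]; grind
    have hbR1 : b ∉ R1 := by rw [h1.mem_iff]; grind
    have hz : ∀ z, o2 = some z → c < z := fun z hz => (h2.mem_out z hz).2.1
    refine ⟨?_, Or.inr (Or.inl ⟨c, rfl, rfl, rfl, rfl, ho1, ?_⟩)⟩
    · ext x
      have e1 := h3.mem_iff x
      have e2 := h2.mem_iff x
      have e3 := h3'.mem_iff x
      have e4 := h2.mem_iff b
      have e5 := hz b
      grind
    · intro z hz'
      have e1 := h2.mem_out z hz'
      have e2 := (h1.mem_iff z).1 e1.1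
      have e3 := h1.lt_of_none
      have e4 := h1.mem_out
      cases o1 with
      | none => grind
      | some y => grind

/-- The insertions of `n, n + 1, n` and of `n + 1, n, n + 1` into a row give the same row, and the
entries passed on differ by a Coxeter–Knuth move, as far as they exist. -/
theorem RowIns.braid {n : ℕ} {R R1 R2 R3 S1 S2 S3 : Finset ℕ} {o1 o2 o3 o1' o2' o3' : Option ℕ}
    (h1 : RowIns n R R1 o1) (h2 : RowIns (n+1) R1 R2 o2) (h3 : RowIns n R2 R3 o3)
    (h1' : RowIns (n+1) R S1 o1') (h2' : RowIns n S1 S2 o2') (h3' : RowIns (n+1) S2 S3 o3') :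
    R3 = S3 ∧
    ((∃ x, o3 = some x ∧ o2' = some x ∧ o1 = o1' ∧ o2 = o3' ∧ (∀ y, o1 = some y → x < y) ∧
        ∀ z, o2 = some z → ∃ y, o1 = some y ∧ y < z) ∨
     (∃ x, o1 = some x ∧ o2 = some (x+1) ∧ o3 = some x ∧ o1' = some (x + 1) ∧ o2' = some x ∧
       o3' = some (x + 1))) := by
  obtain rfl : o3 = some (n + 1) := h3.out_eq_some (by rw [h2.mem_iff]; grind) (by omega)
    fun r hr har => by omega
  obtain rfl : o2' = some (n + 1) := h2'.out_eq_some (by rw [h1'.mem_iff]; grind) (by omega)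
    fun r hr har => by omega
  by_cases hn1 : n + 1 ∈ R
  · obtain rfl : o1 = some (n + 1) := h1.out_eq_some hn1 (by omega) fun r hr har => by omega
    obtain rfl := h1'.out_of_mem hn1
    have hn2 := (h1'.mem_out _ rfl).1
    obtain rfl : o2 = some (n + 1 + 1) := h2.out_eq_some (by rw [h1.mem_iff]; grind) (by omega)
      fun r hr har => by omega
    obtain rfl : o3' = some (n + 1 + 1) := h3'.out_eq_some
      (by rw [h2'.mem_iff, h1'.mem_iff]; grind) (by omega) fun r hr har => by omega
    refine ⟨?_, Or.inr ⟨n + 1, rfl, rfl, rfl, rfl, rfl, rfl⟩⟩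
    ext y
    have e1 := h3.mem_iff y
    have e2 := h2.mem_iff y
    have e3 := h1.mem_iff y
    have e1' := h3'.mem_iff y
    have e2' := h2'.mem_iff y
    have e3' := h1'.mem_iff y
    have e4 := h2.mem_iff n
    have e5 := h1.mem_iff n
    have e6 := h1.mem_iff (n + 1)
    have e4' := h2'.mem_iff (n + 1)
    have e5' := h1'.mem_iff (n + 1)
    have e6' := h1'.mem_iff n
    grind
  · have hn : n ∉ R := fun h => hn1 (h1.mem_out _ (h1.out_of_mem h)).1
    obtain rfl : o1 = o1' := h1.eq_out h1' fun x => by grind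
    have ho1 : ∀ x, o1 = some x → n + 1 < x := fun x hx => (h1'.mem_out x hx).2.1
    obtain rfl : o2 = o3' := h2.congr_right h3' fun x hx => by
      rw [h1.mem_iff, h2'.mem_iff, h1'.mem_iff]; grind
    have hz : ∀ z, o2 = some z → n + 1 < z := fun z hz => (h2.mem_out z hz).2.1
    refine ⟨?_, Or.inl ⟨n + 1, rfl, rfl, rfl, rfl, ho1, ?_⟩⟩
    · ext y
      have e1 := h3.mem_iff y
      have e2 := h2.mem_iff y
      have e3 := h1.mem_iff y
      have e1' := h3'.mem_iff y
      have e2' := h2'.mem_iff y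
      have e3' := h1'.mem_iff y
      have e4 := h2.mem_iff n
      have e5 := h1.mem_iff n
      have e6 := h1.mem_iff (n + 1)
      have e4' := h2'.mem_iff (n + 1)
      have e5' := h1'.mem_iff (n + 1)
      have e6' := h1'.mem_iff n
      have := hz n
      have := hz (n + 1)
      have := ho1 n
      have := ho1 (n + 1)
      grind
    · intro z hz'
      have e1 := h2.mem_out z hz'
      have e2 := (h1.mem_iff z).1 e1.1
      have e3 := h1.lt_of_none
      have e4 := h1.mem_out
      cases o1 with
      | none => grind
      | some y => grind

/-- Two entries inserted one after the other: an increasing pair. -/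
theorem RowIns.pair_lt {a b : ℕ} {R R1 R2 : Finset ℕ} {o1 o2 : Option ℕ} (hab : a < b)
    (h1 : RowIns a R R1 o1) (h2 : RowIns b R1 R2 o2) :
    ∀ z, o2 = some z → ∃ y, o1 = some y ∧ y < z := by
  intro z hz
  have e1 := h2.mem_out z hz
  have e2 := (h1.mem_iff z).1 e1.1
  have e3 := h1.lt_of_none
  have e4 := h1.mem_out
  have e5 := h1.out_of_mem
  cases o1 with
  | none => grind
  | some y => grind

/-- Two entries inserted one after the other: a decreasing pair. -/
theorem RowIns.pair_gt {a b : ℕ} {R R1 R2 : Finset ℕ} {o1 o2 : Option ℕ} (hab : a < b)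
    (h1 : RowIns b R R1 o1) (h2 : RowIns a R1 R2 o2) :
    ∃ z, o2 = some z ∧ ∀ y, o1 = some y → z < y := by
  have hb : b ∈ R1 := (h1.mem_iff b).2 (Or.inl rfl)
  have e1 := h2.mem_out
  have e2 := h2.lt_of_none
  have e4 := h1.mem_out
  cases o2 with
  | none => grind
  | some z => exact ⟨z, rfl, fun y hy => by have := e1 z rfl; have := e4 y hy; grind⟩

/-! ### Insertion into a tableau -/

/-- Insertion of `n` into a tableau given by its infinitely many rows, almost all empty; the new
box is added to row `r`. -/
def TabIns : ℕ → (ℕ → Finset ℕ) → (ℕ → Finset ℕ) → ℕ → Prop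
  | n, T, T', 0 => RowIns n (T 0) (T' 0) none ∧ ∀ k, T' (k + 1) = T (k + 1)
  | n, T, T', r + 1 => ∃ y, RowIns n (T 0) (T' 0) (some y) ∧
      TabIns y (fun k => T (k + 1)) (fun k => T' (k + 1)) r

/-- Continuation of an insertion below the first row: if nothing is passed
on, then the new box is in the first row, `r = 0`. -/
def TabRest : Option ℕ → (ℕ → Finset ℕ) → (ℕ → Finset ℕ) → ℕ → Prop
  | none, T, T', r => T' = T ∧ r = 0
  | some y, T, T', r => ∃ s, r = s + 1 ∧ TabIns y T T' s

theorem TabIns.exists_rest {n r : ℕ} {T T' : ℕ → Finset ℕ} (h : TabIns n T T' r) :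
    ∃ o, RowIns n (T 0) (T' 0) o ∧ TabRest o (fun k => T (k + 1)) (fun k => T' (k + 1)) r := by
  cases r with
  | zero => exact ⟨none, h.1, funext h.2, rfl⟩
  | succ r =>
    obtain ⟨y, h1, h2⟩ := h
    exact ⟨some y, h1, r, rfl, h2⟩

theorem RowIns.det {n : ℕ} {R R' R'' : Finset ℕ} {o o' : Option ℕ} (h : RowIns n R R' o)
    (h' : RowIns n R R'' o') : R' = R'' ∧ o = o' := by
  obtain rfl := h.congr_right h' fun _ _ => Iff.rfl
  exact ⟨by ext x; rw [h.mem_iff, h'.mem_iff], rfl⟩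

theorem tab_ext {T T' : ℕ → Finset ℕ} (h0 : T 0 = T' 0)
    (h : (fun k => T (k + 1)) = fun k => T' (k + 1)) : T = T' := by
  funext k
  cases k with
  | zero => exact h0
  | succ k => exact congrFun h k

theorem TabIns.det {n r r' : ℕ} {T T' T'' : ℕ → Finset ℕ} (h : TabIns n T T' r)
    (h' : TabIns n T T'' r') : T' = T'' ∧ r = r' := by
  induction r generalizing n T T' T'' r' with
  | zero =>
    obtain ⟨o, h1, h2⟩ := h'.exists_rest
    obtain ⟨h3, rfl⟩ := h.1.det h1
    exact ⟨tab_ext h3 ((funext h.2).trans h2.1.symm), h2.2.symm⟩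
  | succ r ih =>
    obtain ⟨o, h1, h2⟩ := h'.exists_rest
    obtain ⟨y, h3, h4⟩ := h
    obtain ⟨h5, rfl⟩ := h3.det h1
    obtain ⟨s, rfl, h6⟩ := h2
    obtain ⟨h7, rfl⟩ := ih h4 h6
    exact ⟨tab_ext h5 h7, rfl⟩

/-- Inserting a larger entry afterwards: the new box is weakly higher. -/
theorem TabIns.row_le_of_lt {a b r s : ℕ} {T T1 T2 : ℕ → Finset ℕ} (hab : a < b)
    (h1 : TabIns a T T1 r) (h2 : TabIns b T1 T2 s) : s ≤ r := by
  induction s generalizing a b r T T1 T2 with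
  | zero => exact Nat.zero_le _
  | succ s ih =>
    obtain ⟨y, h3, h4⟩ := h2
    obtain ⟨o, h5, h6⟩ := h1.exists_rest
    obtain ⟨x, rfl, hxy⟩ := h5.pair_lt hab h3 y rfl
    obtain ⟨r, rfl, h7⟩ := h6
    exact Nat.succ_le_succ (ih hxy h7 h4)

/-- Inserting a smaller entry afterwards: the new box is strictly lower. -/
theorem TabIns.row_lt_of_gt {a b r s : ℕ} {T T1 T2 : ℕ → Finset ℕ} (hab : a < b)
    (h1 : TabIns b T T1 r) (h2 : TabIns a T1 T2 s) : r < s := by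
  induction r generalizing a b s T T1 T2 with
  | zero =>
    obtain ⟨o, h5, h6⟩ := h2.exists_rest
    obtain ⟨x, rfl, hxy⟩ := RowIns.pair_gt hab h1.1 h5
    obtain ⟨s, rfl, h7⟩ := h6
    omega
  | succ r ih =>
    obtain ⟨y, h3, h4⟩ := h1
    obtain ⟨o, h5, h6⟩ := h2.exists_rest
    obtain ⟨x, rfl, hxy⟩ := RowIns.pair_gt hab h3 h5
    obtain ⟨s, rfl, h7⟩ := h6
    exact Nat.succ_lt_succ (ih (hxy y rfl) h4 h7)

/-- The Coxeter–Knuth moves, in the order of insertion. -/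
inductive InsTriple : ℕ → ℕ → ℕ → ℕ → ℕ → ℕ → Prop
  | bac {a b c : ℕ} (hab : a < b) (hbc : b < c) : InsTriple b a c b c a
  | acb {a b c : ℕ} (hab : a < b) (hbc : b < c) : InsTriple a c b c a b
  | braid (n : ℕ) : InsTriple n (n + 1) n (n + 1) n (n + 1)

/-- Knuth moves on words of row numbers, in the order of insertion: two adjacent entries are
exchanged if the entry before or after them lies between them, where among equal entries the
later one counts as smaller. -/
def Knuth (f d e f' d' e' : ℕ) : Prop :=
  (f' = f ∧ d' = e ∧ e' = d ∧ ((d ≤ f ∧ f < e) ∨ (e ≤ f ∧ f < d))) ∨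
    (e' = e ∧ f' = d ∧ d' = f ∧ ((f < e ∧ e ≤ d) ∨ (d < e ∧ e ≤ f)))

theorem Knuth.symm {f d e f' d' e' : ℕ} (h : Knuth f d e f' d' e') : Knuth f' d' e' f d e := by
  unfold Knuth at *; omega

theorem Knuth.succ {f d e f' d' e' : ℕ} (h : Knuth f d e f' d' e') :
    Knuth (f + 1) (d + 1) (e + 1) (f' + 1) (d' + 1) (e' + 1) := by
  unfold Knuth at *; omega

theorem TabRest.det_two {o o' : Option ℕ} {T T1 T2 T1' T2' : ℕ → Finset ℕ} {r s r' s' : ℕ}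
    (h1 : TabRest o T T1 r) (h2 : TabRest o' T1 T2 s)
    (h1' : TabRest o T T1' r') (h2' : TabRest o' T1' T2' s') : T2 = T2' ∧ r = r' ∧ s = s' := by
  have key : ∀ {o : Option ℕ} {T T1 T1' : ℕ → Finset ℕ} {r r' : ℕ}, TabRest o T T1 r →
      TabRest o T T1' r' → T1 = T1' ∧ r = r' := by
    intro o T T1 T1' r r' h h'
    cases o with
    | none => exact ⟨h.1.trans h'.1.symm, h.2.trans h'.2.symm⟩
    | some y =>
      obtain ⟨s, rfl, h⟩ := h
      obtain ⟨s', rfl, h'⟩ := h'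
      obtain ⟨h1, rfl⟩ := h.det h'
      exact ⟨h1, rfl⟩
  obtain ⟨rfl, rfl⟩ := key h1 h1'
  obtain ⟨rfl, rfl⟩ := key h2 h2'
  exact ⟨rfl, rfl, rfl⟩

/-- Below a row from which the entries `b', a', c'` with `a' < b' < c'` are passed on. The
hypothesis `ih` serves the case that all of them are. -/
theorem knuth_of_rest_bac {a : ℕ} {ob oc : Option ℕ} {T A B C A' B' C' : ℕ → Finset ℕ}
    {r1 r2 r3 s1 s2 s3 : ℕ}
    (hab : ∀ b, ob = some b → a < b) (hbc : ∀ c, oc = some c → ∃ b, ob = some b ∧ b < c)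
    (h1 : TabRest ob T A r1) (h2 : TabRest (some a) A B r2) (h3 : TabRest oc B C r3)
    (h1' : TabRest ob T A' s1) (h2' : TabRest oc A' B' s2) (h3' : TabRest (some a) B' C' s3)
    (ih : ∀ b c t1 t2 t3 u1 u2 u3, t1 < r1 → u1 < s1 → a < b → b < c → TabIns b T A t1 →
      TabIns a A B t2 → TabIns c B C t3 → TabIns b T A' u1 → TabIns c A' B' u2 →
      TabIns a B' C' u3 → C = C' ∧ Knuth t1 t2 t3 u1 u2 u3) :
    C = C' ∧ Knuth r1 r2 r3 s1 s2 s3 := by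
  cases oc with
  | none =>
    obtain ⟨rfl, rfl⟩ := h3
    obtain ⟨rfl, rfl⟩ := h2'
    obtain ⟨hC, rfl, rfl⟩ := TabRest.det_two h1 h2 h1' h3'
    refine ⟨hC, ?_⟩
    obtain ⟨t2, rfl, g2⟩ := h2
    cases ob with
    | none =>
      obtain ⟨rfl, rfl⟩ := h1
      unfold Knuth; omega
    | some b =>
      obtain ⟨t1, rfl, g1⟩ := h1
      have := TabIns.row_lt_of_gt (hab b rfl) g1 g2
      unfold Knuth; omega
  | some c =>
    obtain ⟨b, rfl, hlt⟩ := hbc c rfl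
    obtain ⟨t1, rfl, g1⟩ := h1
    obtain ⟨t2, rfl, g2⟩ := h2
    obtain ⟨t3, rfl, g3⟩ := h3
    obtain ⟨u1, rfl, g1'⟩ := h1'
    obtain ⟨u2, rfl, g2'⟩ := h2'
    obtain ⟨u3, rfl, g3'⟩ := h3'
    obtain ⟨hC, hK⟩ := ih b c t1 t2 t3 u1 u2 u3 (by omega) (by omega) (hab b rfl) hlt
      g1 g2 g3 g1' g2' g3'
    exact ⟨hC, hK.succ⟩

/-- A Coxeter–Knuth move does not change the tableau and changes the sequence of the rows of the
new boxes by a Knuth move. -/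
theorem TabIns.knuth {p q s p' q' s' : ℕ} (h : InsTriple p q s p' q' s') {r1 : ℕ} :
    ∀ {T A B C A' B' C' : ℕ → Finset ℕ} {r2 r3 s1 s2 s3 : ℕ},
    TabIns p T A r1 → TabIns q A B r2 → TabIns s B C r3 →
    TabIns p' T A' s1 → TabIns q' A' B' s2 → TabIns s' B' C' s3 →
    C = C' ∧ Knuth r1 r2 r3 s1 s2 s3 := by
  induction r1 using Nat.strong_induction_on generalizing p q s p' q' s' with
  | _ r1 ih =>
    intro T A B C A' B' C' r2 r3 s1 s2 s3 h1 h2 h3 h1' h2' h3'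
    obtain ⟨o1, g1, e1⟩ := h1.exists_rest
    obtain ⟨o2, g2, e2⟩ := h2.exists_rest
    obtain ⟨o3, g3, e3⟩ := h3.exists_rest
    obtain ⟨o1', g1', e1'⟩ := h1'.exists_rest
    obtain ⟨o2', g2', e2'⟩ := h2'.exists_rest
    obtain ⟨o3', g3', e3'⟩ := h3'.exists_rest
    -- The outcome `(y, z, x)` against `(y, x, z)` with `x < y < z`.
    have hbca : ∀ x, o3 = some x → o2' = some x → o1 = o1' → o2 = o3' →
        (∀ y, o1 = some y → x < y) → (∀ z, o2 = some z → ∃ y, o1 = some y ∧ y < z) → C 0 = C' 0 →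
        C = C' ∧ Knuth r1 r2 r3 s1 s2 s3 := by
      rintro x rfl rfl rfl rfl hxy hyz hC0
      obtain ⟨hC, hK⟩ := knuth_of_rest_bac hxy hyz e1' e2' e3' e1 e2 e3 (by
        intro b c t1 t2 t3 u1 u2 u3 _ hlt hab hbc k1 k2 k3 k1' k2' k3'
        obtain rfl := (k1.det k1').2
        exact ih t1 hlt (.bac hab hbc) k1 k2 k3 k1' k2' k3')
      exact ⟨(tab_ext hC0.symm hC).symm, hK.symm⟩
    have hbraid : ∀ x, o1 = some x → o2 = some (x+1) → o3 = some x → o1' = some (x + 1) →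
        o2' = some x → o3' = some (x + 1) → C 0 = C' 0 → C = C' ∧ Knuth r1 r2 r3 s1 s2 s3 := by
      rintro x rfl rfl rfl rfl rfl rfl hC0
      obtain ⟨t1, rfl, k1⟩ := e1
      obtain ⟨t2, rfl, k2⟩ := e2
      obtain ⟨t3, rfl, k3⟩ := e3
      obtain ⟨u1, rfl, k1'⟩ := e1'
      obtain ⟨u2, rfl, k2'⟩ := e2'
      obtain ⟨u3, rfl, k3'⟩ := e3'
      obtain ⟨hC, hK⟩ := ih t1 (by omega) (.braid x) k1 k2 k3 k1' k2' k3'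
      exact ⟨tab_ext hC0 hC, hK.succ⟩
    cases h with
    | bac hab hbc =>
      obtain ⟨hC0, rfl, rfl, rfl, ⟨x, rfl, hxy⟩, hyz⟩ := RowIns.bac hab hbc g1 g2 g3 g1' g2' g3'
      obtain ⟨hC, hK⟩ := knuth_of_rest_bac hxy hyz e1 e2 e3 e1' e2' e3' (by
        intro b c t1 t2 t3 u1 u2 u3 hlt _ hab hbc k1 k2 k3 k1' k2' k3'
        exact ih t1 hlt (.bac hab hbc) k1 k2 k3 k1' k2' k3')
      exact ⟨tab_ext hC0 hC, hK⟩
    | acb hab hbc =>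
      obtain ⟨hC0, H⟩ := RowIns.acb hab hbc g1 g2 g3 g1' g2' g3'
      rcases H with ⟨x, y, hxy, rfl, rfl, rfl, rfl, rfl, hz⟩ | ⟨x, f1, f2, f3, f4, f5, f6⟩ |
        ⟨f1, f2, f3, f4, f5, f6⟩
      · cases o2 with
        | none =>
          obtain ⟨f1, rfl⟩ := e2
          obtain ⟨f2, rfl⟩ := e1'
          rw [f1] at e3
          rw [f2] at e2'
          obtain ⟨hC, rfl, rfl⟩ := TabRest.det_two e1 e3 e2' e3'
          refine ⟨tab_ext hC0 hC, ?_⟩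
          obtain ⟨t1, rfl, k1⟩ := e1
          obtain ⟨t3, rfl, k3⟩ := e3
          have := TabIns.row_le_of_lt hxy k1 k3
          unfold Knuth; omega
        | some z =>
          obtain ⟨t1, rfl, k1⟩ := e1
          obtain ⟨t2, rfl, k2⟩ := e2
          obtain ⟨t3, rfl, k3⟩ := e3
          obtain ⟨u1, rfl, k1'⟩ := e1'
          obtain ⟨u2, rfl, k2'⟩ := e2'
          obtain ⟨u3, rfl, k3'⟩ := e3'
          obtain ⟨hC, hK⟩ := ih t1 (by omega) (.acb hxy (hz z rfl)) k1 k2 k3 k1' k2' k3'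
          exact ⟨tab_ext hC0 hC, hK.succ⟩
      · exact hbca x f1 f2 f3 f4 f5 f6 hC0
      · exact hbraid _ f1 f2 f3 f4 f5 f6 hC0
    | braid n =>
      obtain ⟨hC0, H⟩ := RowIns.braid g1 g2 g3 g1' g2' g3'
      rcases H with ⟨x, f1, f2, f3, f4, f5, f6⟩ | ⟨x, f1, f2, f3, f4, f5, f6⟩
      · exact hbca x f1 f2 f3 f4 f5 f6 hC0
      · exact hbraid _ f1 f2 f3 f4 f5 f6 hC0

/-! ### Edelman–Greene insertion of a reduced word -/

theorem wordPerm_nil : wordPerm [] = 1 := rfl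

theorem wordPerm_cons (a : ℕ) (w : List ℕ) : wordPerm (a :: w) = swap a (a + 1) * wordPerm w := by
  simp [wordPerm]

theorem wordPerm_append (u v : List ℕ) : wordPerm (u ++ v) = wordPerm u * wordPerm v := by
  simp [wordPerm]

theorem wordPerm_cons_comm {n : ℕ} {l : List ℕ} (h : ∀ x ∈ l, n + 1 < x ∨ x + 1 < n) :
    wordPerm (n :: l) = wordPerm (l ++ [n]) := by
  induction l with
  | nil => rfl
  | cons x l ih =>
    have hx := h x (by simp)
    have hc : swap n (n + 1) * swap x (x + 1) = swap x (x + 1) * swap n (n + 1) :=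
      (Perm.disjoint_swap_swap (by simp; omega)).commute
    rw [wordPerm_cons, wordPerm_cons, ← mul_assoc, hc, mul_assoc, ← wordPerm_cons,
      ih fun y hy => h y (by simp [hy]), List.cons_append, wordPerm_cons]

theorem wordPerm_braid (n : ℕ) : wordPerm [n, n + 1, n] = wordPerm [n + 1, n, n + 1] := by
  have h1 : swap n (n + 1) * swap (n + 1) (n + 1 + 1) * swap n (n + 1) =
      swap (n + 1) (n + 1 + 1) * swap n (n + 1) * swap (n + 1) (n + 1 + 1) := by
    have e1 := swap_apply_apply (swap n (n + 1)) (n + 1) (n + 1 + 1)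
    have e2 := swap_apply_apply (swap (n + 1) (n + 1 + 1)) n (n + 1)
    rw [swap_inv, swap_apply_right, swap_apply_of_ne_of_ne (by omega) (by omega)] at e1
    rw [swap_inv, swap_apply_left, swap_apply_of_ne_of_ne (by omega) (by omega)] at e2
    rw [← e1, ← e2]
  simpa [wordPerm, mul_assoc] using h1

theorem IsWord.append {u v : List ℕ} (hu : IsWord u) (hv : IsWord v) : IsWord (u ++ v) := by
  intro a ha
  rcases List.mem_append.1 ha with h | h
  · exact hu a h
  · exact hv a h

theorem IsReducedWord.of_wordPerm_eq {w v : List ℕ} (hw : IsReducedWord w) (hv : IsWord v)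
    (h : wordPerm v = wordPerm w) (hl : v.length ≤ w.length) : IsReducedWord v :=
  ⟨hv, fun u hu he => hl.trans (hw.2 u hu (he.trans h))⟩

theorem IsReducedWord.of_append_right {u v : List ℕ} (h : IsReducedWord (u ++ v)) :
    IsReducedWord v := by
  refine ⟨fun a ha => h.1 a (by simp [ha]), fun x hx he => ?_⟩
  have := h.2 (u ++ x) (IsWord.append (fun a ha => h.1 a (by simp [ha])) hx)
    (by rw [wordPerm_append, wordPerm_append, he])
  simpa using this

/-- In a reduced word no letter `n` is followed by a block of letters commuting with it and
another `n`. -/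
theorem not_isReducedWord_of_far {n : ℕ} {A B : List ℕ} (hA : ∀ x ∈ A, n + 1 < x) :
    ¬ IsReducedWord (n :: A ++ n :: B) := fun h => by
  have := h.2 (A ++ B) (IsWord.append (fun a ha => h.1 a (by simp [ha]))
    (fun a ha => h.1 a (by simp [ha]))) (by
      rw [wordPerm_append, wordPerm_append, wordPerm_cons_comm fun x hx => Or.inl (hA x hx),
        wordPerm_append, wordPerm_cons n B, wordPerm_cons, wordPerm_nil]
      simp [mul_assoc])
  simp at this

/-- The entries of a strictly increasing row which are at most `n`, and the others. -/
theorem row_split {n : ℕ} {row : List ℕ} (hs : row.Pairwise (· < ·)) :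
    row = row.takeWhile (fun r => decide (r ≤ n)) ++ row.dropWhile (fun r => decide (r ≤ n)) ∧
      (∀ x ∈ row.takeWhile (fun r => decide (r ≤ n)), x ≤ n) ∧
      ∀ x ∈ row.dropWhile (fun r => decide (r ≤ n)), n < x := by
  refine ⟨List.takeWhile_append_dropWhile.symm, fun x hx => by
    simpa using List.mem_takeWhile_imp hx, ?_⟩
  induction row with
  | nil => simp
  | cons a row ih =>
    rw [List.pairwise_cons] at hs
    rw [List.dropWhile_cons]
    split_ifs with h
    · exact ih hs.2
    · intro x hx
      simp only [decide_eq_true_eq, not_le] at h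
      rcases List.mem_cons.1 hx with rfl | hx
      · exact h
      · exact h.trans (hs.1 x hx)

/-- Insertion of a letter into a row is a sequence of Coxeter relations: it preserves the
permutation of the row, read from right to left, followed by the entry passed on. Reducedness
excludes the case that `n` is in the row without `n + 1`. -/
theorem rowInsert_spec {n : ℕ} {row rest : List ℕ} (hs : row.Pairwise (· < ·))
    (hr : IsReducedWord (n :: row.reverse ++ rest)) :
    ∃ row' o, rowInsert n row = (row', o) ∧ row'.Pairwise (· < ·) ∧
      RowIns n row.toFinset row'.toFinset o ∧
      wordPerm (n :: row.reverse) = wordPerm (row'.reverse ++ o.toList) ∧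
      row'.length + o.toList.length = row.length + 1 := by
  obtain ⟨hsplit, hA, hD⟩ := row_split (n := n) hs
  unfold rowInsert
  generalize row.takeWhile (fun r => decide (r ≤ n)) = A at *
  generalize row.dropWhile (fun r => decide (r ≤ n)) = D at *
  subst hsplit
  rw [List.pairwise_append] at hs
  obtain ⟨hsA, hsD, hAD⟩ := hs
  -- If `n` occurs in the row, then it is the last entry of `A`.
  have hlast : n ∈ A → ∃ A₀, A = A₀ ++ [n] ∧ ∀ x ∈ A₀, x < n := by
    intro h
    obtain ⟨A₀, b, rfl⟩ : ∃ A₀ b, A = A₀ ++ [b] :=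
      ⟨A.dropLast, A.getLast (List.ne_nil_of_mem h), (List.dropLast_append_getLast _).symm⟩
    rw [List.pairwise_append] at hsA
    have hb : b = n := by
      have h1 := hA b (by simp)
      rcases List.mem_append.1 h with h | h
      · have := hsA.2.2 n h b (by simp); omega
      · exact (List.mem_singleton.1 h).symm
    subst hb
    exact ⟨A₀, rfl, fun x hx => hsA.2.2 x hx b (by simp)⟩
  match D with
  | [] =>
    have hn : n ∉ A := fun h => by
      obtain ⟨A₀, rfl, -⟩ := hlast h
      refine not_isReducedWord_of_far (n := n) (A := []) (B := A₀.reverse ++ rest) (by simp) ?_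
      simpa using hr
    have hlt : ∀ x ∈ A, x < n := fun x hx => by
      have := hA x hx
      rcases this.lt_or_eq with h | rfl
      · exact h
      · exact absurd hx hn
    refine ⟨A ++ [n], none, by simp, ?_, ⟨?_, ?_, ?_, ?_⟩, by simp, by simp⟩
    · rw [List.pairwise_append]
      exact ⟨hsA, by simp, by simpa using hlt⟩
    · simpa using hlt
    · simp
    · simp [hn]
    · intro x
      simp [or_comm]
  | y :: E =>
    have hy := hD y (by simp)
    rw [List.pairwise_cons] at hsD
    by_cases hc : y = n + 1 ∧ A.getLast? = some n
    · obtain ⟨rfl, hl⟩ := hc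
      obtain ⟨A₀, rfl, hA₀⟩ := hlast (List.mem_of_getLast? hl)
      refine ⟨A₀ ++ [n] ++ (n + 1) :: E, some (n + 1), by simp, ?_, ⟨?_, ?_, ?_, ?_⟩, ?_, by simp⟩
      · rw [List.pairwise_append]
        exact ⟨hsA, List.pairwise_cons.2 hsD, hAD⟩
      · simp
      · simp
      · simp
      · intro x
        simp only [List.mem_toFinset]
        simp
        rintro rfl
        simp
      · have e1 : wordPerm (n :: E.reverse) = wordPerm (E.reverse ++ [n]) :=
          wordPerm_cons_comm fun x hx => Or.inl (hsD.1 x (by simpa using hx))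
        have e2 : wordPerm ((n + 1) :: A₀.reverse) = wordPerm (A₀.reverse ++ [n + 1]) :=
          wordPerm_cons_comm fun x hx => Or.inr (by
            have := hA₀ x (by simpa using hx); omega)
        calc wordPerm (n :: (A₀ ++ [n] ++ (n + 1) :: E).reverse)
            = wordPerm (n :: E.reverse) * wordPerm ([n + 1, n] ++ A₀.reverse) := by
              rw [← wordPerm_append]; simp
          _ = wordPerm E.reverse * wordPerm [n, n + 1, n] * wordPerm A₀.reverse := by
              rw [e1, mul_assoc, ← wordPerm_append, ← wordPerm_append, ← wordPerm_append]; simp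
          _ = wordPerm (E.reverse ++ [n + 1, n]) * wordPerm ((n + 1) :: A₀.reverse) := by
              rw [wordPerm_braid, ← wordPerm_append, ← wordPerm_append, ← wordPerm_append]; simp
          _ = _ := by rw [e2, ← wordPerm_append]; simp
    · have hn : n ∉ A := fun h => by
        obtain ⟨A₀, rfl, -⟩ := hlast h
        have hy1 : n + 1 < y := by
          by_contra h1
          exact hc ⟨by omega, by simp⟩
        refine not_isReducedWord_of_far (n := n) (A := (y :: E).reverse)
          (B := A₀.reverse ++ rest) ?_ (by simpa using hr)
        intro x hx
        rcases List.mem_cons.1 (List.mem_reverse.1 hx) with rfl | hx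
        · exact hy1
        · have := hsD.1 x hx; omega
      have hlt : ∀ x ∈ A, x < n := fun x hx => by
        have := hA x hx
        rcases this.lt_or_eq with h | rfl
        · exact h
        · exact absurd hx hn
      refine ⟨A ++ n :: E, some y, by simp [hc], ?_, ⟨?_, ?_, ?_, ?_⟩, ?_, by simp⟩
      · rw [List.pairwise_append, List.pairwise_cons]
        exact ⟨hsA, ⟨fun x hx => hy.trans (hsD.1 x hx), hsD.2⟩, by
          intro a ha b hb
          rcases List.mem_cons.1 hb with rfl | hb
          · exact hlt a ha
          · exact (hlt a ha).trans (hy.trans (hsD.1 b hb))⟩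
      · simp
      · simp only [Option.some.injEq, List.mem_toFinset, List.mem_append, List.mem_cons]
        rintro _ rfl
        refine ⟨by simp, hy, ?_⟩
        rintro r (h | rfl | h) hr'
        · have := hA r h; omega
        · exact le_rfl
        · exact (hsD.1 r h).le
      · simp only [List.mem_toFinset, List.mem_append, List.mem_cons]
        rintro (h | rfl | h)
        · exact absurd h hn
        · omega
        · have := hsD.1 n h; omega
      · intro x
        have h1 : n ∉ E := fun h => by have := hsD.1 n h; omega
        have h2 : x ∈ A → y ≠ x := by rintro h rfl; have := hA y h; omega
        have h3 : x ∈ E → y ≠ x := by rintro h rfl; have := hsD.1 y h; omega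
        have h4 : n ≠ y := by omega
        simp only [List.mem_toFinset, List.mem_append, List.mem_cons, Option.some.injEq, ne_eq]
        grind
      · have e1 : wordPerm (n :: E.reverse) = wordPerm (E.reverse ++ [n]) :=
          wordPerm_cons_comm fun x hx => Or.inl (by
            have := hsD.1 x (by simpa using hx); omega)
        have e2 : wordPerm (y :: A.reverse) = wordPerm (A.reverse ++ [y]) :=
          wordPerm_cons_comm fun x hx => Or.inr (by
            have := hlt x (by simpa using hx); omega)
        calc wordPerm (n :: (A ++ y :: E).reverse)
            = wordPerm (n :: E.reverse) * wordPerm (y :: A.reverse) := by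
              rw [← wordPerm_append]; simp
          _ = _ := by rw [e1, e2, ← wordPerm_append]; simp

/-- The reading word of a tableau: its rows from top to bottom, each from right to left. -/
def reading (T : List (List ℕ)) : List ℕ := T.flatMap List.reverse

/-- A tableau as a function giving the set of entries of each row. -/
def toTab (T : List (List ℕ)) : ℕ → Finset ℕ := fun k => (T.getD k []).toFinset

theorem reading_cons (row : List ℕ) (T : List (List ℕ)) :
    reading (row :: T) = row.reverse ++ reading T := by simp [reading]

theorem tableauInsert_spec (T : List (List ℕ)) : ∀ (n : ℕ),
    (∀ row ∈ T, row.Pairwise (· < ·)) → IsReducedWord (n :: reading T) →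
    (∀ row ∈ (tableauInsert n T).1, row.Pairwise (· < ·)) ∧
      TabIns n (toTab T) (toTab (tableauInsert n T).1) (tableauInsert n T).2 ∧
      wordPerm (reading (tableauInsert n T).1) = wordPerm (n :: reading T) ∧
      (reading (tableauInsert n T).1).length = (reading T).length + 1 ∧
      IsWord (reading (tableauInsert n T).1) := by
  induction T with
  | nil =>
    intro n _ hr
    refine ⟨by simp [tableauInsert], ?_, by simp [tableauInsert, reading],
      by simp [tableauInsert, reading], by simpa [tableauInsert, reading] using hr.1⟩
    simp only [tableauInsert]
    refine ⟨⟨?_, ?_, ?_, ?_⟩, ?_⟩ <;> simp [toTab]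
  | cons row T ih =>
    intro n hT hr
    rw [reading_cons, ← List.cons_append] at hr
    obtain ⟨row', o, he, hs, hins, hp, hl⟩ := rowInsert_spec (hT row (by simp)) hr
    have hrow' : ∀ x ∈ row', 1 ≤ x := fun x hx => by
      rcases (hins.mem_iff x).1 (by simpa using hx) with rfl | ⟨h, -⟩
      · exact hr.1 x (by simp)
      · exact hr.1 x (by simpa using Or.inr (Or.inl (by simpa using h)))
    have hTs : ∀ row ∈ T, row.Pairwise (· < ·) := fun r h => hT r (by simp [h])
    cases o with
    | none =>
      have hi : tableauInsert n (row :: T) = (row' :: T, 0) := by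
        rw [tableauInsert, he]
      simp only [hi]
      refine ⟨?_, ⟨?_, ?_⟩, ?_, ?_, ?_⟩
      · intro r h
        rcases List.mem_cons.1 h with rfl | h
        · exact hs
        · exact hTs r h
      · simpa [toTab] using hins
      · intro k
        simp [toTab]
      · rw [reading_cons, reading_cons, ← List.cons_append, wordPerm_append, wordPerm_append, hp]
        simp
      · simp only [Option.toList_none, List.length_nil] at hl
        simp [reading_cons]; omega
      · rw [reading_cons]
        exact IsWord.append (fun x hx => hrow' x (by simpa using hx))
          fun x hx => hr.1 x (by simp [hx])
    | some y =>
      have hi : tableauInsert n (row :: T) =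
          (row' :: (tableauInsert y T).1, (tableauInsert y T).2 + 1) := by
        rw [tableauInsert, he]
      simp only [hi]
      have hy : 1 ≤ y := hr.1 y (by
        have := (hins.mem_out y rfl).1
        simp only [List.mem_toFinset] at this
        simp [this])
      have hred : IsReducedWord (row'.reverse ++ y :: reading T) := by
        refine hr.of_wordPerm_eq (IsWord.append (fun x hx => hrow' x (by simpa using hx)) ?_) ?_ ?_
        · intro x hx
          rcases List.mem_cons.1 hx with rfl | hx
          · exact hy
          · exact hr.1 x (by simp [hx])
        · rw [wordPerm_append (n :: row.reverse), hp, ← wordPerm_append]; simp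
        · simp at hl ⊢; omega
      obtain ⟨h1, h2, h3, h4, h5⟩ := ih y hTs hred.of_append_right
      refine ⟨?_, ⟨y, ?_, ?_⟩, ?_, ?_, ?_⟩
      · intro r h
        rcases List.mem_cons.1 h with rfl | h
        · exact hs
        · exact h1 r h
      · simpa [toTab] using hins
      · exact h2
      · rw [reading_cons, wordPerm_append, h3, ← wordPerm_append, reading_cons,
          ← List.cons_append, wordPerm_append (n :: row.reverse), hp, ← wordPerm_append]
        simp
      · simp only [Option.toList_some, List.length_singleton] at hl
        simp [reading_cons]; omega
      · rw [reading_cons]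
        exact IsWord.append (fun x hx => hrow' x (by simpa using hx)) h5

/-- The rows in which the boxes of the recording tableau are added, one for each letter. -/
def rowsOf : List ℕ → List ℕ
  | [] => []
  | a :: w => (tableauInsert a (P w)).2 :: rowsOf w

/-- `EGRel w T y`: insertion of the letters of `w` from right to left yields the tableau `T`, and
the boxes are added in the rows `y`. -/
inductive EGRel : List ℕ → (ℕ → Finset ℕ) → List ℕ → Prop
  | nil : EGRel [] (fun _ => ∅) []
  | cons {a r : ℕ} {w y : List ℕ} {T T' : ℕ → Finset ℕ} (h : EGRel w T y)
      (ha : TabIns a T T' r) : EGRel (a :: w) T' (r :: y)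

theorem EGRel.det {w y y' : List ℕ} {T T' : ℕ → Finset ℕ} (h : EGRel w T y)
    (h' : EGRel w T' y') : T = T' ∧ y = y' := by
  induction h generalizing T' y' with
  | nil => cases h'; exact ⟨rfl, rfl⟩
  | cons h ha ih =>
    cases h' with
    | cons g ga =>
      obtain ⟨rfl, rfl⟩ := ih g
      obtain ⟨rfl, rfl⟩ := ha.det ga
      exact ⟨rfl, rfl⟩

theorem IsReducedWord.egRel_aux {w : List ℕ} (hw : IsReducedWord w) :
    EGRel w (toTab (P w)) (rowsOf w) ∧ (∀ row ∈ P w, row.Pairwise (· < ·)) ∧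
      wordPerm (reading (P w)) = wordPerm w ∧ (reading (P w)).length = w.length ∧
      IsWord (reading (P w)) := by
  induction w with
  | nil =>
    refine ⟨?_, by simp [P, EG], by simp [P, EG, reading], by simp [P, EG, reading],
      by simp [P, EG, reading, IsWord]⟩
    have : toTab (P []) = fun _ => ∅ := by funext k; simp [toTab, P, EG]
    rw [this]
    exact .nil
  | cons a w ih =>
    have hw' : IsReducedWord w := IsReducedWord.of_append_right (u := [a]) (by simpa using hw)
    obtain ⟨h1, h2, h3, h4, h5⟩ := ih hw'
    have hP : P (a :: w) = (tableauInsert a (P w)).1 := rfl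
    have hred : IsReducedWord (a :: reading (P w)) := by
      refine hw.of_wordPerm_eq ?_ (by rw [wordPerm_cons, h3, wordPerm_cons]) (by simp [h4])
      intro x hx
      rcases List.mem_cons.1 hx with rfl | hx
      · exact hw.1 x (by simp)
      · exact h5 x hx
    obtain ⟨g1, g2, g3, g4, g5⟩ := tableauInsert_spec (P w) a h2 hred
    rw [hP]
    refine ⟨.cons h1 g2, g1, ?_, by rw [g4, h4]; simp, g5⟩
    rw [g3, wordPerm_cons, h3, wordPerm_cons]

theorem IsReducedWord.egRel {w : List ℕ} (hw : IsReducedWord w) :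
    EGRel w (toTab (P w)) (rowsOf w) := hw.egRel_aux.1

/-! ### Recorded rows and Coxeter–Knuth moves -/

/-- Knuth moves on words of row numbers at the positions `k, k + 1, k + 2`. -/
inductive KnuthAt : ℕ → List ℕ → List ℕ → Prop
  | head {f d e f' d' e' : ℕ} (l : List ℕ) (h : Knuth f d e f' d' e') :
      KnuthAt 0 (e :: d :: f :: l) (e' :: d' :: f' :: l)
  | cons {k : ℕ} (a : ℕ) {l l' : List ℕ} (h : KnuthAt k l l') :
      KnuthAt (k + 1) (a :: l) (a :: l')

theorem KnuthAt.symm {k : ℕ} {l l' : List ℕ} (h : KnuthAt k l l') : KnuthAt k l' l := by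
  induction h with
  | head l h => exact .head l h.symm
  | cons a h ih => exact .cons a ih

/-- A Coxeter–Knuth move does not change the insertion tableau and changes the recorded rows by a
Knuth move at the same place. -/
theorem EGRel.knuthAt {A B : List ℕ} {x y z x' y' z' : ℕ}
    (h : InsTriple z y x z' y' x') {T T' : ℕ → Finset ℕ} {u u' : List ℕ}
    (hu : EGRel (A ++ x :: y :: z :: B) T u) (hu' : EGRel (A ++ x' :: y' :: z' :: B) T' u') :
    T = T' ∧ KnuthAt A.length u u' := by
  induction A generalizing T T' u u' with
  | nil =>
    simp only [List.nil_append] at hu hu'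
    obtain _ | ⟨hu, h3⟩ := hu
    obtain _ | ⟨hu, h2⟩ := hu
    obtain _ | ⟨hu, h1⟩ := hu
    obtain _ | ⟨hu', h3'⟩ := hu'
    obtain _ | ⟨hu', h2'⟩ := hu'
    obtain _ | ⟨hu', h1'⟩ := hu'
    obtain ⟨rfl, rfl⟩ := hu.det hu'
    obtain ⟨h4, h5⟩ := TabIns.knuth h h1 h2 h3 h1' h2' h3'
    exact ⟨h4, .head _ h5⟩
  | cons a A ih =>
    simp only [List.cons_append] at hu hu'
    obtain _ | ⟨hu, h1⟩ := hu
    obtain _ | ⟨hu', h1'⟩ := hu'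
    obtain ⟨rfl, h2⟩ := ih hu hu'
    obtain ⟨h3, rfl⟩ := h1.det h1'
    exact ⟨h3, .cons _ h2⟩

/-- The ascents of a word are the descents of the recorded rows. -/
theorem EGRel.lt_iff {w u : List ℕ} {T : ℕ → Finset ℕ} (h : EGRel w T u) {i : ℕ}
    (hi : i + 1 < w.length) (hne : w.getD i 0 ≠ w.getD (i + 1) 0) :
    w.getD i 0 < w.getD (i + 1) 0 ↔ u.getD (i + 1) 0 < u.getD i 0 := by
  induction i generalizing w u T with
  | zero =>
    obtain _ | ⟨h, h1⟩ := h
    · simp at hi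
    obtain _ | ⟨h, h2⟩ := h
    · simp at hi
    simp only [List.getD_cons_zero, List.getD_cons_succ, zero_add] at hne ⊢
    rcases lt_or_gt_of_ne hne with hlt | hlt
    · have := h2.row_lt_of_gt hlt h1
      omega
    · have := h2.row_le_of_lt hlt h1
      omega
  | succ i ih =>
    obtain _ | ⟨h, h1⟩ := h
    · simp at hi
    exact ih h (by simpa using hi) (by simpa using hne)

theorem EGRel.length_eq {w u : List ℕ} {T : ℕ → Finset ℕ} (h : EGRel w T u) :
    u.length = w.length := by
  induction h with
  | nil => rfl
  | cons h ha ih => simp [ih]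

/-! ### The columns of the insertion tableau -/

/-- Two consecutive rows with strictly increasing columns: for all `j`, the `j`-th entry of the
lower row `S` is larger than the `j`-th entry of `R`. -/
def ColStrict (R S : Finset ℕ) : Prop :=
  ∀ x, (S.filter (· ≤ x)).card ≤ (R.filter (· < x)).card

theorem RowIns.notMem_of_none {n : ℕ} {R R' : Finset ℕ} (h : RowIns n R R' none) : n ∉ R :=
  fun hn => by simpa using h.out_of_mem hn

theorem RowIns.eq_insert {n : ℕ} {R R' : Finset ℕ} (h : RowIns n R R' none) :
    R' = insert n R := by
  ext x
  rw [h.mem_iff]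
  simp

theorem RowIns.eq_of_mem {n : ℕ} {R R' : Finset ℕ} {o : Option ℕ} (h : RowIns n R R' o)
    (hn : n ∈ R) : R' = R := by
  ext x
  rw [h.mem_iff]
  grind

theorem RowIns.eq_insert_erase {n y : ℕ} {R R' : Finset ℕ} (h : RowIns n R R' (some y))
    (hn : n ∉ R) : R' = insert n (R.erase y) := by
  ext x
  rw [h.mem_iff]
  simp [hn, and_comm, eq_comm]

/-- One entry is exchanged for another one. -/
theorem RowIns.card_filter {n y : ℕ} {R R' : Finset ℕ} (h : RowIns n R R' (some y))
    (hn : n ∉ R) (p : ℕ → Prop) [DecidablePred p] :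
    (R'.filter p).card + (if p y then 1 else 0) = (R.filter p).card + if p n then 1 else 0 := by
  have hy := (h.mem_out y rfl).1
  rw [h.eq_insert_erase hn, Finset.filter_insert, Finset.filter_erase]
  have h1 : (R.filter p).card = ((R.filter p).erase y).card + if p y then 1 else 0 := by
    split_ifs with hp
    · rw [Finset.card_erase_add_one (by simp [hy, hp])]
    · rw [Finset.erase_eq_of_notMem (by simp [hp])]; rfl
  rw [h1]
  by_cases hp : p n
  · rw [if_pos hp, if_pos hp, Finset.card_insert_of_notMem (by simp [hn])]
    omega
  · rw [if_neg hp, if_neg hp]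
    rfl

theorem ColStrict.insert_none {n : ℕ} {R R' S : Finset ℕ} (hc : ColStrict R S)
    (h : RowIns n R R' none) : ColStrict R' S := by
  intro x
  refine (hc x).trans (Finset.card_le_card (Finset.filter_subset_filter _ ?_))
  rw [h.eq_insert]
  exact Finset.subset_insert _ _

theorem ColStrict.insert_some {n y : ℕ} {o : Option ℕ} {R R' S S' : Finset ℕ}
    (hc : ColStrict R S) (h : RowIns n R R' (some y)) (h' : RowIns y S S' o) :
    ColStrict R' S' := by
  intro x
  obtain ⟨hyR, hny, hmin⟩ := h.mem_out y rfl
  have hR : (R.filter (· < x)).card ≤ (R'.filter (· < x)).card := by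
    by_cases hn : n ∈ R
    · rw [h.eq_of_mem hn]
    · have := h.card_filter hn (· < x)
      split_ifs at this <;> omega
  by_cases hyS : y ∈ S
  · rw [h'.eq_of_mem hyS]
    exact (hc x).trans hR
  by_cases hx : y ≤ x ∧ ∀ z, o = some z → x < z
  · obtain ⟨hyx, hz⟩ := hx
    -- Only the new entry `y` of `S'` lies between `y` and `x`.
    have h1 : S'.filter (· ≤ x) = insert y (S.filter (· ≤ y - 1)) := by
      ext s
      simp only [Finset.mem_filter, Finset.mem_insert, h'.mem_iff]
      constructor
      · rintro ⟨rfl | ⟨hs, -⟩, hsx⟩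
        · exact Or.inl rfl
        · right
          refine ⟨hs, ?_⟩
          have e1 : s ≠ y := fun e => hyS (e ▸ hs)
          by_contra hlt
          cases o with
          | none => have := h'.lt_of_none rfl s hs; omega
          | some z =>
            have := (h'.mem_out z rfl).2.2 s hs (by omega)
            have := hz z rfl
            omega
      · rintro (rfl | ⟨hs, hsy⟩)
        · exact ⟨Or.inl rfl, hyx⟩
        · refine ⟨Or.inr ⟨hs, Or.inr fun e => ?_⟩, by omega⟩
          have := hz s e
          omega
    rw [h1, Finset.card_insert_of_notMem (by simp [hyS])]
    have h2 := hc (y - 1)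
    have key : ∀ t : ℕ, t ∈ R' → y - 1 ≤ t → t < x →
        (∀ s ∈ R, s < y - 1 → s ∈ R') → (R.filter (· < y - 1)).card + 1 ≤
          (R'.filter (· < x)).card := by
      intro t ht hyt htx hsub
      rw [← Finset.card_insert_of_notMem (a := t) (by simp; omega)]
      apply Finset.card_le_card
      intro s hs
      simp only [Finset.mem_insert, Finset.mem_filter] at hs ⊢
      rcases hs with rfl | ⟨hs, hsy⟩
      · exact ⟨ht, htx⟩
      · exact ⟨hsub s hs hsy, by omega⟩
    have hsub : ∀ s ∈ R, s < y - 1 → s ∈ R' := fun s hs hsy => by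
      rw [h.mem_iff]
      exact Or.inr ⟨hs, Or.inr fun e => by simp only [Option.some.injEq] at e; omega⟩
    by_cases hn : n ∈ R
    · have hy := h.out_of_mem hn
      simp only [Option.some.injEq] at hy
      exact (Nat.succ_le_succ h2).trans
        (key n ((h.mem_iff n).2 (Or.inl rfl)) (by omega) (by omega) hsub)
    · have e1 := h.card_filter hn (· < x)
      rw [if_pos (by omega : n < x)] at e1
      have e2 : (R.filter (· < y - 1)).card + (if y < x then 1 else 0) ≤
          (R.filter (· < x)).card := by
        split_ifs with hyx'
        · rw [← Finset.card_insert_of_notMem (a := y) (by simp)]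
          apply Finset.card_le_card
          intro s hs
          simp only [Finset.mem_insert, Finset.mem_filter] at hs ⊢
          rcases hs with rfl | ⟨hs, hsy⟩
          · exact ⟨hyR, hyx'⟩
          · exact ⟨hs, by omega⟩
        · apply Finset.card_le_card
          intro s hs
          simp only [Finset.mem_filter] at hs ⊢
          exact ⟨hs.1, by omega⟩
      omega
  · refine le_trans ?_ ((hc x).trans hR)
    cases o with
    | none =>
      rw [h'.eq_insert, Finset.filter_insert, if_neg (by simpa using hx)]
    | some z =>
      have e1 := h'.card_filter hyS (· ≤ x)
      have e2 := (h'.mem_out z rfl).2.1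
      simp only [Option.some.injEq, forall_eq', not_and, not_lt] at hx
      split_ifs at e1 <;> omega

theorem TabIns.colStrict {n r : ℕ} {T T' : ℕ → Finset ℕ} (h : TabIns n T T' r)
    (hc : ∀ k, ColStrict (T k) (T (k + 1))) : ∀ k, ColStrict (T' k) (T' (k + 1)) := by
  induction r generalizing n T T' with
  | zero =>
    intro k
    cases k with
    | zero => rw [h.2 0]; exact (hc 0).insert_none h.1
    | succ k => rw [h.2 k, h.2 (k + 1)]; exact hc (k + 1)
  | succ r ih =>
    obtain ⟨y, h1, h2⟩ := h
    intro k
    cases k with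
    | zero =>
      obtain ⟨o, h3, -⟩ := h2.exists_rest
      exact (hc 0).insert_some h1 h3
    | succ k => exact ih h2 (fun k => hc (k + 1)) k

theorem TabIns.card {n r : ℕ} {T T' : ℕ → Finset ℕ} (h : TabIns n T T' r) (k : ℕ) :
    (T' k).card = (T k).card + if r = k then 1 else 0 := by
  induction r generalizing n T T' k with
  | zero =>
    cases k with
    | zero => rw [h.1.eq_insert, Finset.card_insert_of_notMem h.1.notMem_of_none]; rfl
    | succ k => rw [h.2 k]; rfl
  | succ r ih =>
    obtain ⟨y, h1, h2⟩ := h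
    cases k with
    | zero =>
      by_cases hn : n ∈ T 0
      · rw [h1.eq_of_mem hn]; rfl
      · simpa using h1.card_filter hn (fun _ => True)
    | succ k => rw [ih h2 k]; simp

/-- Yamanouchi words, read from right to left: after each letter `r ≥ 1`, there are at most as many
letters `r` as letters `r - 1`. These are the sequences of rows of standard Young tableaux. -/
def Yamanouchi : List ℕ → Prop
  | [] => True
  | r :: y => Yamanouchi y ∧ (r = 0 ∨ y.count r < y.count (r - 1))

theorem EGRel.yamanouchi {w u : List ℕ} {T : ℕ → Finset ℕ} (h : EGRel w T u) :
    Yamanouchi u ∧ (∀ k, u.count k = (T k).card) ∧ ∀ k, ColStrict (T k) (T (k + 1)) := by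
  induction h with
  | nil => exact ⟨trivial, by simp, fun k x => by simp⟩
  | @cons a r w y T T' h ha ih =>
    obtain ⟨h1, h2, h3⟩ := ih
    have hc := ha.colStrict h3
    have hcount : ∀ k, (r :: y).count k = (T' k).card := fun k => by
      rw [List.count_cons, ha.card, h2]; simp
    refine ⟨⟨h1, ?_⟩, hcount, hc⟩
    by_contra! hr
    obtain ⟨hr0, hr⟩ := hr
    -- Row `r` cannot become longer than row `r - 1`.
    have e1 := hc (r - 1) (∑ x ∈ T' r, x)
    rw [Nat.sub_add_cancel (by omega), Finset.filter_true_of_mem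
      (fun x hx => Finset.single_le_sum (f := fun x => x) (fun _ _ => Nat.zero_le _) hx)] at e1
    have e2 := e1.trans (Finset.card_le_card (Finset.filter_subset _ _))
    rw [ha.card, ha.card, ← h2, ← h2, if_pos rfl, if_neg (by omega)] at e2
    omega

/-! ### Yamanouchi words are determined by descents and Knuth moves -/

theorem Knuth.det {f d e f' d' e' f'' d'' e'' : ℕ} (h : Knuth f d e f' d' e')
    (h' : Knuth f d e f'' d'' e'') : f' = f'' ∧ d' = d'' ∧ e' = e'' := by
  unfold Knuth at *; omega

theorem KnuthAt.det {k : ℕ} {l l' l'' : List ℕ} (h : KnuthAt k l l') (h' : KnuthAt k l l'') :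
    l' = l'' := by
  induction h generalizing l'' with
  | head l h =>
    cases h' with
    | head _ h' =>
      obtain ⟨rfl, rfl, rfl⟩ := h.det h'
      rfl
  | cons a h ih =>
    cases h' with
    | cons _ h' => rw [ih h']

/-- A finite sequence of Knuth moves. -/
def KnuthEquiv : List ℕ → List ℕ → Prop := Relation.ReflTransGen fun l l' => ∃ k, KnuthAt k l l'

theorem KnuthEquiv.cons (a : ℕ) {l l' : List ℕ} (h : KnuthEquiv l l') :
    KnuthEquiv (a :: l) (a :: l') := by
  induction h with
  | refl => exact .refl
  | tail _ h ih =>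
    obtain ⟨k, hk⟩ := h
    exact ih.tail ⟨k + 1, .cons a hk⟩

theorem KnuthAt.perm {k : ℕ} {l l' : List ℕ} (h : KnuthAt k l l') : l.Perm l' := by
  induction h with
  | @head f d e f' d' e' l h =>
    rcases h with ⟨rfl, rfl, rfl, -⟩ | ⟨rfl, rfl, rfl, -⟩
    · exact .swap _ _ _
    · exact .cons _ (.swap _ _ _)
  | cons a h ih => exact ih.cons a

theorem KnuthEquiv.perm {l l' : List ℕ} (h : KnuthEquiv l l') : l.Perm l' := by
  induction h with
  | refl => exact .refl _
  | tail _ h ih => exact ih.trans h.choose_spec.perm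

/-- Any removable row can be moved to the front by Knuth moves. -/
theorem Yamanouchi.exists_knuthEquiv (n : ℕ) : ∀ {t : List ℕ} {d : ℕ}, t.length = n →
    Yamanouchi t → t.count (d + 1) < t.count d →
    ∃ t', KnuthEquiv t (d :: t') ∧ Yamanouchi (d :: t') := by
  induction n using Nat.strong_induction_on with
  | _ n ih =>
    intro t d hl ht hd
    match t, ht with
    | [], _ => simp at hd
    | e :: t₁, ⟨ht₁, he⟩ =>
      by_cases hed : e = d
      · subst hed
        exact ⟨t₁, .refl, ht₁, he⟩
      simp only [List.length_cons] at hl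
      rw [List.count_cons, List.count_cons] at hd
      simp only [beq_iff_eq, if_neg hed, add_zero] at hd
      obtain ⟨t₂, h₂, hy₂, hd₂⟩ := ih t₁.length (by omega) rfl ht₁ (d := d) (by omega)
      -- The counts of `t₁` are those of `t₂` with `d` added.
      have hc : ∀ x, t₁.count x = t₂.count x + if d = x then 1 else 0 := fun x => by
        rw [h₂.perm.count_eq, List.count_cons]
        simp
      rw [hc, hc] at hd he
      have hlen : t₁.length = t₂.length + 1 := h₂.perm.length_eq
      set f := max d e - 1 with hf
      have hfr : t₂.count (f + 1) < t₂.count f := by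
        rcases lt_or_gt_of_ne hed with h | h
        · have e1 : f = d - 1 := by omega
          have e2 : f + 1 = d := by omega
          rw [e2, e1]
          omega
        · have e1 : f = e - 1 := by omega
          have e2 : f + 1 = e := by omega
          rw [e2, e1]
          rcases eq_or_ne (e - 1) d with h' | h'
          · have e3 : d + 1 = e := by omega
            rw [e3] at hd
            rw [h']
            split_ifs at hd <;> omega
          · split_ifs at he <;> omega
      obtain ⟨t₃, h₃, hy₃, hf₃⟩ := ih t₂.length (by omega) rfl hy₂ (d := f) hfr
      have hc₃ : ∀ x, (f :: t₃).count x = t₂.count x := fun x => (h₃.perm.count_eq x).symm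
      refine ⟨e :: f :: t₃, ?_, ⟨⟨hy₃, hf₃⟩, ?_⟩, ?_⟩
      · refine ((h₂.cons e).trans ((h₃.cons d).cons e)).tail ⟨0, .head _ ?_⟩
        unfold Knuth
        omega
      · rw [hc₃, hc₃]
        rcases Nat.eq_zero_or_pos e with h0 | h0
        · exact Or.inl h0
        right
        rcases eq_or_ne (e - 1) d with h' | h'
        · have e3 : d + 1 = e := by omega
          rw [e3] at hd
          rw [h']
          split_ifs at hd <;> omega
        · split_ifs at he <;> omega
      · rcases hd₂ with h | h
        · exact Or.inl h
        right
        rw [List.count_cons (l := f :: t₃), List.count_cons (l := f :: t₃), hc₃, hc₃]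
        simp only [beq_iff_eq, if_neg hed]
        omega

/-- A relation between Yamanouchi words of the same length which preserves descents, and along which
every Knuth move of one of the words can be followed by the other word. -/
structure KnuthBisim (ℛ : List ℕ → List ℕ → Prop) : Prop where
  length_eq : ∀ {y z}, ℛ y z → y.length = z.length
  left : ∀ {y z}, ℛ y z → Yamanouchi y
  right : ∀ {y z}, ℛ y z → Yamanouchi z
  lt_iff : ∀ {y z}, ℛ y z → ∀ i, i + 1 < y.length →
    (y.getD (i + 1) 0 < y.getD i 0 ↔ z.getD (i + 1) 0 < z.getD i 0)
  knuth : ∀ {y z}, ℛ y z → ∀ k, (∃ y', KnuthAt k y y') ∨ (∃ z', KnuthAt k z z') →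
    ∃ y' z', ℛ y' z' ∧ KnuthAt k y y' ∧ KnuthAt k z z'

theorem KnuthBisim.flip {ℛ : List ℕ → List ℕ → Prop} (h : KnuthBisim ℛ) :
    KnuthBisim fun y z => ℛ z y where
  length_eq hr := (h.length_eq hr).symm
  left hr := h.right hr
  right hr := h.left hr
  lt_iff hr i hi := (h.lt_iff hr i (by rw [h.length_eq hr]; exact hi)).symm
  knuth hr k hk := by
    obtain ⟨y', z', h1, h2, h3⟩ := h.knuth hr k hk.symm
    exact ⟨z', y', h1, h3, h2⟩

theorem KnuthBisim.transport {ℛ : List ℕ → List ℕ → Prop} (h : KnuthBisim ℛ) {p q : ℕ}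
    {t t' : List ℕ} (hr : ℛ (p :: t) (q :: t)) (ht : KnuthEquiv t t') :
    ℛ (p :: t') (q :: t') := by
  induction ht with
  | refl => exact hr
  | tail _ hk ih =>
    obtain ⟨k, hk⟩ := hk
    obtain ⟨y', z', h1, h2, h3⟩ := h.knuth ih (k + 1) (Or.inl ⟨_, .cons p hk⟩)
    rwa [← h2.det (.cons p hk), ← h3.det (.cons q hk)]

/-- The first letters of related words with the same tail agree: Knuth moves of the tail bring any
possible letter to its front, and the descent at the beginning tells `p` from `q`. -/
theorem KnuthBisim.not_lt {ℛ : List ℕ → List ℕ → Prop} (h : KnuthBisim ℛ) {p q : ℕ}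
    {t : List ℕ} (hr : ℛ (p :: t) (q :: t)) : ¬ p < q := by
  intro hpq
  obtain ⟨hy, hq⟩ := h.right hr
  have hq' := hq.resolve_left (by omega)
  obtain ⟨t', h1, -⟩ := Yamanouchi.exists_knuthEquiv t.length rfl hy (d := q - 1)
    (by rwa [Nat.sub_add_cancel (by omega)])
  -- In front of `q - 1`, the entry `q` makes a descent and `p` does not.
  have := h.lt_iff (h.transport hr h1) 0 (by simp)
  simp at this
  omega

/-- A relation between Yamanouchi words which preserves descents and is compatible with Knuth
moves is contained in equality. -/
theorem KnuthBisim.eq {ℛ : List ℕ → List ℕ → Prop} (h : KnuthBisim ℛ) {y z : List ℕ}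
    (hr : ℛ y z) : y = z := by
  have hl := h.length_eq hr
  induction y generalizing ℛ z with
  | nil => exact (List.length_eq_zero_iff.1 hl.symm).symm
  | cons p y ih =>
    cases z with
    | nil => simp at hl
    | cons q z =>
      have htail : KnuthBisim fun y z => ∃ p q, ℛ (p :: y) (q :: z) := by
        refine ⟨?_, ?_, ?_, ?_, ?_⟩
        · rintro y z ⟨p, q, hr⟩
          simpa using h.length_eq hr
        · rintro y z ⟨p, q, hr⟩
          exact (h.left hr).1
        · rintro y z ⟨p, q, hr⟩
          exact (h.right hr).1
        · rintro y z ⟨p, q, hr⟩ i hi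
          simpa using h.lt_iff hr (i + 1) (by simpa using hi)
        · rintro y z ⟨p, q, hr⟩ k hk
          obtain ⟨y', z', h1, h2, h3⟩ := h.knuth hr (k + 1) (by
            rcases hk with ⟨y', hk⟩ | ⟨z', hk⟩
            · exact Or.inl ⟨_, .cons p hk⟩
            · exact Or.inr ⟨_, .cons q hk⟩)
          obtain _ | ⟨_, h2⟩ := h2
          obtain _ | ⟨_, h3⟩ := h3
          exact ⟨_, _, ⟨p, q, h1⟩, h2, h3⟩
      obtain rfl := ih htail ⟨p, q, hr⟩ (by simpa using hl)
      have h1 := h.not_lt hr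
      have h2 := h.flip.not_lt hr
      rw [show p = q by omega]

/-! ### The recording tableau and the row numbers -/

theorem addBox_length (t r : ℕ) (Q : List (List ℕ)) (h : r ≤ Q.length) :
    (addBox t r Q).length = max Q.length (r + 1) := by
  induction Q generalizing r with
  | nil => simp at h; subst h; simp [addBox]
  | cons row Q ih =>
    cases r with
    | zero => simp [addBox]
    | succ r => simp [addBox, ih r (by simpa using h)]

theorem tableauInsert_length (n : ℕ) (T : List (List ℕ)) :
    (tableauInsert n T).2 ≤ T.length ∧
      (tableauInsert n T).1.length = max T.length ((tableauInsert n T).2 + 1) := by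
  induction T generalizing n with
  | nil => simp [tableauInsert]
  | cons row T ih =>
    rw [tableauInsert]
    rcases rowInsert n row with ⟨row', _ | y⟩
    · simp
    · have := ih y
      simp
      omega

theorem Q_length_eq (w : List ℕ) : (Q w).length = (P w).length := by
  induction w with
  | nil => rfl
  | cons a w ih =>
    have h := tableauInsert_length a (P w)
    have h1 : Q (a :: w) = addBox (w.length + 1) (tableauInsert a (P w)).2 (Q w) := rfl
    have h2 : P (a :: w) = (tableauInsert a (P w)).1 := rfl
    rw [h1, h2, addBox_length _ _ _ (by omega), h.2, ih]

/-- The box with the entry `t` removed from a tableau. -/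
def removeBox (t : ℕ) (Q : List (List ℕ)) : List (List ℕ) :=
  (Q.map fun row => row.filter (· ≠ t)).filter (· ≠ [])

theorem removeBox_addBox {t r : ℕ} {Q : List (List ℕ)} (hne : ∀ row ∈ Q, row ≠ [])
    (ht : ∀ row ∈ Q, t ∉ row) : removeBox t (addBox t r Q) = Q := by
  have hrow : ∀ row : List ℕ, t ∉ row → row.filter (· ≠ t) = row := fun row h =>
    List.filter_eq_self.2 fun a ha => by simpa using ne_of_mem_of_not_mem ha h
  have hself : ∀ Q : List (List ℕ), (∀ row ∈ Q, row ≠ []) → (∀ row ∈ Q, t ∉ row) →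
      removeBox t Q = Q := by
    intro Q hne ht
    rw [removeBox, List.map_congr_left (g := id) fun row h => hrow row (ht row h), List.map_id]
    exact List.filter_eq_self.2 fun a ha => by simpa using hne a ha
  have hcons : ∀ (row : List ℕ) Q, removeBox t (row :: Q) =
      if row.filter (· ≠ t) = [] then removeBox t Q
      else row.filter (· ≠ t) :: removeBox t Q := by
    intro row Q
    rw [removeBox, List.map_cons, List.filter_cons]
    by_cases h : row.filter (· ≠ t) = []
    · rw [if_pos h, if_neg (by simpa using h)]
      rfl
    · rw [if_neg h, if_pos (by simpa using h)]
      rfl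
  induction Q generalizing r with
  | nil => simp [addBox, removeBox]
  | cons row Q ih =>
    have h1 := hrow row (ht row (by simp))
    have h2 := hne row (by simp)
    have h3 : ∀ row ∈ Q, row ≠ [] := fun r h => hne r (by simp [h])
    have h4 : ∀ row ∈ Q, t ∉ row := fun r h => ht r (by simp [h])
    cases r with
    | zero =>
      rw [addBox, hcons, List.filter_append, h1, hself Q h3 h4]
      simp [h2]
    | succ r => rw [addBox, hcons, h1, if_neg h2, ih h3 h4]

theorem mem_addBox_getD {t r k : ℕ} {Q : List (List ℕ)} (h : r ≤ Q.length)
    (ht : ∀ row ∈ Q, t ∉ row) : t ∈ (addBox t r Q).getD k [] ↔ k = r := by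
  induction Q generalizing r k with
  | nil =>
    simp at h; subst h
    cases k <;> simp [addBox]
  | cons row Q ih =>
    have h1 := ht row (by simp)
    have h2 : ∀ row ∈ Q, t ∉ row := fun r h => ht r (by simp [h])
    have h3 : ∀ k, t ∉ Q.getD k [] := fun k hk => by
      by_cases hlt : k < Q.length
      · rw [List.getD_eq_getElem _ _ hlt] at hk
        exact h2 _ (List.getElem_mem hlt) hk
      · rw [List.getD_eq_default _ _ (by omega)] at hk
        simp at hk
    cases r with
    | zero =>
      cases k with
      | zero => simp [addBox]
      | succ k => simpa [addBox] using h3 k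
    | succ r =>
      cases k with
      | zero => simpa [addBox] using h1
      | succ k => simpa [addBox] using ih (k := k) (by simpa using h) h2

theorem mem_addBox {t r : ℕ} {Q : List (List ℕ)} {row : List ℕ} (h : row ∈ addBox t r Q) :
    row ∈ Q ∨ row = [t] ∨ ∃ row' ∈ Q, row = row' ++ [t] := by
  induction Q generalizing r with
  | nil => simp [addBox] at h; simp [h]
  | cons row₀ Q ih =>
    cases r with
    | zero =>
      rw [addBox, List.mem_cons] at h
      rcases h with rfl | h
      · exact Or.inr (Or.inr ⟨row₀, by simp, rfl⟩)
      · exact Or.inl (by simp [h])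
    | succ r =>
      rw [addBox, List.mem_cons] at h
      rcases h with rfl | h
      · exact Or.inl (by simp)
      · rcases ih h with h | h | ⟨row', h1, h2⟩
        · exact Or.inl (by simp [h])
        · exact Or.inr (Or.inl h)
        · exact Or.inr (Or.inr ⟨row', by simp [h1], h2⟩)

theorem Q_entries (w : List ℕ) :
    (∀ row ∈ Q w, row ≠ []) ∧ ∀ row ∈ Q w, ∀ t ∈ row, t ≤ w.length := by
  induction w with
  | nil => simp [Q, EG]
  | cons a w ih =>
    have h1 : Q (a :: w) = addBox (w.length + 1) (tableauInsert a (P w)).2 (Q w) := rfl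
    rw [h1]
    refine ⟨fun row h => ?_, fun row h t ht => ?_⟩
    · rcases mem_addBox h with h | rfl | ⟨row', h', rfl⟩
      · exact ih.1 row h
      · simp
      · simp
    · rcases mem_addBox h with h | rfl | ⟨row', h', rfl⟩
      · have := ih.2 row h t ht
        simp; omega
      · simp at ht; simp [ht]
      · rcases List.mem_append.1 ht with ht | ht
        · have := ih.2 row' h' t ht
          simp; omega
        · simp at ht; simp [ht]

theorem length_mem_Q (a : ℕ) (w : List ℕ) : ∃ row ∈ Q (a :: w), w.length + 1 ∈ row := by
  have h := tableauInsert_length a (P w)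
  have h2 := Q_length_eq w
  have h1 : Q (a :: w) = addBox (w.length + 1) (tableauInsert a (P w)).2 (Q w) := rfl
  have h3 := (mem_addBox_getD (t := w.length + 1) (r := (tableauInsert a (P w)).2)
    (k := (tableauInsert a (P w)).2) (Q := Q w) (by omega) (fun row hr hm => by
      have := (Q_entries w).2 row hr _ hm; omega)).2 rfl
  have h4 : (tableauInsert a (P w)).2 < (Q (a :: w)).length := by
    rw [h1, addBox_length _ _ _ (by omega)]; omega
  rw [← h1, List.getD_eq_getElem _ _ h4] at h3
  exact ⟨_, List.getElem_mem h4, h3⟩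

/-- The recording tableau carries the same information as the sequence of rows in which the boxes
are added. -/
theorem Q_eq_iff (v w : List ℕ) : Q v = Q w ↔ rowsOf v = rowsOf w := by
  induction v generalizing w with
  | nil =>
    cases w with
    | nil => simp
    | cons a w =>
      obtain ⟨row, h, -⟩ := length_mem_Q a w
      have h1 : Q [] = [] := rfl
      rw [h1]
      simp only [rowsOf, reduceCtorEq, iff_false]
      intro e
      rw [← e] at h
      simp at h
  | cons b v ih =>
    cases w with
    | nil =>
      obtain ⟨row, h, -⟩ := length_mem_Q b v
      have h1 : Q [] = [] := rfl
      rw [h1]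
      simp only [rowsOf, reduceCtorEq, iff_false]
      intro e
      rw [e] at h
      simp at h
    | cons a w =>
      have hv : Q (b :: v) = addBox (v.length + 1) (tableauInsert b (P v)).2 (Q v) := rfl
      have hw : Q (a :: w) = addBox (w.length + 1) (tableauInsert a (P w)).2 (Q w) := rfl
      have hlen : ∀ w, (rowsOf w).length = w.length := fun w => by
        induction w with
        | nil => rfl
        | cons a w ih => simp [rowsOf, ih]
      simp only [rowsOf, List.cons.injEq, ← ih]
      constructor
      · intro h
        have hl : v.length = w.length := by
          obtain ⟨row, h1, h2⟩ := length_mem_Q b v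
          obtain ⟨row', h1', h2'⟩ := length_mem_Q a w
          have e1 := (Q_entries (a :: w)).2 row (h ▸ h1) _ h2
          have e2 := (Q_entries (b :: v)).2 row' (h ▸ h1') _ h2'
          simp at e1 e2
          omega
        have hnv : ∀ row ∈ Q v, v.length + 1 ∉ row := fun row hr hm => by
          have := (Q_entries v).2 row hr _ hm; omega
        have hnw : ∀ row ∈ Q w, v.length + 1 ∉ row := fun row hr hm => by
          have := (Q_entries w).2 row hr _ hm; omega
        have lv := tableauInsert_length b (P v)
        have lw := tableauInsert_length a (P w)
        have qv := Q_length_eq v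
        have qw := Q_length_eq w
        rw [hv, hw, ← hl] at h
        have e := mem_addBox_getD (k := (tableauInsert b (P v)).2) (by omega) hnv
          (r := (tableauInsert b (P v)).2)
        rw [h, mem_addBox_getD (by omega) hnw] at e
        refine ⟨e.2 rfl, ?_⟩
        rw [← removeBox_addBox (Q_entries v).1 hnv (r := (tableauInsert b (P v)).2), h,
          removeBox_addBox (Q_entries w).1 hnw]
      · rintro ⟨h1, h2⟩
        have hl := congrArg List.length ((ih w).1 h2)
        rw [hlen, hlen] at hl
        rw [hv, hw, h1, h2, hl]

/-! ### Words of positive integers as words of integers -/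

/-- The list `u` as a word of integers, with all letters decreased by `c`. -/
def shift (u : List ℕ) (c : ℤ) : ℕ → ℤ := fun i => (u.map fun a : ℕ => (a : ℤ) - c).getD i 0

theorem shift_of_lt {u : List ℕ} {i : ℕ} (h : i < u.length) (c : ℤ) :
    shift u c i = (u[i] : ℤ) - c := by
  simp [shift, h]

theorem shift_of_ge {u : List ℕ} {i : ℕ} (h : u.length ≤ i) (c : ℤ) : shift u c i = 0 := by
  simp [shift, h]

theorem shift_inj {u v : List ℕ} {c : ℤ} (hl : u.length = v.length)
    (h : ∀ i < u.length, shift u c i = shift v c i) : u = v := by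
  refine List.ext_getElem hl fun i h1 h2 => ?_
  have := h i h1
  rw [shift_of_lt h1, shift_of_lt h2] at this
  omega

theorem IsWord.lt_shift {u : List ℕ} (hu : IsWord u) (c : ℤ) : ∀ i < u.length,
    -c < shift u c i := fun i hi => by
  rw [shift_of_lt hi]
  have := hu _ (List.getElem_mem hi)
  omega

theorem exists_shift_eq {m : ℕ} {y : ℕ → ℤ} {c : ℤ} (h0 : ∀ i, m ≤ i → y i = 0)
    (h : ∀ i < m, -c < y i) : ∃ u, IsWord u ∧ u.length = m ∧ shift u c = y := by
  refine ⟨(List.range m).map fun i => (y i + c).toNat, ?_, by simp, ?_⟩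
  · intro a ha
    simp only [List.mem_map, List.mem_range] at ha
    obtain ⟨i, hi, rfl⟩ := ha
    have := h i hi
    omega
  · funext i
    by_cases hi : i < m
    · rw [shift_of_lt (by simpa using hi)]
      have := h i hi
      simp
      omega
    · rw [shift_of_ge (by simpa using hi), h0 i (by omega)]

theorem shift_eraseIdx (u : List ℕ) (i : ℕ) (c : ℤ) :
    shift (u.eraseIdx i) c = del (shift u c) i := by
  funext k
  simp only [shift, del]
  rw [← List.eraseIdx_map, List.getD_eq_getElem?_getD, List.getElem?_eraseIdx]
  split_ifs <;> simp [List.getD_eq_getElem?_getD]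

theorem pre_shift {u : List ℕ} {k : ℕ} (hk : k ≤ u.length) (c : ℤ) (n : ℕ) :
    pre (shift u c) k ((n : ℤ) - c) = (wordPerm (u.take k) n : ℤ) - c := by
  induction k generalizing n with
  | zero => simp [wordPerm_nil]
  | succ k ih =>
    have hlt : k < u.length := hk
    rw [List.take_succ_eq_append_getElem hlt, wordPerm_append, wordPerm_cons, wordPerm_nil, mul_one,
      pre_succ, Perm.mul_apply, Perm.mul_apply, shift_of_lt hlt, ← ih hlt.le]
    congr 1
    simp only [swap_apply_def]
    split_ifs <;> push_cast <;> omega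

theorem pre_shift_length_eq_iff {u v : List ℕ} (hu : IsWord u) (hv : IsWord v) (c : ℤ) :
    pre (shift u c) u.length = pre (shift v c) v.length ↔ wordPerm u = wordPerm v := by
  have key : ∀ u : List ℕ, ∀ n : ℕ,
      pre (shift u c) u.length ((n : ℤ) - c) = (wordPerm u n : ℤ) - c := fun u n => by
    simpa using pre_shift (u := u) le_rfl c n
  have hneg : ∀ u : List ℕ, IsWord u → ∀ x ≤ -c, pre (shift u c) u.length x = x := fun u hu x hx =>
    ((pos_eq_iff _ _ _ _).1 (pos_of_lt_letters (hu.lt_shift c) hx)).symm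
  constructor
  · intro h
    ext n
    have h1 := key u n
    rw [h, key v n] at h1
    omega
  · intro h
    ext x
    rcases le_or_gt x (-c) with hx | hx
    · rw [hneg u hu x hx, hneg v hv x hx]
    · obtain ⟨n, hn⟩ := Int.eq_ofNat_of_zero_le (show 0 ≤ x + c by omega)
      rw [show x = (n : ℤ) - c by omega, key, key, h]

theorem tr_shift {u : List ℕ} {i : ℕ} (hi : i < u.length) (c : ℤ) :
    tr (shift u c) i = swap ((wordPerm (u.take i) u[i] : ℤ) - c)
      ((wordPerm (u.take i) (u[i] + 1) : ℤ) - c) := by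
  rw [tr, shift_of_lt hi, ← pre_shift hi.le, ← pre_shift hi.le]
  congr 2
  push_cast
  omega

theorem swappedValues_eq_iff {u : List ℕ} {i j : ℕ} (hi : i < u.length) (hj : j < u.length)
    (c : ℤ) :
    swappedValues u i = swappedValues u j ↔ tr (shift u c) i = tr (shift u c) j := by
  have hne : wordPerm (u.take i) (u[i] + 1) ≠ wordPerm (u.take i) u[i] :=
    (wordPerm (u.take i)).injective.ne (Nat.succ_ne_self u[i])
  rw [tr_shift hi, tr_shift hj, swap_eq_swap_iff (by omega), swappedValues, swappedValues,
    Sym2.eq_iff]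
  simp only [List.getD_eq_getElem _ _ hi, List.getD_eq_getElem _ _ hj]
  omega

theorem IsWord.eraseIdx {u : List ℕ} (hu : IsWord u) (i : ℕ) : IsWord (u.eraseIdx i) :=
  fun a ha => hu a (List.mem_of_mem_eraseIdx ha)

/-- A word has minimal length exactly if no pair of values is exchanged twice. -/
theorem isReducedWord_iff {u : List ℕ} (hu : IsWord u) (c : ℤ) :
    IsReducedWord u ↔ Red u.length (shift u c) := by
  constructor
  · intro h
    have key : ∀ i j, i < j → j < u.length → tr (shift u c) i ≠ tr (shift u c) j := by
      intro i j hij hj he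
      -- The two letters could be removed without changing the permutation.
      have h1 := hu.eraseIdx j
      have l1 := List.length_eraseIdx_of_lt hj
      have l2 := List.length_eraseIdx_of_lt (l := u.eraseIdx j) (i := i) (by omega)
      have := h.2 _ (h1.eraseIdx i) ((pre_shift_length_eq_iff (h1.eraseIdx i) hu c).1 (by
        rw [shift_eraseIdx, l2,
          NearRed.pre_del (by omega), shift_eraseIdx, l1, NearRed.pre_del hj,
          tr_del_lt hij, he, tr_mul_self_assoc]))
      omega
    intro i hi j hj he
    rcases lt_trichotomy i j with hij | rfl | hij
    · exact (key i j hij hj he).elim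
    · rfl
    · exact (key j i hij hi he.symm).elim
  · intro h
    exact ⟨hu, fun v hv he => h.length_le ((pre_shift_length_eq_iff hu hv c).2 he.symm)⟩

theorem isReducedWord_eraseIdx_iff {u : List ℕ} (hu : IsWord u) {i : ℕ} (hi : i < u.length)
    (c : ℤ) : IsReducedWord (u.eraseIdx i) ↔ NearRed u.length (shift u c) i := by
  rw [isReducedWord_iff (hu.eraseIdx i) c, shift_eraseIdx,
    List.length_eraseIdx_of_lt hi, NearRed, and_iff_right hi]

theorem length_decrementAt (u : List ℕ) (i : ℕ) : (decrementAt u i).length = u.length := by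
  unfold decrementAt
  split_ifs <;> simp

theorem isWord_decrementAt {u : List ℕ} (hu : IsWord u) (i : ℕ) : IsWord (decrementAt u i) := by
  intro a ha
  unfold decrementAt at ha
  split_ifs at ha with h
  · obtain ⟨k, hk, rfl⟩ := List.mem_mapIdx.1 ha
    have := hu _ (List.getElem_mem hk)
    split_ifs <;> omega
  · obtain ⟨k, hk, rfl⟩ := List.mem_mapIdx.1 ha
    have := hu _ (List.getElem_mem hk)
    split_ifs with hki
    · subst hki
      have h1 : u[k] ≠ 1 := fun e => h (by rw [List.getElem?_eq_getElem hk, e])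
      omega
    · omega

theorem shift_decrementAt_of_eq_one {u : List ℕ} {i : ℕ} (hi : i < u.length) (h : u[i] = 1)
    (c : ℤ) : shift (decrementAt u i) (c + 1) = dec (shift u c) i := by
  have hl := length_decrementAt u i
  funext k
  by_cases hk : k < u.length
  · rw [shift_of_lt (by omega)]
    have h' : u[i]? = some 1 := by rw [List.getElem?_eq_getElem hi, h]
    simp only [decrementAt, if_pos h', List.getElem_mapIdx, dec]
    by_cases hki : k = i
    · subst hki
      simp [shift_of_lt hk]
      omega
    · simp [hki, shift_of_lt hk]
  · rw [shift_of_ge (by omega), dec, Function.update_of_ne (by omega), shift_of_ge (by omega)]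

theorem shift_decrementAt_of_ne_one {u : List ℕ} (hu : IsWord u) {i : ℕ} (hi : i < u.length)
    (h : u[i] ≠ 1) (c : ℤ) : shift (decrementAt u i) c = dec (shift u c) i := by
  have hl := length_decrementAt u i
  funext k
  by_cases hk : k < u.length
  · rw [shift_of_lt (by omega)]
    have h' : u[i]? ≠ some 1 := by rw [List.getElem?_eq_getElem hi]; simpa using h
    simp only [decrementAt, if_neg h', List.getElem_mapIdx, dec]
    by_cases hki : k = i
    · subst hki
      have := hu _ (List.getElem_mem hk)
      simp [shift_of_lt hk]
      omega
    · simp [hki, shift_of_lt hk]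
  · rw [shift_of_ge (by omega), dec, Function.update_of_ne (by omega), shift_of_ge (by omega)]

theorem BumpFrom.bump {u v : List ℕ} {i : ℕ} (h : BumpFrom u i v) (hu : IsWord u)
    (hi : i < u.length) (c : ℤ) :
    IsWord v ∧ v.length = u.length ∧ ∃ c', Bump u.length (shift u c) i (shift v c') := by
  have hdec : ∀ (u : List ℕ) (i : ℕ), IsWord u → i < u.length → ∀ c : ℤ, ∃ c',
      shift (decrementAt u i) c' = dec (shift u c) i := fun u i hu hi c => by
    by_cases h : u[i] = 1
    · exact ⟨c + 1, shift_decrementAt_of_eq_one hi h c⟩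
    · exact ⟨c, shift_decrementAt_of_ne_one hu hi h c⟩
  induction h generalizing c with
  | last u i h =>
    obtain ⟨c', hc⟩ := hdec u i hu hi c
    refine ⟨h.1, length_decrementAt u i, c', ?_⟩
    rw [hc]
    apply Bump.last
    rwa [← hc, ← length_decrementAt u i, ← isReducedWord_iff h.1]
  | next u i j v h hj hij hswap hv ih =>
    obtain ⟨c₁, hc⟩ := hdec u i hu hi c
    have hl := length_decrementAt u i
    have hw := isWord_decrementAt hu i
    obtain ⟨h1, h2, c', h3⟩ := ih hw (by omega) c₁
    rw [hl] at h2 h3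
    rw [hc] at h3
    refine ⟨h1, h2, c', .next _ i j _ ?_ hj hij ?_ h3⟩
    · rwa [← hc, ← hl, ← isReducedWord_iff hw]
    · rwa [← hc, ← swappedValues_eq_iff (by omega) (by omega)]

/-- A bump of integer words comes from a Little bump of words of positive integers; there is no
renormalisation if the result is positive anyway. -/
theorem Bump.bumpFrom {m : ℕ} {w y : ℕ → ℤ} {i : ℕ} (h : Bump m w i y) {u : List ℕ} {c : ℤ}
    (hw : w = shift u c) (hm : m = u.length) (hu : IsWord u) (hi : i < m) :
    ∃ v c', BumpFrom u i v ∧ shift v c' = y ∧ ((∀ k < m, -c < y k) → c' = c) := by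
  have hdec : ∀ (u : List ℕ) (i : ℕ), IsWord u → i < u.length → ∀ c : ℤ, ∃ c',
      shift (decrementAt u i) c' = dec (shift u c) i ∧
        (-c < dec (shift u c) i i → c' = c) := fun u i hu hi c => by
    by_cases h : u[i] = 1
    · refine ⟨c + 1, shift_decrementAt_of_eq_one hi h c, fun hlt => ?_⟩
      simp [dec, shift_of_lt hi, h] at hlt
    · exact ⟨c, shift_decrementAt_of_ne_one hu hi h c, fun _ => rfl⟩
  induction h generalizing u c with
  | last w i h =>
    subst hw hm
    obtain ⟨c', hc, hc'⟩ := hdec u i hu hi c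
    refine ⟨decrementAt u i, c', .last u i ?_, hc, fun hp => hc' (hp i hi)⟩
    rwa [isReducedWord_iff (isWord_decrementAt hu i) c', hc, length_decrementAt]
  | next w i j y h hj hij ht hv ih =>
    subst hw hm
    obtain ⟨c₁, hc, hc'⟩ := hdec u i hu hi c
    have hl := length_decrementAt u i
    have hw := isWord_decrementAt hu i
    obtain ⟨v, c', h1, h2, h3⟩ := ih hc.symm hl.symm hw hj
    refine ⟨v, c', .next u i j v ?_ hj hij ?_ h1, h2, fun hp => ?_⟩
    · rwa [isReducedWord_iff hw c₁, hc, hl]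
    · rwa [swappedValues_eq_iff (by omega) (by omega) c₁, hc]
    · have e := hc' ((hp i hi).trans_le (hv.le.1 i))
      subst e
      exact h3 hp

/-! ### Little bumps preserve the recording tableau -/

/-- A Coxeter–Knuth move of letters, read from right to left. -/
theorem CKTriple.insTriple {x y z x' y' z' : ℕ} {c : ℤ}
    (h : CKTriple ((x : ℤ) - c) ((y : ℤ) - c) ((z : ℤ) - c) ((x' : ℤ) - c) ((y' : ℤ) - c)
      ((z' : ℤ) - c)) : InsTriple z y x z' y' x' ∨ InsTriple z' y' x' z y x := by
  generalize hx : (x : ℤ) - c = X at h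
  generalize hy : (y : ℤ) - c = Y at h
  generalize hz : (z : ℤ) - c = Z at h
  generalize hx' : (x' : ℤ) - c = X' at h
  generalize hy' : (y' : ℤ) - c = Y' at h
  generalize hz' : (z' : ℤ) - c = Z' at h
  cases h with
  | acb h1 h2 =>
    obtain ⟨rfl, rfl, rfl⟩ : x' = y ∧ y' = x ∧ z' = z := by omega
    exact Or.inr (.bac (by omega) (by omega))
  | cab h1 h2 =>
    obtain ⟨rfl, rfl, rfl⟩ : x' = y ∧ y' = x ∧ z' = z := by omega
    exact Or.inl (.bac (by omega) (by omega))
  | bac h1 h2 =>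
    obtain ⟨rfl, rfl, rfl⟩ : x' = x ∧ y' = z ∧ z' = y := by omega
    exact Or.inr (.acb (by omega) (by omega))
  | bca h1 h2 =>
    obtain ⟨rfl, rfl, rfl⟩ : x' = x ∧ y' = z ∧ z' = y := by omega
    exact Or.inl (.acb (by omega) (by omega))
  | up =>
    obtain ⟨rfl, rfl, rfl, rfl, rfl⟩ : y = x + 1 ∧ z = x ∧ x' = x + 1 ∧ y' = x ∧ z' = x + 1 := by
      omega
    exact Or.inl (.braid _)
  | down =>
    obtain ⟨rfl, rfl, rfl, rfl, rfl⟩ : x = y + 1 ∧ z = y + 1 ∧ x' = y ∧ y' = y + 1 ∧ z' = y := by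
      omega
    exact Or.inr (.braid _)

theorem eq_take_append_drop {u : List ℕ} {k : ℕ} (hk : k + 2 < u.length) :
    u = u.take k ++ u[k] :: u[k + 1] :: u[k + 2] :: u.drop (k + 3) := by
  rw [← List.drop_eq_getElem_cons, ← List.drop_eq_getElem_cons, ← List.drop_eq_getElem_cons,
    List.take_append_drop]

/-- A Coxeter–Knuth move of words as a replacement of three consecutive letters. -/
theorem CK.exists_append {k : ℕ} {u u' : List ℕ} {c : ℤ} (hl : u'.length = u.length)
    (hk : k + 2 < u.length) (h : CK k (shift u c) (shift u' c)) :
    ∃ (A : List ℕ) (x y z x' y' z' : ℕ) (B : List ℕ), A.length = k ∧ u = A ++ x :: y :: z :: B ∧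
      u' = A ++ x' :: y' :: z' :: B ∧
      CKTriple ((x : ℤ) - c) ((y : ℤ) - c) ((z : ℤ) - c) ((x' : ℤ) - c) ((y' : ℤ) - c)
        ((z' : ℤ) - c) := by
  have hget : ∀ i (hi : i < u.length), i ≠ k → i ≠ k + 1 → i ≠ k + 2 →
      u'[i]'(by omega) = u[i] := fun i hi h1 h2 h3 => by
    have := h.1 i h1 h2 h3
    rw [shift_of_lt hi, shift_of_lt (by omega)] at this
    omega
  refine ⟨u.take k, u[k], u[k + 1], u[k + 2], u'[k], u'[k + 1], u'[k + 2], u.drop (k + 3),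
    by simp; omega, eq_take_append_drop hk, ?_, ?_⟩
  · have h1 : u.take k = u'.take k := List.ext_getElem (by simp; omega) fun i h1 h2 => by
      simp only [List.length_take] at h1
      simp [hget i (by omega) (by omega) (by omega) (by omega)]
    have h2 : u.drop (k + 3) = u'.drop (k + 3) := List.ext_getElem (by simp; omega)
      fun i h1 h2 => by
        simp only [List.length_drop] at h1
        simp [hget (k + 3 + i) (by omega) (by omega) (by omega) (by omega)]
    rw [h1, h2]
    exact eq_take_append_drop (by omega)
  · have := h.2
    rwa [shift_of_lt (by omega), shift_of_lt (by omega), shift_of_lt (by omega),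
      shift_of_lt (by omega), shift_of_lt (by omega), shift_of_lt (by omega)] at this

theorem CK.knuthAt {k : ℕ} {u u' : List ℕ} {c : ℤ} (h : CK k (shift u c) (shift u' c))
    (hl : u'.length = u.length) (hk : k + 2 < u.length) (hu : IsReducedWord u)
    (hu' : IsReducedWord u') : KnuthAt k (rowsOf u) (rowsOf u') := by
  obtain ⟨A, x, y, z, x', y', z', B, rfl, rfl, rfl, ht⟩ := h.exists_append hl hk
  rcases ht.insTriple with ht | ht
  · exact (EGRel.knuthAt ht hu.egRel hu'.egRel).2
  · exact (EGRel.knuthAt ht hu'.egRel hu.egRel).2.symm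

theorem CKTriple.lt {x y z x' y' z' L : ℤ} (h : CKTriple x y z x' y' z') (hx : L < x)
    (hy : L < y) (hz : L < z) : L < x' ∧ L < y' ∧ L < z' := by
  cases h <;> omega

/-- Coxeter–Knuth moves stay within the reduced words of positive integers. -/
theorem CK.exists_isReducedWord {k : ℕ} {u : List ℕ} {c : ℤ} {w' : ℕ → ℤ}
    (h : CK k (shift u c) w') (hk : k + 2 < u.length) (hu : IsReducedWord u) :
    ∃ u', IsReducedWord u' ∧ u'.length = u.length ∧ shift u' c = w' := by
  have hlt := hu.1.lt_shift c
  obtain ⟨h0, h1, h2⟩ := h.2.lt (hlt k (by omega)) (hlt (k + 1) (by omega)) (hlt (k + 2) hk)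
  obtain ⟨u', hw, hl, rfl⟩ := exists_shift_eq (m := u.length) (y := w') (c := c)
    (fun i hi => by rw [← h.1 i (by omega) (by omega) (by omega), shift_of_ge hi])
    (fun i hi => by
      by_cases e0 : i = k
      · rwa [e0]
      by_cases e1 : i = k + 1
      · rwa [e1]
      by_cases e2 : i = k + 2
      · rwa [e2]
      · rw [← h.1 i e0 e1 e2]
        exact hlt i hi)
  refine ⟨u', (isReducedWord_iff hw c).2 ?_, hl, rfl⟩
  rw [hl]
  exact h.red hk ((isReducedWord_iff hu.1 c).1 hu)

theorem Red.not_far {m k : ℕ} {w : ℕ → ℤ} (hw : Red m w) (hk : k + 2 < m)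
    (h : w k = w (k + 2)) : ¬ (w k + 1 < w (k + 1) ∨ w (k + 1) + 1 < w k) := fun hf => by
  have := hw k (by omega) (k + 2) hk (tr_add_two_eq_of_eq h hf).symm
  omega

theorem exists_ckTriple {x y z : ℤ} (h1 : x ≠ y) (h : x < y ↔ z < y)
    (hf : x = z → ¬ (x + 1 < y ∨ y + 1 < x)) (h2 : y ≠ z) :
    ∃ x' y' z', CKTriple x y z x' y' z' := by
  rcases lt_trichotomy x z with hxz | rfl | hxz
  · rcases lt_or_gt_of_ne h1 with hlt | hlt
    · exact ⟨_, _, _, .acb hxz (h.1 hlt)⟩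
    · exact ⟨_, _, _, .bac hlt hxz⟩
  · have := hf rfl
    rcases lt_or_gt_of_ne h1 with hlt | hlt
    · obtain rfl : y = x + 1 := by omega
      exact ⟨_, _, _, .up x⟩
    · obtain rfl : x = y + 1 := by omega
      exact ⟨_, _, _, .down y⟩
  · rcases lt_or_gt_of_ne h1 with hlt | hlt
    · exact ⟨_, _, _, .bca hxz hlt⟩
    · exact ⟨_, _, _, .cab (by omega) hxz⟩

/-- A Coxeter–Knuth move applies at every peak and every valley of a reduced word. -/
theorem Red.exists_ck {m k : ℕ} {w : ℕ → ℤ} (hw : Red m w) (hk : k + 2 < m)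
    (h : w k < w (k + 1) ↔ ¬ w (k + 1) < w (k + 2)) : ∃ w', CK k w w' := by
  have h1 := hw.ne_succ (k := k) (by omega)
  have h2 : w (k + 1) ≠ w (k + 2) := hw.ne_succ (k := k + 1) hk
  obtain ⟨x', y', z', ht⟩ := exists_ckTriple h1 (by omega) (hw.not_far hk) h2
  refine ⟨fun j => if j = k then x' else if j = k + 1 then y' else if j = k + 2 then z' else w j,
    fun j e0 e1 e2 => by simp [e0, e1, e2], by simpa using ht⟩

/-- A Knuth move applies only where exactly one of two consecutive pairs is a descent. -/
theorem KnuthAt.peak_or_valley {k : ℕ} {y y' : List ℕ} (h : KnuthAt k y y') :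
    k + 2 < y.length ∧
      (y.getD (k + 1) 0 < y.getD k 0 ↔ ¬ y.getD (k + 2) 0 < y.getD (k + 1) 0) := by
  induction h with
  | head l h =>
    unfold Knuth at h
    simp
    omega
  | cons a h ih => exact ⟨Nat.succ_lt_succ ih.1, ih.2⟩

theorem IsReducedWord.length_rowsOf {u : List ℕ} (hu : IsReducedWord u) :
    (rowsOf u).length = u.length := hu.egRel.length_eq

theorem IsReducedWord.lt_iff {u : List ℕ} (hu : IsReducedWord u) (c : ℤ) {i : ℕ}
    (hi : i + 1 < u.length) : shift u c i < shift u c (i + 1) ↔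
      (rowsOf u).getD (i + 1) 0 < (rowsOf u).getD i 0 := by
  have hne := ((isReducedWord_iff hu.1 c).1 hu).ne_succ hi
  rw [shift_of_lt hi, shift_of_lt (by omega)] at hne ⊢
  rw [← hu.egRel.lt_iff hi, List.getD_eq_getElem _ _ hi, List.getD_eq_getElem _ _ (by omega)]
  · omega
  · rw [List.getD_eq_getElem _ _ hi, List.getD_eq_getElem _ _ (by omega)]
    omega

theorem IsReducedWord.exists_ck {u : List ℕ} (hu : IsReducedWord u) (c : ℤ) {k : ℕ}
    (hk : k + 2 < u.length) (h : (rowsOf u).getD (k + 1) 0 < (rowsOf u).getD k 0 ↔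
      ¬ (rowsOf u).getD (k + 2) 0 < (rowsOf u).getD (k + 1) 0) :
    ∃ u', IsReducedWord u' ∧ u'.length = u.length ∧ CK k (shift u c) (shift u' c) := by
  rw [← hu.lt_iff c (by omega), ← hu.lt_iff c hk] at h
  obtain ⟨w', hw⟩ := ((isReducedWord_iff hu.1 c).1 hu).exists_ck hk h
  obtain ⟨u', h1, h2, rfl⟩ := hw.exists_isReducedWord hk hu
  exact ⟨u', h1, h2, hw⟩

/-- The recording words of two reduced words one of which is a bump of the other. -/
def BumpRows (y z : List ℕ) : Prop :=
  ∃ u v : List ℕ, ∃ (c c' : ℤ) (i : ℕ), IsReducedWord u ∧ IsReducedWord v ∧ v.length = u.length ∧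
    NearRed u.length (shift u c) i ∧ Bump u.length (shift u c) i (shift v c') ∧
    y = rowsOf u ∧ z = rowsOf v

/-- Little bumps preserve descents and commute with Coxeter–Knuth moves, which act on the recorded
rows by Knuth moves. -/
theorem knuthBisim_bumpRows : KnuthBisim BumpRows := by
  have hlt : ∀ {y z}, BumpRows y z → ∀ i, i + 1 < y.length →
      (y.getD (i + 1) 0 < y.getD i 0 ↔ z.getD (i + 1) 0 < z.getD i 0) := by
    rintro _ _ ⟨u, v, c, c', i, hu, hv, hl, hn, hb, rfl, rfl⟩ k hk
    rw [hu.length_rowsOf] at hk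
    rw [← hu.lt_iff c hk, ← hv.lt_iff c' (by omega)]
    exact hb.lt_iff ((isReducedWord_iff hu.1 c).1 hu) hn hk
  have hlen : ∀ {y z}, BumpRows y z → y.length = z.length := by
    rintro _ _ ⟨u, v, c, c', i, hu, hv, hl, -, -, rfl, rfl⟩
    rw [hu.length_rowsOf, hv.length_rowsOf, hl]
  refine ⟨hlen, ?_, ?_, hlt, ?_⟩
  · rintro _ _ ⟨u, v, c, c', i, hu, hv, hl, -, -, rfl, rfl⟩
    exact hu.egRel.yamanouchi.1
  · rintro _ _ ⟨u, v, c, c', i, hu, hv, hl, -, -, rfl, rfl⟩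
    exact hv.egRel.yamanouchi.1
  · intro y z hr k hk
    have hp : k + 2 < y.length ∧
        (y.getD (k + 1) 0 < y.getD k 0 ↔ ¬ y.getD (k + 2) 0 < y.getD (k + 1) 0) := by
      rcases hk with ⟨y', h⟩ | ⟨z', h⟩
      · exact h.peak_or_valley
      · have := h.peak_or_valley
        rw [← hlen hr] at this
        rwa [hlt hr k (by omega), hlt hr (k + 1) (by omega)]
    obtain ⟨u, v, c, c', i, hu, hv, hl, hn, hb, rfl, rfl⟩ := hr
    rw [hu.length_rowsOf] at hp
    obtain ⟨u', hu', hl', hck⟩ := hu.exists_ck c hp.1 hp.2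
    obtain ⟨i', w', hn', hb', hck'⟩ := hb.exists_bump_of_ck hp.1 hn hck
    obtain ⟨v', hv', hlv', rfl⟩ := hck'.exists_isReducedWord (by omega) hv
    refine ⟨_, _, ⟨u', v', c, c', i', hu', hv', by omega, by rwa [hl'], by rwa [hl'], rfl, rfl⟩,
      hck.knuthAt hl' hp.1 hu hu', hck'.knuthAt hlv' (by omega) hv hv'⟩

theorem rowsOf_eq_of_bump {u v : List ℕ} {c c' : ℤ} {i : ℕ} (hu : IsReducedWord u)
    (hv : IsReducedWord v) (hl : v.length = u.length) (hn : NearRed u.length (shift u c) i)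
    (hb : Bump u.length (shift u c) i (shift v c')) : rowsOf u = rowsOf v :=
  knuthBisim_bumpRows.eq ⟨u, v, c, c', i, hu, hv, hl, hn, hb, rfl, rfl⟩

theorem LittleBump.rowsOf_eq {u v : List ℕ} (h : LittleBump u v) : rowsOf u = rowsOf v := by
  obtain ⟨hu, i, hi, he, hb⟩ := h
  obtain ⟨hv, hl, c', hb⟩ := hb.bump hu.1 hi 0
  refine rowsOf_eq_of_bump hu ((isReducedWord_iff hv c').2 ?_) hl
    ((isReducedWord_eraseIdx_iff hu.1 hi 0).1 he) hb
  rw [hl]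
  exact hb.red

theorem Communicate.rowsOf_eq {u v : List ℕ} (h : Communicate u v) : rowsOf u = rowsOf v := by
  induction h with
  | rel _ _ h => exact h.rowsOf_eq
  | refl _ => rfl
  | symm _ _ _ ih => exact ih.symm
  | trans _ _ _ _ _ ih1 ih2 => exact ih1.trans ih2

/-! ### Bumping to a Grassmannian permutation -/

/-- A complete bump of a reduced word of length `m`, at a position at which it may begin. -/
def BumpMove (m : ℕ) (w v : ℕ → ℤ) : Prop := Red m w ∧ ∃ i, NearRed m w i ∧ Bump m w i v

/-- The permutation `p` has no descent except possibly at `d`. -/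
def Grassmannian (d : ℤ) (p : Perm ℤ) : Prop :=
  StrictMonoOn p (Set.Iic d) ∧ StrictMonoOn p (Set.Ioi d)

/-- Suppose that the values at the positions after `r` increase, and that `s` is the last position
after `r` with a smaller value than the one at `r`. The Little bump at the letter exchanging the
values at `r` and `s` removes this inversion; the new inversion which it creates exchanges the
smaller of the two values with one at a position to the left of `r`. -/
theorem Red.exists_bumpMove {m : ℕ} {w : ℕ → ℤ} {d r s : ℤ} (hw : Red m w) (hdr : d < r)
    (hrs : r < s) (hd : StrictMonoOn (pre w m) (Set.Iic d))
    (hr : StrictMonoOn (pre w m) (Set.Ioi r)) (hs : ∀ p, s < p → pre w m r < pre w m p)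
    (hlt : pre w m s < pre w m r) :
    ∃ v, BumpMove m w v ∧ StrictMonoOn (pre v m) (Set.Iic d) ∧
      StrictMonoOn (pre v m) (Set.Ioi r) ∧ ∀ p, s - 1 < p → pre v m r < pre v m p := by
  set V := pre w m s with hV
  set U := pre w m r with hU
  have hpV : pos w m V = s := pos_pre _ _ _
  have hpU : pos w m U = r := pos_pre _ _ _
  obtain ⟨i, hi, hti⟩ := exists_tr_eq (w := w) (m := m) hlt (by omega)
  have hn : NearRed m w i := hw.nearRed_of_cover hi hlt hti fun z h1 h2 h3 h4 => by
    have := hr (a := pos w m z) (b := s) (by simp; omega) (by simpa using hrs) (by omega)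
    rw [pre_pos] at this
    omega
  obtain ⟨v, hv⟩ := hn.exists_bump
  obtain ⟨C, hCV, hpos, hlt', hcov⟩ := hv.exists_pre_eq hn
  have hmark : pre w i (w i) = V := by
    have h1 := hw.pos_lt_before hi hti hlt le_rfl
    have h2 := tr_eq_swap_iff.1 hti
    rw [eq_comm, ← pos_eq_iff]
    omega
  rw [hmark] at hCV hpos hlt' hcov
  have hdel : ∀ x, pos (del w i) (m - 1) x = pos w m (swap V U x) := fun x => by
    rw [pos, NearRed.pre_del hi, hti]
    simp [pos]
  simp only [hdel, swap_apply_left] at hpos hlt' hcov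
  rw [swap_apply_of_ne_of_ne (by omega) (by omega), hpU] at hlt'
  simp only [swap_apply_of_ne_of_ne (show C ≠ V by omega) (show C ≠ U by omega)] at hcov
  rw [hpU] at hcov
  set q := pos w m C with hq
  have hpq : pre w m q = C := pre_pos _ _ _
  -- The new permutation.
  have hvr : pre v m r = C := by
    rw [eq_comm, ← pos_eq_iff, hpos, swap_apply_left, swap_apply_left, hpU]
  have hvs : pre v m s = U := by
    rw [eq_comm, ← pos_eq_iff, hpos, swap_apply_of_ne_of_ne (show U ≠ C by omega) (by omega),
      swap_apply_right, hpV]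
  have hvq : pre v m q = V := by
    rw [eq_comm, ← pos_eq_iff, hpos, swap_apply_right, swap_apply_of_ne_of_ne (by omega) (by omega)]
  have hv' : ∀ p, p ≠ q → p ≠ r → p ≠ s → pre v m p = pre w m p := fun p h1 h2 h3 => by
    rw [eq_comm, ← pos_eq_iff, hpos, swap_apply_of_ne_of_ne (a := C), swap_apply_of_ne_of_ne,
      pos_pre]
    · exact fun e => h3 ((pre w m).injective e)
    · exact fun e => h2 ((pre w m).injective e)
    · rw [← hpq]
      exact fun e => h1 ((pre w m).injective e)
    · exact fun e => h3 ((pre w m).injective e)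
  refine ⟨v, ⟨hw, i, hn, hv⟩, ?_, ?_, ?_⟩
  · intro a ha b hb hab
    simp only [Set.mem_Iic] at ha hb
    have hmono := hd ha hb hab
    rcases eq_or_ne a q with rfl | haq
    · rw [hvq, hv' b (by omega) (by omega) (by omega)]
      by_contra hle
      have h1 : pre w m b ≠ V := fun e => by have := (pre w m).injective e; omega
      refine hcov (pre w m b) (by omega) (by omega) ?_ ?_
      · rw [swap_apply_of_ne_of_ne (by omega) (by omega), pos_pre]
        omega
      · rw [swap_apply_of_ne_of_ne (by omega) (by omega), pos_pre]
        omega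
    rw [hv' a haq (by omega) (by omega)]
    rcases eq_or_ne b q with rfl | hbq
    · rw [hvq]
      omega
    · rwa [hv' b hbq (by omega) (by omega)]
  · intro a ha b hb hab
    simp only [Set.mem_Ioi] at ha hb
    have hmono := hr ha hb hab
    rcases eq_or_ne a s with rfl | has
    · rw [hvs, hv' b (by omega) (by omega) (by omega)]
      exact hs b hab
    rw [hv' a (by omega) (by omega) has]
    rcases eq_or_ne b s with rfl | hbs
    · rw [hvs]
      omega
    · rwa [hv' b (by omega) (by omega) hbs]
  · intro p hp
    rw [hvr]
    rcases eq_or_ne p s with rfl | hps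
    · rw [hvs]
      omega
    · rw [hv' p (by omega) (by omega) hps]
      have := hs p (by omega)
      omega

theorem exists_forall_pre_lt (w : ℕ → ℤ) (m : ℕ) (r : ℤ) :
    ∃ s, r ≤ s ∧ ∀ p, s < p → pre w m r < pre w m p := by
  obtain ⟨N, -, hN⟩ := exists_forall_pos_eq w m
  refine ⟨max r (max N (pre w m r)), by omega, fun p hp => ?_⟩
  have := (pos_eq_iff _ _ _ _).1 (hN p (by omega))
  omega

/-- The Lascoux–Schützenberger tree: a reduced word whose permutation increases up to `d` is
brought by Little bumps to a word of a Grassmannian permutation with descent `d`. -/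
theorem Red.exists_grassmannian {m : ℕ} {w : ℕ → ℤ} {d : ℤ} (hw : Red m w)
    (hd : StrictMonoOn (pre w m) (Set.Iic d)) :
    ∃ v, Relation.ReflTransGen (BumpMove m) w v ∧ Grassmannian d (pre v m) := by
  -- Induction on the last descent `r`, and then on the last position `s` after `r` whose value may
  -- be smaller than the one at `r`.
  have key : ∀ n : ℕ, ∀ (r : ℤ) (w : ℕ → ℤ), r - d = n → Red m w →
      StrictMonoOn (pre w m) (Set.Iic d) → StrictMonoOn (pre w m) (Set.Ioi r) →
      ∃ v, Relation.ReflTransGen (BumpMove m) w v ∧ Grassmannian d (pre v m) := by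
    intro n
    induction n with
    | zero =>
      intro r w hn hw hd hr
      obtain rfl : r = d := by simpa [sub_eq_zero] using hn
      exact ⟨w, .refl, hd, hr⟩
    | succ n ih =>
      intro r w hn hw hd hr
      have inner : ∀ l : ℕ, ∀ (s : ℤ) (w : ℕ → ℤ), s - r = l → Red m w →
          StrictMonoOn (pre w m) (Set.Iic d) → StrictMonoOn (pre w m) (Set.Ioi r) →
          (∀ p, s < p → pre w m r < pre w m p) →
          ∃ v, Relation.ReflTransGen (BumpMove m) w v ∧ Grassmannian d (pre v m) := by
        intro l
        induction l with
        | zero =>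
          intro s w hl hw hd hr hs
          refine ih (r - 1) w (by push_cast at hn; omega) hw hd fun a ha b hb hab => ?_
          simp only [Set.mem_Ioi] at ha hb
          rcases eq_or_ne a r with rfl | har
          · exact hs b (by push_cast at hl; omega)
          · exact hr (by simp; omega) (by simp; omega) hab
        | succ l ihl =>
          intro s w hl hw hd hr hs
          push_cast at hl hn
          rcases lt_or_ge (pre w m s) (pre w m r) with hlt | hge
          · obtain ⟨v, h1, h2, h3, h4⟩ := hw.exists_bumpMove (by omega) (by omega) hd hr hs hlt
            obtain ⟨v', h5, h6⟩ :=
              ihl (s - 1) v (by omega) h1.2.choose_spec.2.red h2 h3 h4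
            exact ⟨v', h5.head h1, h6⟩
          · refine ihl (s - 1) w (by omega) hw hd hr fun p hp => ?_
            rcases eq_or_ne p s with rfl | hps
            · exact lt_of_le_of_ne hge ((pre w m).injective.ne (by omega))
            · exact hs p (by omega)
      obtain ⟨s, hrs, hs⟩ := exists_forall_pre_lt w m r
      exact inner (s - r).toNat s w (by omega) hw hd hr hs
  obtain ⟨N, -, hN⟩ := exists_forall_pos_eq w m
  refine key (max N d - d).toNat (max N d) w (by omega) hw hd fun a ha b hb hab => ?_
  simp only [Set.mem_Ioi] at ha hb
  rwa [← (pos_eq_iff _ _ _ _).1 (hN a (by omega)), ← (pos_eq_iff _ _ _ _).1 (hN b (by omega))]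

/-! ### Words of Grassmannian permutations -/

theorem StrictMonoOn.swap_mul {p : Perm ℤ} {S : Set ℤ} {a : ℤ} (h : StrictMonoOn p S)
    (ha : p⁻¹ a ∉ S ∨ p⁻¹ (a + 1) ∉ S) :
    StrictMonoOn (swap a (a + 1) * p : Perm ℤ) S := by
  intro x hx y hy hxy
  have h1 := h hx hy hxy
  have hx' : p⁻¹ (p x) ∈ S := by simpa using hx
  have hy' : p⁻¹ (p y) ∈ S := by simpa using hy
  have hne : ¬ (p x = a ∧ p y = a + 1) := by
    rintro ⟨e1, e2⟩
    rw [e1] at hx'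
    rw [e2] at hy'
    tauto
  simp only [Perm.mul_apply, swap_apply_def]
  split_ifs <;> omega

/-- `GrRel c d w p y`: the word `w`, with its letters decreased by `c`, is built from right to left
in such a way that each letter moves a value up which occupies a position `d - r ≤ d`, in exchange
with a value which occupies a position `> d`. The list `y` records the numbers `r`, and `p` is
the permutation of `w`. -/
inductive GrRel (c d : ℤ) : List ℕ → Perm ℤ → List ℕ → Prop
  | nil : GrRel c d [] 1 []
  | cons {a r : ℕ} {w y : List ℕ} {p : Perm ℤ} (h : GrRel c d w p y)
      (hr : p (d - r) = (a : ℤ) - c) (hd : d < p⁻¹ ((a : ℤ) - c + 1)) :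
      GrRel c d (a :: w) (swap ((a : ℤ) - c) ((a : ℤ) - c + 1) * p) (r :: y)

theorem GrRel.length_eq {c d : ℤ} {w y : List ℕ} {p : Perm ℤ} (h : GrRel c d w p y) :
    y.length = w.length := by
  induction h with
  | nil => rfl
  | cons h hr hd ih => simp [ih]

/-- The numbers of the moved positions determine the word. -/
theorem GrRel.eq_of_rows {c c' d : ℤ} {w w' y : List ℕ} {p p' : Perm ℤ} (h : GrRel c d w p y)
    (h' : GrRel c' d w' p' y) : p = p' ∧ shift w c = shift w' c' := by
  induction h generalizing w' p' with
  | nil => cases h'; exact ⟨rfl, rfl⟩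
  | @cons a r w y p h hr hd ih =>
    cases h' with
    | @cons a' _ w' _ p' h' hr' hd' =>
      obtain ⟨rfl, h1⟩ := ih h'
      have e : (a : ℤ) - c = (a' : ℤ) - c' := by rw [← hr, ← hr']
      refine ⟨by rw [e], ?_⟩
      funext i
      cases i with
      | zero => simpa [shift] using e
      | succ i => simpa [shift] using congrFun h1 i

theorem GrRel.grassmannian {c d : ℤ} {w y : List ℕ} {p : Perm ℤ} (h : GrRel c d w p y) :
    Grassmannian d p := by
  induction h with
  | nil => exact ⟨fun _ _ _ _ h => h, fun _ _ _ _ h => h⟩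
  | @cons a r w y p h hr hd ih =>
    have h1 : p⁻¹ ((a : ℤ) - c) = d - r := Perm.inv_eq_iff_eq.2 hr.symm
    exact ⟨StrictMonoOn.swap_mul ih.1 (Or.inr (by simpa using hd)),
      StrictMonoOn.swap_mul ih.2 (Or.inl (by rw [h1]; simp))⟩

/-- The number of moves of the position `d - k` is its displacement. -/
theorem GrRel.count_eq {c d : ℤ} {w y : List ℕ} {p : Perm ℤ} (h : GrRel c d w p y) (k : ℕ) :
    (y.count k : ℤ) = p (d - k) - (d - k) := by
  induction h with
  | nil => simp
  | @cons a r w y p h hr hd ih =>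
    rw [List.count_cons, Perm.mul_apply]
    by_cases hk : r = k
    · subst hk
      rw [hr] at ih ⊢
      rw [swap_apply_left]
      simp
      omega
    · rw [swap_apply_of_ne_of_ne]
      · simpa [hk] using ih
      · rw [← hr]
        exact p.injective.ne (by omega)
      · intro e
        rw [← Perm.eq_inv_iff_eq] at e
        omega

theorem GrRel.yamanouchi {c d : ℤ} {w y : List ℕ} {p : Perm ℤ} (h : GrRel c d w p y) :
    Yamanouchi y := by
  induction h with
  | nil => trivial
  | @cons a r w y p h hr hd ih =>
    refine ⟨ih, ?_⟩
    rcases Nat.eq_zero_or_pos r with h0 | h0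
    · exact Or.inl h0
    right
    have h1 := h.count_eq r
    have h2 := h.count_eq (r - 1)
    have e : d - ((r - 1 : ℕ) : ℤ) = d - r + 1 := by omega
    have h3 := h.grassmannian.1 (Set.mem_Iic.2 (show d - (r : ℤ) ≤ d by omega))
      (Set.mem_Iic.2 (show d - (r : ℤ) + 1 ≤ d by omega)) (by omega)
    have h4 : p (d - r + 1) ≠ (a : ℤ) - c + 1 := by
      rw [Ne, ← Perm.eq_inv_iff_eq]
      omega
    rw [e] at h2
    omega

/-- The ascents of a word of a Grassmannian permutation are the descents of the recorded
positions. -/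
theorem GrRel.lt_iff {c d : ℤ} {w y : List ℕ} {p : Perm ℤ} (h : GrRel c d w p y) {i : ℕ}
    (hi : i + 1 < w.length) : shift w c i < shift w c (i + 1) ↔ y.getD (i + 1) 0 < y.getD i 0 := by
  induction i generalizing w y p with
  | zero =>
    obtain _ | @⟨a, r, _, _, _, h, hr, hd⟩ := h
    · simp at hi
    obtain _ | @⟨b, s, _, _, p, h, hs, he⟩ := h
    · simp at hi
    simp only [shift, List.map_cons, List.getD_cons_zero, List.getD_cons_succ, zero_add]
    rw [Perm.mul_apply] at hr
    rcases eq_or_ne r s with rfl | hrs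
    · rw [hs, swap_apply_left] at hr
      omega
    · have h1 : p (d - r) ≠ p (d - s) := p.injective.ne (by omega)
      have h2 : p (d - r) ≠ (b : ℤ) - c + 1 := by
        rw [Ne, ← Perm.eq_inv_iff_eq]
        omega
      rw [swap_apply_of_ne_of_ne (by omega) h2] at hr
      rw [← hr, ← hs, h.grassmannian.1.lt_iff_lt (by simp) (by simp)]
      omega
  | succ i ih =>
    obtain _ | ⟨h, -, -⟩ := h
    · simp at hi
    exact ih h (by simpa using hi)

/-- Commuting letters can be exchanged together with the recorded positions. -/
theorem GrRel.swap {c d : ℤ} {a b r s : ℕ} {w y : List ℕ} {p : Perm ℤ}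
    (h : GrRel c d (a :: b :: w) p (r :: s :: y)) (hab : a + 1 < b ∨ b + 1 < a) :
    GrRel c d (b :: a :: w) p (s :: r :: y) := by
  obtain _ | @⟨_, _, _, _, _, h, hr, hd⟩ := h
  obtain _ | @⟨_, _, _, _, p, h, hs, he⟩ := h
  rw [Perm.mul_apply, swap_apply_eq_iff, Equiv.swap_apply_of_ne_of_ne (by omega) (by omega)] at hr
  rw [mul_inv_rev, swap_inv, Perm.mul_apply,
    Equiv.swap_apply_of_ne_of_ne (by omega) (by omega)] at hd
  rw [← mul_assoc, swap_comm_of_far (by omega), mul_assoc]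
  refine .cons (.cons h hr hd) ?_ ?_
  · rw [Perm.mul_apply, hs, Equiv.swap_apply_of_ne_of_ne (by omega) (by omega)]
  · rwa [mul_inv_rev, swap_inv, Perm.mul_apply,
      Equiv.swap_apply_of_ne_of_ne (by omega) (by omega)]

/-- Grassmannian permutations are fully commutative. -/
theorem GrRel.not_braid {c d : ℤ} {x y : ℕ} {w u : List ℕ} {p : Perm ℤ}
    (h : GrRel c d (x :: y :: x :: w) p u) : y ≠ x + 1 ∧ x ≠ y + 1 := by
  obtain _ | @⟨_, r₁, _, _, _, h, h1, h1'⟩ := h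
  obtain _ | @⟨_, r₂, _, _, _, h, h2, h2'⟩ := h
  obtain _ | @⟨_, r₃, _, _, p, h, h3, h3'⟩ := h
  constructor
  · rintro rfl
    -- After the last two letters, the value `x` occupies a position `> d`.
    have e : ((x + 1 : ℕ) : ℤ) - c = (x : ℤ) - c + 1 := by push_cast; ring
    rw [e, Perm.mul_apply, Perm.mul_apply, swap_apply_eq_iff,
      Equiv.swap_apply_of_ne_of_ne (a := (x : ℤ) - c + 1) (by omega) (by omega), swap_apply_eq_iff,
      Equiv.swap_apply_left, ← Perm.eq_inv_iff_eq] at h1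
    omega
  · rintro rfl
    -- After the last two letters, the value `y + 2` occupies a position `≤ d`.
    have e : ((y + 1 : ℕ) : ℤ) - c = (y : ℤ) - c + 1 := by push_cast; ring
    rw [e] at h1' h3
    simp only [mul_inv_rev, swap_inv, Perm.mul_apply] at h1'
    rw [Equiv.swap_apply_of_ne_of_ne (a := (y : ℤ) - c) (by omega) (by omega),
      Equiv.swap_apply_right, Perm.inv_eq_iff_eq.2 h3.symm] at h1'
    omega

theorem GrRel.knuth {c d : ℤ} {x y z x' y' z' : ℕ} {B Y : List ℕ} {p : Perm ℤ}
    (ht : CKTriple ((x : ℤ) - c) ((y : ℤ) - c) ((z : ℤ) - c) ((x' : ℤ) - c) ((y' : ℤ) - c)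
      ((z' : ℤ) - c)) (h : GrRel c d (x :: y :: z :: B) p Y) :
    ∃ Y', GrRel c d (x' :: y' :: z' :: B) p Y' ∧ KnuthAt 0 Y Y' := by
  obtain ⟨r, s, t, Y, rfl⟩ : ∃ r s t Y', Y = r :: s :: t :: Y' := by
    have := h.length_eq
    match Y, this with
    | r :: s :: t :: Y, _ => exact ⟨_, _, _, _, rfl⟩
  have d0 := h.lt_iff (i := 0) (by simp)
  have d1 := h.lt_iff (i := 1) (by simp)
  simp [shift] at d0 d1
  have hb := fun (e : z = x) => (e ▸ h : GrRel c d (x :: y :: x :: B) p _).not_braid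
  have swap₁ : (x + 1 < y ∨ y + 1 < x) → x' = y → y' = x → z' = z →
      ((x < z ∧ z < y) ∨ (y < z ∧ z < x)) →
      ∃ Y', GrRel c d (x' :: y' :: z' :: B) p Y' ∧ KnuthAt 0 (r :: s :: t :: Y) Y' := by
    rintro hf rfl rfl rfl hz
    have h' := h.swap hf
    have d1' := h'.lt_iff (i := 1) (by simp)
    simp [shift] at d1'
    refine ⟨_, h', .head _ ?_⟩
    unfold Knuth
    omega
  have swap₂ : (y + 1 < z ∨ z + 1 < y) → x' = x → y' = z → z' = y →
      ((y < x ∧ x < z) ∨ (z < x ∧ x < y)) →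
      ∃ Y', GrRel c d (x' :: y' :: z' :: B) p Y' ∧ KnuthAt 0 (r :: s :: t :: Y) Y' := by
    rintro hf rfl rfl rfl hz
    obtain _ | ⟨h, hr, hd⟩ := h
    have h' := GrRel.cons (h.swap hf) hr hd
    have d0' := h'.lt_iff (i := 0) (by simp)
    simp [shift] at d0'
    refine ⟨_, h', .head _ ?_⟩
    unfold Knuth
    omega
  generalize hx : (x : ℤ) - c = X at ht
  generalize hy : (y : ℤ) - c = Y at ht
  generalize hz : (z : ℤ) - c = Z at ht
  generalize hx' : (x' : ℤ) - c = X' at ht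
  generalize hy' : (y' : ℤ) - c = Y' at ht
  generalize hz' : (z' : ℤ) - c = Z' at ht
  cases ht with
  | acb h1 h2 => exact swap₁ (by omega) (by omega) (by omega) (by omega) (by omega)
  | cab h1 h2 => exact swap₁ (by omega) (by omega) (by omega) (by omega) (by omega)
  | bac h1 h2 => exact swap₂ (by omega) (by omega) (by omega) (by omega) (by omega)
  | bca h1 h2 => exact swap₂ (by omega) (by omega) (by omega) (by omega) (by omega)
  | up => have := hb (by omega); omega
  | down => have := hb (by omega); omega

/-- Coxeter–Knuth moves act on the recorded positions by Knuth moves. -/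
theorem GrRel.knuthAt {c d : ℤ} {A B : List ℕ} {x y z x' y' z' : ℕ} {Y : List ℕ} {p : Perm ℤ}
    (ht : CKTriple ((x : ℤ) - c) ((y : ℤ) - c) ((z : ℤ) - c) ((x' : ℤ) - c) ((y' : ℤ) - c)
      ((z' : ℤ) - c)) (h : GrRel c d (A ++ x :: y :: z :: B) p Y) :
    ∃ Y', GrRel c d (A ++ x' :: y' :: z' :: B) p Y' ∧ KnuthAt A.length Y Y' := by
  induction A generalizing Y p with
  | nil => exact h.knuth ht
  | cons a A ih =>
    simp only [List.cons_append] at h ⊢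
    obtain _ | ⟨h, hr, hd⟩ := h
    obtain ⟨Y', h1, h2⟩ := ih h
    exact ⟨_, .cons h1 hr hd, .cons _ h2⟩

theorem pre_shift_cons (a : ℕ) (u : List ℕ) (c : ℤ) (k : ℕ) :
    pre (shift (a :: u) c) (k + 1) =
      Equiv.swap ((a : ℤ) - c) ((a : ℤ) - c + 1) * pre (shift u c) k := by
  induction k with
  | zero => simp [pre_succ, shift]
  | succ k ih =>
    rw [pre_succ, ih, pre_succ, mul_assoc]
    rfl

theorem IsReducedWord.exists_grRel {u : List ℕ} (hu : IsReducedWord u) {c d : ℤ}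
    (h : Grassmannian d (pre (shift u c) u.length)) :
    ∃ y, GrRel c d u (pre (shift u c) u.length) y := by
  induction u with
  | nil => exact ⟨[], .nil⟩
  | cons a u ih =>
    have hred := (isReducedWord_iff hu.1 c).1 hu
    have hlt := hred.pos_lt_after (i := 0) (k := (a :: u).length) (x := (a : ℤ) - c)
      (y := (a : ℤ) - c + 1) (by simp [tr, shift]) (by omega) (by simp) le_rfl
    rw [pos, pos] at hlt
    have hle : (pre (shift (a :: u) c) (a :: u).length)⁻¹ ((a : ℤ) - c + 1) ≤ d := by
      by_contra hgt
      have := h.2 (Set.mem_Ioi.2 (by omega)) (Set.mem_Ioi.2 (by omega)) hlt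
      simp at this
    have hgt : d < (pre (shift (a :: u) c) (a :: u).length)⁻¹ ((a : ℤ) - c) := by
      by_contra hle'
      have := h.1 (Set.mem_Iic.2 hle) (Set.mem_Iic.2 (by omega)) hlt
      simp at this
    have hp := pre_shift_cons a u c u.length
    rw [← List.length_cons (a := a)] at hp
    have hp' : pre (shift u c) u.length = Equiv.swap ((a : ℤ) - c) ((a : ℤ) - c + 1) *
        pre (shift (a :: u) c) (a :: u).length := by
      rw [hp, ← mul_assoc, swap_mul_self, one_mul]
    obtain ⟨y, hy⟩ := ih (IsReducedWord.of_append_right (u := [a]) (by simpa using hu)) (by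
      rw [hp']
      exact ⟨StrictMonoOn.swap_mul h.1 (Or.inl (by simpa using hgt)),
        StrictMonoOn.swap_mul h.2 (Or.inr (by simpa using hle))⟩)
    rw [hp]
    set q := pre (shift (a :: u) c) (a :: u).length
    refine ⟨(d - q⁻¹ ((a : ℤ) - c + 1)).toNat :: y, .cons hy ?_ ?_⟩
    · rw [Int.toNat_of_nonneg (by omega), sub_sub_cancel, hp']
      simp
    · rw [hp', mul_inv_rev, swap_inv, Perm.mul_apply, swap_apply_right]
      exact hgt

/-- The recorded positions behave like the rows recorded by Edelman–Greene insertion. -/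
theorem knuthBisim_grRel (c d : ℤ) : KnuthBisim fun y z =>
    ∃ u p, IsReducedWord u ∧ y = rowsOf u ∧ GrRel c d u p z := by
  have hlt : ∀ {y z : List ℕ}, (∃ u p, IsReducedWord u ∧ y = rowsOf u ∧ GrRel c d u p z) →
      ∀ i, i + 1 < y.length → (y.getD (i + 1) 0 < y.getD i 0 ↔ z.getD (i + 1) 0 < z.getD i 0) := by
    rintro _ z ⟨u, p, hu, rfl, hz⟩ i hi
    rw [hu.length_rowsOf] at hi
    rw [← hu.lt_iff c hi, hz.lt_iff hi]
  have hlen : ∀ {y z : List ℕ}, (∃ u p, IsReducedWord u ∧ y = rowsOf u ∧ GrRel c d u p z) →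
      y.length = z.length := by
    rintro _ z ⟨u, p, hu, rfl, hz⟩
    rw [hu.length_rowsOf, hz.length_eq]
  refine ⟨hlen, ?_, ?_, hlt, ?_⟩
  · rintro _ z ⟨u, p, hu, rfl, hz⟩
    exact hu.egRel.yamanouchi.1
  · rintro _ z ⟨u, p, hu, rfl, hz⟩
    exact hz.yamanouchi
  · intro y z hr k hk
    have hp : k + 2 < y.length ∧
        (y.getD (k + 1) 0 < y.getD k 0 ↔ ¬ y.getD (k + 2) 0 < y.getD (k + 1) 0) := by
      rcases hk with ⟨y', h⟩ | ⟨z', h⟩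
      · exact h.peak_or_valley
      · have := h.peak_or_valley
        rw [← hlen hr] at this
        rwa [hlt hr k (by omega), hlt hr (k + 1) (by omega)]
    obtain ⟨u, p, hu, rfl, hz⟩ := hr
    rw [hu.length_rowsOf] at hp
    obtain ⟨u', hu', hl', hck⟩ := hu.exists_ck c hp.1 hp.2
    have hk' := hck.knuthAt hl' hp.1 hu hu'
    obtain ⟨A, x, y, z, x', y', z', B, rfl, rfl, rfl, ht⟩ := hck.exists_append hl' hp.1
    obtain ⟨Y', h1, h2⟩ := hz.knuthAt ht
    exact ⟨_, Y', ⟨_, p, hu', rfl, h1⟩, hk', h2⟩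

/-- For a word of a Grassmannian permutation, Edelman–Greene insertion records the moved
positions. -/
theorem IsReducedWord.grRel_rowsOf {u : List ℕ} (hu : IsReducedWord u) {c d : ℤ}
    (h : Grassmannian d (pre (shift u c) u.length)) :
    GrRel c d u (pre (shift u c) u.length) (rowsOf u) := by
  obtain ⟨y, hy⟩ := hu.exists_grRel h
  rwa [(knuthBisim_grRel c d).eq ⟨u, _, hu, rfl, hy⟩]

/-! ### Words with the same recording tableau communicate -/

theorem pre_sub (w : ℕ → ℤ) (t : ℤ) (k : ℕ) (x : ℤ) :
    pre (fun i => w i - t) k (x - t) = pre w k x - t := by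
  induction k generalizing x with
  | zero => rfl
  | succ k ih =>
    have e : Equiv.swap (w k - t) (w k - t + 1) (x - t) = Equiv.swap (w k) (w k + 1) x - t := by
      simp only [swap_apply_def]
      split_ifs <;> omega
    rw [pre_succ, pre_succ, Perm.mul_apply, Perm.mul_apply, e, ih]

theorem pre_shift_sub (u : List ℕ) (c t x : ℤ) :
    pre (shift u (c + t)) u.length (x - t) = pre (shift u c) u.length x - t := by
  rw [← pre_sub, pre_congr]
  intro j hj
  rw [shift_of_lt hj, shift_of_lt hj]
  ring

/-- A sequence of bumps of integer words comes from Little bumps of words of positive integers;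
there is no renormalisation if the result is positive anyway. -/
theorem exists_communicate {m : ℕ} {w y : ℕ → ℤ} (h : Relation.ReflTransGen (BumpMove m) w y)
    {u : List ℕ} {c : ℤ} (hu : IsReducedWord u) (hw : w = shift u c) (hm : m = u.length) :
    ∃ v c', Communicate u v ∧ IsReducedWord v ∧ v.length = u.length ∧ shift v c' = y ∧
      ((∀ k < m, -c < y k) → c' = c) ∧ ∀ k, y k ≤ w k := by
  induction h using Relation.ReflTransGen.head_induction_on generalizing u c with
  | refl => exact ⟨u, c, .refl _, hu, rfl, hw.symm, fun _ => rfl, fun _ => le_rfl⟩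
  | @head w w₁ h _ ih =>
    obtain ⟨-, i, hn, hb⟩ := h
    obtain ⟨u₁, c₁, h1, h2, h3⟩ := hb.bumpFrom hw hm hu.1 hn.1
    subst hw hm
    obtain ⟨hw₁, hl₁, -⟩ := h1.bump hu.1 hn.1 c
    have hu₁ : IsReducedWord u₁ := by
      rw [isReducedWord_iff hw₁ c₁, h2, hl₁]
      exact hb.red
    obtain ⟨v, c', g1, g2, g3, g4, g5, g6⟩ := ih hu₁ h2.symm hl₁.symm
    refine ⟨v, c', .trans _ _ _ (.rel _ _ ⟨hu, i, hn.1,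
      (isReducedWord_eraseIdx_iff hu.1 hn.1 c).2 hn, h1⟩) g1, g2, by omega, g4, fun hp => ?_,
      fun k => (g6 k).trans (hb.le.1 k)⟩
    have e := h3 fun k hk => (hp k hk).trans_le (g6 k)
    subst e
    exact g5 hp

/-- Every reduced word communicates with a word `v` of a Grassmannian permutation, up to a shift of
the letters: the difference `c' - c` counts the renormalisations. -/
theorem IsReducedWord.exists_grassmannian {u : List ℕ} (hu : IsReducedWord u) {c d : ℤ}
    (hd : StrictMonoOn (pre (shift u c) u.length) (Set.Iic d)) :
    ∃ v c', Communicate u v ∧ IsReducedWord v ∧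
      GrRel c' d v (pre (shift v c') v.length) (rowsOf u) ∧
      ((∀ k < u.length, -c < shift v c' k) → c' = c) := by
  obtain ⟨y, h1, h2⟩ := ((isReducedWord_iff hu.1 c).1 hu).exists_grassmannian hd
  obtain ⟨v, c', g1, g2, g3, rfl, g5, -⟩ := exists_communicate h1 hu rfl rfl
  refine ⟨v, c', g1, g2, ?_, g5⟩
  rw [g1.rowsOf_eq]
  rw [← g3] at h2
  exact g2.grRel_rowsOf h2

/-- Two Grassmannian words with the same recorded rows differ by a shift of the letters, which can
be achieved by Little bumps. -/
theorem communicate_of_grRel {v v' y : List ℕ} {p p' : Perm ℤ} {c c' d : ℤ} (hv : IsReducedWord v)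
    (hv' : IsReducedWord v') (h : GrRel c d v p y) (h' : GrRel c' d v' p' y) (hy : y = rowsOf v')
    (hp' : p' = pre (shift v' c') v'.length) (hc : c ≤ c') : Communicate v v' := by
  -- The word `v'` arises from `v` by increasing all letters by `c' - c`. Seen with the offset `c`,
  -- its permutation increases up to `d + (c' - c)`, and it can be bumped to a Grassmannian word
  -- with descent `d`, which has to be `v` because of its recorded rows.
  have hmono : StrictMonoOn (pre (shift v' c) v'.length) (Set.Iic d) := by
    intro a ha b hb hab
    simp only [Set.mem_Iic] at ha hb
    have := h'.grassmannian.1 (Set.mem_Iic.2 (show a - (c' - c) ≤ d by omega))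
      (Set.mem_Iic.2 (show b - (c' - c) ≤ d by omega)) (by omega)
    rw [hp', show c' = c + (c' - c) by ring, show c + (c' - c) - c = c' - c by ring, pre_shift_sub,
      pre_shift_sub] at this
    omega
  obtain ⟨v'', c'', g1, g2, g3, g4⟩ := hv'.exists_grassmannian hmono
  rw [← hy] at g3
  have e := (g3.eq_of_rows h).2
  have hl : v''.length = v.length := by rw [← g3.length_eq, h.length_eq]
  have hl' : v'.length = v.length := by rw [← h'.length_eq, h.length_eq]
  obtain rfl := g4 (by rw [e, hl']; exact hv.1.lt_shift c)
  obtain rfl := shift_inj hl fun i _ => congrFun e i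
  exact .symm _ _ g1

/-- Both words communicate with Grassmannian words, which are determined by the recorded rows up
to a shift. -/
theorem communicate_of_rowsOf_eq {u u' : List ℕ} (hu : IsReducedWord u) (hu' : IsReducedWord u')
    (h : rowsOf u = rowsOf u') : Communicate u u' := by
  have hmono : ∀ u : List ℕ, IsReducedWord u →
      StrictMonoOn (pre (shift u 0) u.length) (Set.Iic 0) := by
    intro u hu a ha b hb hab
    have key : ∀ x ≤ 0, pre (shift u 0) u.length x = x := fun x hx =>
      ((pos_eq_iff _ _ _ _).1 (pos_of_lt_letters (hu.1.lt_shift 0) (by simpa using hx))).symm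
    rwa [key a ha, key b hb]
  obtain ⟨v, c, h1, h2, h3, -⟩ := hu.exists_grassmannian (hmono u hu)
  obtain ⟨v', c', h1', h2', h3', -⟩ := hu'.exists_grassmannian (hmono u' hu')
  refine .trans _ _ _ h1 (.trans _ _ _ ?_ (.symm _ _ h1'))
  rw [h] at h3
  rcases le_total c c' with hc | hc
  · exact communicate_of_grRel h2 h2' h3 h3' h1'.rowsOf_eq rfl hc
  · exact .symm _ _ (communicate_of_grRel h2' h2 h3' h3 (h.symm.trans h1.rowsOf_eq) rfl hc)

end LittleBumps

theorem theorem2 (v w : List ℕ) (hv : LittleBumps.IsReducedWord v)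
    (hw : LittleBumps.IsReducedWord w) :
    LittleBumps.Communicate v w ↔ LittleBumps.Q v = LittleBumps.Q w := by
  rw [LittleBumps.Q_eq_iff]
  exact ⟨LittleBumps.Communicate.rowsOf_eq, LittleBumps.communicate_of_rowsOf_eq hv hw⟩
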